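/- Let $n\ge 1$, $\ell>0$, $k\in\mathbb R$, and let $M$ be a smooth $(2n+1)$-dimensional manifold, possibly with boundary. Let $P_a, J_{ab}$ ($a,b=0,\dots,2n$) be the generators of the AdS algebra $\mathfrak{so}(2n,2)$, $[P_a,P_b]=\ell^{-2}J_{ab}$, $[J_{ab},P_c]=\eta_{cb}P_a-\eta_{ca}P_b$, $[J_{ab},J_{cd}]=\eta_{cb}J_{ad}-\eta_{ca}J_{bd}+\eta_{db}J_{ca}-\eta_{da}J_{cb}$, $\eta=\mathrm{diag}(-1,1,\dots,1)$, and let $\langle\cdots\rangle$ be the symmetric polynomial of rank $n+1$ on $\mathfrak{so}(2n,2)$ with $$\langle J_{a_1a_2}\cdots J_{a_{2n-1}a_{2n}}P_{a_{2n+1}}\rangle=\frac{2^n}{\ell}\,\varepsilon_{a_1\cdots a_{2n+1}}$$ and vanishing on all other combinations of generators. For smooth $\mathfrak{so}(2n,2)$-valued one-forms $A_i$ on $M$ put $A^2=\tfrac12[A,A]$, $F_A=dA+A^2$ and $$Q^{(2n+1)}_{A_1\leftarrow A_0}=(n+1)\int_0^1\!dt\,\big\langle (A_1-A_0)\,F_{A_0+t(A_1-A_0)}^{\,n}\big\rangle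 ,$$ $$Q^{(2n)}_{A_2\leftarrow A_1\leftarrow A_0}=n(n+1)\int_0^1\!dt\int_0^t\!ds\,\big\langle (A_2-A_1)(A_1-A_0)\,F_{A_0+t(A_1-A_0)+s(A_2-A_1)}^{\,n-1}\big\rangle .$$ Let $e^a,\omega^{ab},\bar\omega^{ab}$ be smooth real one-forms on $M$, and $e=e^aP_a$, $\omega=\tfrac12\omega^{ab}J_{ab}$, $\bar\omega=\tfrac12\bar\omega^{ab}J_{ab}$, $R=d\omega+\omega^2$, $T=de+[\omega,e]$. Then: 1. $Q^{(2n)}_{e+\omega\leftarrow\omega\leftarrow\bar\omega}$ is smooth, and the transgression lagrangian $L=k\,Q^{(2n+1)}_{e+\omega\leftarrow\bar\omega}$ is the canonical Lanczos--Lovelock lagrangian plus an exact term: $$L=(n+1)k\int_0^1\!dt\,\big\langle e\,(R+t^2e^2)^n\big\rangle+k\,dQ^{(2n)}_{e+\omega\leftarrow\omega\leftarrow\bar\omega}.$$ 2. $Q^{(2n+1)}_{\omega\leftarrow\bar\omega}=0$. 3. If $k\ne0$, then $(e,\omega,\bar\omega)$ satisfies the field equations of $L$ (that is, the first variation of the action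 $\int L$ vanishes for all independent smooth variations of $e^a$, $\omega^{ab}$, $\bar\omega^{ab}$ supported in a compact subset of the interior of a coordinate patch) if and only if, on $M$, for all $a,b$, $$\big\langle J_{ab}\,(R+e^2)^{n-1}\,T\big\rangle=0,\qquad \big\langle P_a\,(R+e^2)^n\big\rangle=0 .$$ -/

import Mathlib

open Set Topology MeasureTheory
open scoped ContDiff Manifold

noncomputable section

namespace TGFT

/-! ### Exterior algebra at a point: wedge products of vector-valued alternating forms -/

section Pointwise

variable {E V W X : Type*}
  [NormedAddCommGroup E] [NormedSpace ℝ E] [NormedAddCommGroup V] [NormedSpace ℝ V]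
  [NormedAddCommGroup W] [NormedSpace ℝ W] [NormedAddCommGroup X] [NormedSpace ℝ X]

/-- The tensor product `(u, v) ↦ B (α u) (β v)` of two alternating forms, paired by `B`. -/
def tensor {p q : ℕ} (B : V →L[ℝ] W →L[ℝ] X) (α : E [⋀^Fin p]→L[ℝ] V) (β : E [⋀^Fin q]→L[ℝ] W) :
    ContinuousMultilinearMap ℝ (fun _ : Fin p ⊕ Fin q => E) X :=
  ContinuousMultilinearMap.uncurrySum
    ((((ContinuousLinearMap.compContinuousMultilinearMapL ℝ (fun _ : Fin q => E) W X).flip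
      β.toContinuousMultilinearMap).comp B).compContinuousMultilinearMap
        α.toContinuousMultilinearMap)

/-- The wedge product of a `V`-valued `p`-form and a `W`-valued `q`-form with respect to the
bilinear map `B : V × W → X`, as an `l`-form, where `l = p + q`. The normalization is the usual
one (sum over shuffles), see `wedge_apply`. -/
def wedge {p q l : ℕ} (B : V →L[ℝ] W →L[ℝ] X) (h : p + q = l)
    (α : E [⋀^Fin p]→L[ℝ] V) (β : E [⋀^Fin q]→L[ℝ] W) : E [⋀^Fin l]→L[ℝ] X :=
  ((p.factorial : ℝ) * q.factorial)⁻¹ •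
    ContinuousMultilinearMap.alternatization
      ((tensor B α β).domDomCongr (finSumFinEquiv.trans (finCongr h)))

theorem wedge_apply {p q : ℕ} (B : V →L[ℝ] W →L[ℝ] X)
    (α : E [⋀^Fin p]→L[ℝ] V) (β : E [⋀^Fin q]→L[ℝ] W) (v : Fin (p + q) → E) :
    wedge B rfl α β v = ((p.factorial : ℝ) * q.factorial)⁻¹ •
      ∑ σ : Equiv.Perm (Fin (p + q)), Equiv.Perm.sign σ •
        B (α fun i => v (σ (Fin.castAdd q i))) (β fun j => v (σ (Fin.natAdd p j))) := by
  rw [wedge, ContinuousAlternatingMap.smul_apply,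
    ContinuousMultilinearMap.alternatization_apply_apply]
  rfl

/-- Multilinear forms of rank `r` on `V`. -/
abbrev Poly (V : Type*) [NormedAddCommGroup V] [NormedSpace ℝ V] (r : ℕ) :=
  ContinuousMultilinearMap ℝ (fun _ : Fin r => V) ℝ

/-- Insertion of a vector into the first slot of a multilinear form. -/
def insertFirst (V : Type*) [NormedAddCommGroup V] [NormedSpace ℝ V] (r : ℕ) :
    Poly V (r + 1) →L[ℝ] V →L[ℝ] Poly V r :=
  (continuousMultilinearCurryLeftEquiv ℝ (fun _ : Fin (r + 1) => V) ℝ).toContinuousLinearEquiv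

/-- Change of the degree along an equality. -/
def castDeg {p l : ℕ} (h : p = l) (α : E [⋀^Fin p]→L[ℝ] V) : E [⋀^Fin l]→L[ℝ] V := h ▸ α

/-- For a form `Ψ` with values in the multilinear forms of rank `r` and a `V`-valued two-form `F`,
the real-valued form obtained by filling all `r` slots with `F`. -/
def fill {V : Type*} [NormedAddCommGroup V] [NormedSpace ℝ V] :
    {r p l : ℕ} → (p + 2 * r = l) → E [⋀^Fin p]→L[ℝ] Poly V r → E [⋀^Fin 2]→L[ℝ] V →
      E [⋀^Fin l]→L[ℝ] ℝ
  | 0, _, _, h, Ψ, _ =>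
      ((continuousMultilinearCurryFin0 ℝ V ℝ).toContinuousLinearEquiv :
        Poly V 0 →L[ℝ] ℝ).compContinuousAlternatingMap (castDeg h Ψ)
  | r + 1, _, _, h, Ψ, F => fill (by omega) (wedge (insertFirst V r) rfl Ψ F) F

/-- Constants as zero-forms. -/
def const0 (c : V) : E [⋀^Fin 0]→L[ℝ] V :=
  ContinuousAlternatingMap.constOfIsEmpty ℝ E (Fin 0) c

/-- `⟨Z Fⁿ⟩` for a `p`-form `Z`, a two-form `F` and a polynomial of rank `n + 1`. -/
def angle₁ {n p l : ℕ} (f : Poly V (n + 1)) (h : p + 2 * n = l)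
    (Z : E [⋀^Fin p]→L[ℝ] V) (F : E [⋀^Fin 2]→L[ℝ] V) : E [⋀^Fin l]→L[ℝ] ℝ :=
  fill h (wedge (insertFirst V n) (zero_add p) (const0 f) Z) F

/-- `⟨Y Z Fⁿ⁻¹⟩` for a `p`-form `Y`, a `q`-form `Z`, a two-form `F` and a polynomial of rank
`n + 1`, where `n ≥ 1` (for `n = 0`, where the expression has no meaning, it is set to zero). The place of the even
forms among the arguments is immaterial when the polynomial is symmetric. -/
def angle₂ : {n p q l : ℕ} → (f : Poly V (n + 1)) → (p + q + 2 * n = l + 2) →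
    E [⋀^Fin p]→L[ℝ] V → E [⋀^Fin q]→L[ℝ] V → E [⋀^Fin 2]→L[ℝ] V → E [⋀^Fin l]→L[ℝ] ℝ
  | 0, _, _, _, _, _, _, _, _ => 0
  | m + 1, p, _, _, f, h, Y, Z, F =>
      fill (by omega) (wedge (insertFirst V m) rfl
        (wedge (insertFirst V (m + 1)) (zero_add p) (const0 f) Y) Z) F

end Pointwise

/-! ### The anti-de Sitter algebra `so(2n,2)` and the Levi-Civita polynomial -/

section Algebra

attribute [local instance] LieRing.ofAssociativeRing

/-- The Lie algebra `so(2n,2)` of real matrices that are skew-adjoint with respect to the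
diagonal form with `2n` entries `+1` and two entries `-1`. -/
def AdS (n : ℕ) : Type := LieAlgebra.Orthogonal.so' (Fin (2 * n)) (Fin 2) ℝ

variable {n : ℕ}

instance instLieRingAdS : LieRing (AdS n) :=
  inferInstanceAs (LieRing (LieAlgebra.Orthogonal.so' (Fin (2 * n)) (Fin 2) ℝ))

instance instLieAlgebraAdS : LieAlgebra ℝ (AdS n) :=
  inferInstanceAs (LieAlgebra ℝ (LieAlgebra.Orthogonal.so' (Fin (2 * n)) (Fin 2) ℝ))

/-- The inclusion of `so(2n,2)` into the space of matrices. -/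
def toMat (n : ℕ) : AdS n →ₗ[ℝ] Matrix (Fin (2 * n) ⊕ Fin 2) (Fin (2 * n) ⊕ Fin 2) ℝ :=
  (LieAlgebra.Orthogonal.so' (Fin (2 * n)) (Fin 2) ℝ).toSubmodule.subtype

theorem toMat_injective : Function.Injective (toMat n) := fun _ _ h => Subtype.ext h

/-- `so(2n,2)` is normed by the maximum of the absolute values of the matrix entries. -/
instance instNormedAddCommGroupAdS : NormedAddCommGroup (AdS n) :=
  letI := Matrix.normedAddCommGroup (m := Fin (2 * n) ⊕ Fin 2) (n := Fin (2 * n) ⊕ Fin 2) (α := ℝ)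
  NormedAddCommGroup.induced _ _ (toMat n) toMat_injective

instance instNormedSpaceAdS : NormedSpace ℝ (AdS n) :=
  letI := Matrix.normedAddCommGroup (m := Fin (2 * n) ⊕ Fin 2) (n := Fin (2 * n) ⊕ Fin 2) (α := ℝ)
  letI := Matrix.normedSpace (m := Fin (2 * n) ⊕ Fin 2) (n := Fin (2 * n) ⊕ Fin 2)
    (α := ℝ) (R := ℝ)
  NormedSpace.induced ℝ _ _ (toMat n)

instance instFiniteDimensionalAdS : FiniteDimensional ℝ (AdS n) :=
  FiniteDimensional.of_injective (toMat n) toMat_injective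

/-- The Lie bracket of `so(2n,2)` as a continuous bilinear map. -/
def bracket (n : ℕ) : AdS n →L[ℝ] AdS n →L[ℝ] AdS n :=
  LinearMap.toContinuousBilinearMap
    (LieModule.toEnd ℝ (AdS n) (AdS n) : AdS n →ₗ[ℝ] AdS n →ₗ[ℝ] AdS n)

/-- The diagonal entries of the form of signature `(2n,2)`. -/
def eta : Fin (2 * n) ⊕ Fin 2 → ℝ := Sum.elim (fun _ => 1) (fun _ => -1)

/-- The generator `v ↦ ⟨B, v⟩ A - ⟨A, v⟩ B` of `so(2n,2)`, for basis vectors `A` and `B`. -/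
def gen (A B : Fin (2 * n) ⊕ Fin 2) : AdS n :=
  ⟨Matrix.single A B (eta B) - Matrix.single B A (eta A), by
    rw [LieAlgebra.Orthogonal.so', mem_skewAdjointMatricesLieSubalgebra,
      mem_skewAdjointMatricesSubmodule, Matrix.IsSkewAdjoint, Matrix.IsAdjointPair]
    ext i j
    simp only [LieAlgebra.Orthogonal.indefiniteDiagonal, Matrix.mul_diagonal,
      Matrix.diagonal_mul, Matrix.transpose_apply, Matrix.sub_apply, Matrix.neg_apply,
      Matrix.single_apply]
    change _ * eta j = eta i * _
    by_cases h1 : A = j <;> by_cases h2 : B = i <;> by_cases h3 : B = j <;>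
      by_cases h4 : A = i <;> simp_all⟩

/-- The Lorentz indices `0, 1, …, 2n`, with `0` the time direction, as indices of the ambient
`(2n,2)`-space; the remaining ambient index is `Sum.inr 1`. -/
def lor : Fin (2 * n + 1) → Fin (2 * n) ⊕ Fin 2 := Fin.cons (Sum.inr 0) Sum.inl

/-- The Lorentz generators `J_{ab}`. -/
def J (a b : Fin (2 * n + 1)) : AdS n := gen (lor a) (lor b)

/-- The AdS boosts `P_a`, for AdS radius `ℓ`. -/
def P (ℓ : ℝ) (a : Fin (2 * n + 1)) : AdS n := ℓ⁻¹ • gen (lor a) (Sum.inr 1)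

/-- The component `X^{ab}` of `X = X^a P_a + ½ X^{ab} J_{ab}`. -/
def compJ (a b : Fin (2 * n + 1)) : AdS n →L[ℝ] ℝ :=
  LinearMap.toContinuousLinearMap
    (eta (lor b) • (Matrix.entryLinearMap ℝ ℝ (lor a) (lor b)).comp (toMat n))

/-- The component `X^a` of `X = X^a P_a + ½ X^{ab} J_{ab}`. -/
def compP (ℓ : ℝ) (a : Fin (2 * n + 1)) : AdS n →L[ℝ] ℝ :=
  LinearMap.toContinuousLinearMap
    ((-ℓ) • (Matrix.entryLinearMap ℝ ℝ (lor a) (Sum.inr 1)).comp (toMat n))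

theorem lor_inj : Function.Injective (lor (n := n)) := by
  intro a b; refine Fin.cases ?_ (fun a => ?_) a <;> refine Fin.cases ?_ (fun b => ?_) b <;>
    simp [lor]

theorem lor_ne (a : Fin (2*n+1)) : lor a ≠ Sum.inr 1 := by
  refine Fin.cases ?_ (fun a => ?_) a <;> simp [lor]

theorem eta_sq (A : Fin (2*n) ⊕ Fin 2) : eta A * eta A = 1 := by cases A <;> simp [eta]

theorem compJ_J (a b c d : Fin (2*n+1)) : compJ a b (J c d) =
    (if a = c ∧ b = d then 1 else 0) - (if a = d ∧ b = c then 1 else 0) := by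
  change eta (lor b) * ((Matrix.single (lor c) (lor d) (eta (lor d)) - Matrix.single (lor d) (lor c) (eta (lor c)) : Matrix (Fin (2*n) ⊕ Fin 2) (Fin (2*n) ⊕ Fin 2) ℝ) (lor a) (lor b)) = _
  have := eta_sq (lor b)
  simp only [Matrix.sub_apply, Matrix.single_apply, lor_inj.eq_iff]
  grind

theorem compP_P (ℓ : ℝ) (hℓ : ℓ ≠ 0) (a c : Fin (2*n+1)) : compP ℓ a (P ℓ c) = if a = c then 1 else 0 := by
  change -ℓ * (ℓ⁻¹ * ((Matrix.single (lor c) (Sum.inr 1) (eta (Sum.inr 1)) - Matrix.single (Sum.inr 1) (lor c) (eta (lor c)) : Matrix (Fin (2*n) ⊕ Fin 2) (Fin (2*n) ⊕ Fin 2) ℝ) (lor a) (Sum.inr 1)) ) = _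
  have h := lor_ne a
  have h' := lor_ne c
  simp only [Matrix.sub_apply, Matrix.single_apply, lor_inj.eq_iff]
  simp [eta, h, h', Ne.symm h, Ne.symm h', eq_comm]
  split_ifs <;> simp [hℓ]

theorem compP_J (ℓ : ℝ) (a c d : Fin (2*n+1)) : compP ℓ a (J c d) = 0 := by
  change -ℓ * (((Matrix.single (lor c) (lor d) (eta (lor d)) - Matrix.single (lor d) (lor c) (eta (lor c)) : Matrix (Fin (2*n) ⊕ Fin 2) (Fin (2*n) ⊕ Fin 2) ℝ) (lor a) (Sum.inr 1)) ) = _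
  simp [Matrix.sub_apply, Matrix.single_apply, lor_ne]

theorem compJ_P (ℓ : ℝ) (a b c : Fin (2*n+1)) : compJ a b (P ℓ c) = 0 := by
  change eta (lor b) * (ℓ⁻¹ * ((Matrix.single (lor c) (Sum.inr 1) (eta (Sum.inr 1)) - Matrix.single (Sum.inr 1) (lor c) (eta (lor c)) : Matrix (Fin (2*n) ⊕ Fin 2) (Fin (2*n) ⊕ Fin 2) ℝ) (lor a) (lor b)) ) = _
  simp [Matrix.sub_apply, Matrix.single_apply, Ne.symm (lor_ne _)]
/-- The commutation relations; with `J_{ab} = gen a b` and `P_a = ℓ⁻¹ gen a *`, where `*` is the last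
index, they contain `[P_a, P_b] = ℓ⁻² J_{ab}` and `[J_{ab}, P_c] = η_{cb} P_a - η_{ca} P_b`. -/
theorem gen_lie (A B C D : Fin (2*n) ⊕ Fin 2) : ⁅gen A B, gen C D⁆ =
    (if C = B then eta C else 0) • gen A D - (if C = A then eta C else 0) • gen B D
     + (if D = B then eta D else 0) • gen C A - (if D = A then eta D else 0) • gen C B := by
  refine toMat_injective ?_
  simp only [map_add, map_sub, map_smul]
  change (Matrix.single A B (eta B) - Matrix.single B A (eta A)) * (Matrix.single C D (eta D) - Matrix.single D C (eta C))
    - (Matrix.single C D (eta D) - Matrix.single D C (eta C)) * (Matrix.single A B (eta B) - Matrix.single B A (eta A)) =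
    _ • (Matrix.single A D (eta D) - Matrix.single D A (eta A))
    - _ • (Matrix.single B D (eta D) - Matrix.single D B (eta B))
    + _ • (Matrix.single C A (eta A) - Matrix.single A C (eta C))
    - _ • (Matrix.single C B (eta B) - Matrix.single B C (eta C))
  simp only [sub_mul, mul_sub]
  by_cases h1 : C = B <;> by_cases h2 : C = A <;> by_cases h3 : D = B <;> by_cases h4 : D = A <;>
    subst_vars <;> simp_all [Matrix.single_mul_single_of_ne, Ne.symm, eq_comm, smul_sub] <;>
    simp_all [Matrix.single_mul_single_of_ne, mul_comm, Ne.symm] <;> try abel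

/-- The Levi-Civita symbol, with `ε_{0 1 … 2n} = 1`. -/
def epsilon (a : Fin (2 * n + 1) → Fin (2 * n + 1)) : ℝ :=
  ((1 : Matrix (Fin (2 * n + 1)) (Fin (2 * n + 1)) ℝ).submatrix a id).det

/-- The positions `0, 2, …, 2n-2` (for `s = 0`) and `1, 3, …, 2n-1` (for `s = 1`). -/
def pos (j : Fin n) (s : Fin 2) : Fin (2 * n + 1) := ⟨2 * j + s, by omega⟩

/-- The Levi-Civita polynomial of rank `n + 1` on `so(2n,2)`: with `X = X^a P_a + ½ X^{ab} J_{ab}`,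
it is `ℓ⁻¹ ∑ᵢ ∑ ε_{a₁ … a_{2n+1}} Y₁^{a₁ a₂} ⋯ Yₙ^{a_{2n-1} a_{2n}} Xᵢ^{a_{2n+1}}`, where
`Y₁, …, Yₙ` are the arguments other than `Xᵢ`. -/
def leviCivita (n : ℕ) (ℓ : ℝ) : Poly (AdS n) (n + 1) :=
  ℓ⁻¹ • ∑ i : Fin (n + 1), ∑ a : Fin (2 * n + 1) → Fin (2 * n + 1), epsilon a •
    (ContinuousMultilinearMap.mkPiAlgebra ℝ (Fin (n + 1)) ℝ).compContinuousLinearMap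
      (i.insertNth (α := fun _ => AdS n →L[ℝ] ℝ) (compP ℓ (a (Fin.last (2 * n))))
        (fun j => compJ (a (pos j 0)) (a (pos j 1))))

theorem leviCivita_apply (ℓ : ℝ) (Z : Fin (n + 1) → AdS n) :
    leviCivita n ℓ Z = ℓ⁻¹ * ∑ i : Fin (n + 1), ∑ a : Fin (2 * n + 1) → Fin (2 * n + 1),
      epsilon a * (compP ℓ (a (Fin.last (2 * n))) (Z i) *
        ∏ j : Fin n, compJ (a (pos j 0)) (a (pos j 1)) (Z (i.succAbove j))) := by
  simp only [leviCivita, smul_apply, sum_apply, smul_eq_mul,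
    ContinuousMultilinearMap.compContinuousLinearMap_apply,
    ContinuousMultilinearMap.mkPiAlgebra_apply]
  congr 1
  refine Finset.sum_congr rfl fun i _ => Finset.sum_congr rfl fun a _ => ?_
  rw [Fin.prod_univ_succAbove _ i]
  simp

theorem pos_inj {j k : Fin n} {s t : Fin 2} (h : pos j s = pos k t) : j = k ∧ s = t := by
  simp only [pos, Fin.mk.injEq] at h
  constructor <;> ext <;> omega

theorem pos_ne_last (j : Fin n) (s : Fin 2) : pos j s ≠ Fin.last (2*n) := by
  intro h; have := congrArg Fin.val h; simp [pos] at this; omega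

theorem epsilon_swap (a : Fin (2*n+1) → Fin (2*n+1)) (x y) (h : x ≠ y) :
    epsilon (a ∘ Equiv.swap x y) = - epsilon a := by
  unfold epsilon
  have := Matrix.det_permute (Equiv.swap x y) ((1 : Matrix (Fin (2 * n + 1)) (Fin (2 * n + 1)) ℝ).submatrix a id)
  rw [Equiv.Perm.sign_swap h] at this
  simpa using this

theorem leviCivita_basis_aux (c : Fin (2*n+1) → Fin (2*n+1)) (s : Finset (Fin n)) :
    ∑ a : Fin (2*n+1) → Fin (2*n+1), epsilon a * ((if a (Fin.last (2*n)) = c (Fin.last (2*n)) then 1 else 0) *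
      ∏ j : Fin n, ((if a (pos j 0) = c (pos j 0) ∧ a (pos j 1) = c (pos j 1) then 1 else 0) -
       if j ∈ s then (if a (pos j 0) = c (pos j 1) ∧ a (pos j 1) = c (pos j 0) then 1 else 0) else (0:ℝ))) = 2^s.card * epsilon c := by
  induction s using Finset.induction_on with
  | empty =>
    rw [Finset.sum_eq_single c]
    · simp
    · intro a _ hac
      by_contra hne
      apply hac
      simp only [Finset.notMem_empty, if_false, sub_zero] at hne
      have h1 := right_ne_zero_of_mul hne
      have h2 := left_ne_zero_of_mul h1
      have h3 := Finset.prod_ne_zero_iff.1 (right_ne_zero_of_mul h1)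
      simp at h2 h3
      ext i : 1
      by_cases hi : i = Fin.last (2*n)
      · rw [hi, h2]
      · have : (i:ℕ) < 2*n := by
          have := i.2; have : (i:ℕ) ≠ 2*n := fun h => hi (Fin.ext h); omega
        rcases Nat.even_or_odd' (i:ℕ) with ⟨m, hm | hm⟩
        · have : i = pos ⟨m, by omega⟩ 0 := by ext; simp [pos, hm]
          rw [this, (h3 _).1]
        · have : i = pos ⟨m, by omega⟩ 1 := by ext; simp [pos, hm]
          rw [this, (h3 _).2]
    · simp
  | insert k s hk ih =>
    rw [Finset.card_insert_of_notMem hk, pow_succ, mul_assoc, two_mul (epsilon c), mul_add, ← ih]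
    have key : ∀ (s' : Finset (Fin n)) (a : Fin (2*n+1) → Fin (2*n+1)),
       (∏ j : Fin n, ((if a (pos j 0) = c (pos j 0) ∧ a (pos j 1) = c (pos j 1) then 1 else 0) -
       if j ∈ s' then (if a (pos j 0) = c (pos j 1) ∧ a (pos j 1) = c (pos j 0) then 1 else 0) else (0:ℝ)))
       = ((if a (pos k 0) = c (pos k 0) ∧ a (pos k 1) = c (pos k 1) then 1 else 0) -
       if k ∈ s' then (if a (pos k 0) = c (pos k 1) ∧ a (pos k 1) = c (pos k 0) then 1 else 0) else (0:ℝ)) *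
       ∏ j ∈ Finset.univ.erase k, ((if a (pos j 0) = c (pos j 0) ∧ a (pos j 1) = c (pos j 1) then 1 else 0) -
       if j ∈ s' then (if a (pos j 0) = c (pos j 1) ∧ a (pos j 1) = c (pos j 0) then 1 else 0) else (0:ℝ)) := by
      intro s' a
      exact (Finset.mul_prod_erase Finset.univ (fun j : Fin n => ((if a (pos j 0) = c (pos j 0) ∧ a (pos j 1) = c (pos j 1) then 1 else 0) -
       if j ∈ s' then (if a (pos j 0) = c (pos j 1) ∧ a (pos j 1) = c (pos j 0) then 1 else 0) else (0:ℝ))) (Finset.mem_univ k)).symm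
    have key2 : ∀ a : Fin (2*n+1) → Fin (2*n+1), ∏ j ∈ Finset.univ.erase k, ((if a (pos j 0) = c (pos j 0) ∧ a (pos j 1) = c (pos j 1) then 1 else 0) -
       if j ∈ insert k s then (if a (pos j 0) = c (pos j 1) ∧ a (pos j 1) = c (pos j 0) then 1 else 0) else (0:ℝ)) =
       ∏ j ∈ Finset.univ.erase k, ((if a (pos j 0) = c (pos j 0) ∧ a (pos j 1) = c (pos j 1) then 1 else 0) -
       if j ∈ s then (if a (pos j 0) = c (pos j 1) ∧ a (pos j 1) = c (pos j 0) then 1 else 0) else (0:ℝ)) := by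
      intro a
      refine Finset.prod_congr rfl fun j hj => ?_
      have : j ≠ k := Finset.ne_of_mem_erase hj
      simp [this]
    simp only [key, key2, hk, Finset.mem_insert_self, if_true, if_false, sub_zero, sub_mul, mul_sub, Finset.sum_sub_distrib]
    rw [sub_eq_add_neg]
    congr 1
    rw [← Finset.sum_neg_distrib]
    have hp : pos k 0 ≠ pos k 1 := fun h => by simpa using (pos_inj h).2
    refine Fintype.sum_equiv (Equiv.arrowCongr (Equiv.swap (pos k 0) (pos k 1)) (Equiv.refl _)) _ _ fun a => ?_
    have e : (Equiv.arrowCongr (Equiv.swap (pos k 0) (pos k 1)) (Equiv.refl _)) a = a ∘ Equiv.swap (pos k 0) (pos k 1) := by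
      ext; simp [Equiv.arrowCongr]
    rw [e, epsilon_swap _ _ _ hp]
    have e1 : ∀ j ∈ Finset.univ.erase k, ∀ t, Equiv.swap (pos k 0) (pos k 1) (pos j t) = pos j t := by
      intro j hj t
      have : j ≠ k := Finset.ne_of_mem_erase hj
      exact Equiv.swap_apply_of_ne_of_ne (fun h => this (pos_inj h).1) (fun h => this (pos_inj h).1)
    have e2 : Equiv.swap (pos k 0) (pos k 1) (Fin.last (2*n)) = Fin.last (2*n) :=
      Equiv.swap_apply_of_ne_of_ne (pos_ne_last _ _).symm (pos_ne_last _ _).symm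
    simp only [Function.comp, e2, Equiv.swap_apply_left, Equiv.swap_apply_right]
    have e3 : ∀ F : Fin (2*n+1) → Fin (2*n+1) → Fin n → ℝ, ∏ j ∈ Finset.univ.erase k, F (Equiv.swap (pos k 0) (pos k 1) (pos j 0)) (Equiv.swap (pos k 0) (pos k 1) (pos j 1)) j =
       ∏ j ∈ Finset.univ.erase k, F (pos j 0) (pos j 1) j := fun F =>
      Finset.prod_congr rfl fun j hj => by rw [e1 j hj 0, e1 j hj 1]
    rw [e3 fun x y j => ((if a x = c (pos j 0) ∧ a y = c (pos j 1) then 1 else 0) -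
       if j ∈ s then (if a x = c (pos j 1) ∧ a y = c (pos j 0) then 1 else 0) else (0:ℝ))]
    rw [neg_mul, if_congr (and_comm (a := a (pos k 1) = _)) rfl rfl]
/-- `⟨J_{a₁ a₂} ⋯ J_{a_{2n-1} a_{2n}} P_{a_{2n+1}}⟩ = (2ⁿ / ℓ) ε_{a₁ … a_{2n+1}}`, with `P` in any of
the slots. By `leviCivita_apply`, `compP_J` and `compJ_P`, the polynomial vanishes on all
generators `P_a`, `J_{ab}` among which there is not exactly one `P_a`. -/
theorem leviCivita_basis (ℓ : ℝ) (hℓ : ℓ ≠ 0) (i : Fin (n+1)) (c : Fin (2*n+1) → Fin (2*n+1)) :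
   leviCivita n ℓ (i.insertNth (α := fun _ => AdS n) (P ℓ (c (Fin.last (2*n)))) (fun j => J (c (pos j 0)) (c (pos j 1))))
    = 2^n / ℓ * epsilon c := by
  rw [leviCivita_apply, Finset.sum_eq_single i]
  · have := leviCivita_basis_aux c Finset.univ
    simp only [Finset.mem_univ, if_true, Finset.card_univ, Fintype.card_fin] at this
    simp only [Fin.insertNth_apply_same, Fin.insertNth_apply_succAbove, compP_P ℓ hℓ, compJ_J, this]
    ring
  · intro j _ hj
    refine Finset.sum_eq_zero fun a _ => ?_
    obtain ⟨k, rfl⟩ := Fin.exists_succAbove_eq hj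
    simp [compP_J]
  · simp

end Algebra

/-! ### Differential forms on a manifold, possibly with boundary -/

section Manifold

variable {E H M V W X : Type*} [NormedAddCommGroup E] [NormedSpace ℝ E] [TopologicalSpace H]
  [TopologicalSpace M] [ChartedSpace H M]
  [NormedAddCommGroup V] [NormedSpace ℝ V] [NormedAddCommGroup W] [NormedSpace ℝ W]
  [NormedAddCommGroup X] [NormedSpace ℝ X]

/-- `V`-valued `k`-forms on a manifold `M` modelled on `E`: the value at `x` is an alternating form
on the tangent space `TangentSpace I x`, which is `E` by definition. -/
abbrev DForm (E M : Type*) (k : ℕ) (V : Type*) [NormedAddCommGroup E] [NormedSpace ℝ E]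
    [NormedAddCommGroup V] [NormedSpace ℝ V] : Type _ :=
  M → E [⋀^Fin k]→L[ℝ] V

variable (I : ModelWithCorners ℝ E H)

/-- The expression of a form in the preferred chart at `x₀`: its pullback along the inverse of the
chart. -/
def inChart {k : ℕ} (x₀ : M) (α : DForm E M k V) (y : E) : E [⋀^Fin k]→L[ℝ] V :=
  (α ((extChartAt I x₀).symm y)).compContinuousLinearMap
    (mfderivWithin 𝓘(ℝ, E) I (extChartAt I x₀).symm (range I) y : E →L[ℝ] E)

/-- Smooth forms. -/
def SmoothForm {k : ℕ} (α : DForm E M k V) : Prop :=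
  ∀ x₀ : M, ContDiffOn ℝ ∞ (inChart I x₀ α) (extChartAt I x₀).target

/-- The exterior derivative: at `x` it is computed in the preferred chart at `x`. -/
def extD {k : ℕ} (α : DForm E M k V) : DForm E M (k + 1) V := fun x =>
  (extDerivWithin (inChart I x α) (range I) (extChartAt I x x)).compContinuousLinearMap
    (mfderiv I 𝓘(ℝ, E) (extChartAt I x) x : E →L[ℝ] E)

variable {n : ℕ}

/-- The form `α ⊗ c`, for a real-valued form `α` and a constant `c`. -/
def tensorConst {k : ℕ} (α : DForm E M k ℝ) (c : V) : DForm E M k V := fun x =>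
  (ContinuousLinearMap.toSpanSingleton ℝ c).compContinuousAlternatingMap (α x)

/-- The bracket `[α, β]` of `so(2n,2)`-valued forms. -/
def brk {p q l : ℕ} (h : p + q = l) (α : DForm E M p (AdS n)) (β : DForm E M q (AdS n)) :
    DForm E M l (AdS n) := fun x => wedge (bracket n) h (α x) (β x)

/-- The square `A² = ½ [A, A]` of an `so(2n,2)`-valued one-form. -/
def sq (A : DForm E M 1 (AdS n)) : DForm E M 2 (AdS n) := (1 / 2 : ℝ) • brk rfl A A

/-- The curvature `dA + A²`. -/
def curv (A : DForm E M 1 (AdS n)) : DForm E M 2 (AdS n) := extD I A + sq A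

/-- The transgression form `Q_{A₁ ← A₀} = (n+1) ∫₀¹ dt ⟨(A₁ - A₀) F_tⁿ⟩`, where `F_t` is the
curvature of `A₀ + t (A₁ - A₀)`. -/
def transgression (f : Poly (AdS n) (n + 1)) (A₁ A₀ : DForm E M 1 (AdS n)) :
    DForm E M (2 * n + 1) ℝ := fun x =>
  (n + 1 : ℝ) • ∫ t in (0 : ℝ)..1,
    angle₁ f (add_comm 1 (2 * n)) ((A₁ - A₀) x) (curv I (A₀ + t • (A₁ - A₀)) x)

/-- The form
`Q_{A₂ ← A₁ ← A₀} = n(n+1) ∫₀¹ dt ∫₀ᵗ ds ⟨(A₂ - A₁) (A₁ - A₀) F_{st}ⁿ⁻¹⟩`, where `F_{st}` is the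
curvature of `A₀ + t (A₁ - A₀) + s (A₂ - A₁)`. -/
def transgression₂ (f : Poly (AdS n) (n + 1)) (A₂ A₁ A₀ : DForm E M 1 (AdS n)) :
    DForm E M (2 * n) ℝ := fun x =>
  ((n : ℝ) * (n + 1)) • ∫ t in (0 : ℝ)..1, ∫ s in (0 : ℝ)..t,
    angle₂ f (add_comm 2 (2 * n)) ((A₂ - A₁) x) ((A₁ - A₀) x)
      (curv I (A₀ + t • (A₁ - A₀) + s • (A₂ - A₁)) x)

/-! ### Gravity -/

/-- `e = e^a P_a`. -/
def vielbein (ℓ : ℝ) (e : Fin (2 * n + 1) → DForm E M 1 ℝ) : DForm E M 1 (AdS n) :=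
  ∑ a, tensorConst (e a) (P ℓ a)

/-- `ω = ½ ω^{ab} J_{ab}`; only the antisymmetric part of `ω^{ab}` matters. -/
def spinConn (w : Fin (2 * n + 1) → Fin (2 * n + 1) → DForm E M 1 ℝ) : DForm E M 1 (AdS n) :=
  (1 / 2 : ℝ) • ∑ a, ∑ b, tensorConst (w a b) (J a b)

/-- The torsion `T = de + [ω, e]`. -/
def torsion (e w : DForm E M 1 (AdS n)) : DForm E M 2 (AdS n) := extD I e + brk rfl w e

/-- The transgression lagrangian `L_{e+ω ← ω̄} = k Q_{e+ω ← ω̄}` of gravity. -/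
def gravityLagrangian (ℓ k : ℝ) (e : Fin (2 * n + 1) → DForm E M 1 ℝ)
    (w w₀ : Fin (2 * n + 1) → Fin (2 * n + 1) → DForm E M 1 ℝ) : DForm E M (2 * n + 1) ℝ :=
  k • transgression I (leviCivita n ℓ) (vielbein ℓ e + spinConn w) (spinConn w₀)

/-- The Lanczos–Lovelock lagrangian with canonical coefficients,
`(n+1) k ∫₀¹ dt ⟨e (R + t² e²)ⁿ⟩`. -/
def lovelockLagrangian (ℓ k : ℝ) (e : Fin (2 * n + 1) → DForm E M 1 ℝ)
    (w : Fin (2 * n + 1) → Fin (2 * n + 1) → DForm E M 1 ℝ) : DForm E M (2 * n + 1) ℝ := fun x =>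
  ((n + 1 : ℝ) * k) • ∫ t in (0 : ℝ)..1,
    angle₁ (leviCivita n ℓ) (add_comm 1 (2 * n)) (vielbein ℓ e x)
      ((curv I (spinConn w) + t ^ 2 • sq (vielbein ℓ e)) x)

end Manifold

section FieldEquations

variable {n : ℕ} {H M : Type*} [TopologicalSpace H] [TopologicalSpace M] [ChartedSpace H M]
  (I : ModelWithCorners ℝ (EuclideanSpace ℝ (Fin (2 * n + 1))) H)

/-- The integral of a top-degree form over the part of `M` that corresponds to a set `K` of
coordinates in the preferred chart at `x₀`. -/
def integralChart (x₀ : M) (K : Set (EuclideanSpace ℝ (Fin (2 * n + 1))))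
    (α : DForm (EuclideanSpace ℝ (Fin (2 * n + 1))) M (2 * n + 1) ℝ) : ℝ :=
  ∫ y in K, inChart I x₀ α y fun i => EuclideanSpace.single i 1

/-- `(e, ω, ω̄)` is a solution of the field equations of the lagrangian: under all independent
smooth variations of the three fields that are supported in a compact subset of the interior of a
coordinate patch, the first variation of the action over that compact set vanishes. -/
def IsStationary (ℓ k : ℝ) (e : Fin (2 * n + 1) → DForm (EuclideanSpace ℝ (Fin (2 * n + 1))) M 1 ℝ)
    (w w₀ : Fin (2 * n + 1) → Fin (2 * n + 1) →
      DForm (EuclideanSpace ℝ (Fin (2 * n + 1))) M 1 ℝ) : Prop :=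
  ∀ (x₀ : M) (K : Set (EuclideanSpace ℝ (Fin (2 * n + 1)))), IsCompact K →
    K ⊆ interior (extChartAt I x₀).target →
    ∀ (δe : Fin (2 * n + 1) → DForm (EuclideanSpace ℝ (Fin (2 * n + 1))) M 1 ℝ)
      (δw δw₀ : Fin (2 * n + 1) → Fin (2 * n + 1) →
        DForm (EuclideanSpace ℝ (Fin (2 * n + 1))) M 1 ℝ),
      (∀ a, SmoothForm I (δe a)) → (∀ a b, SmoothForm I (δw a b)) →
      (∀ a b, SmoothForm I (δw₀ a b)) →
      (∀ x, x ∉ (extChartAt I x₀).symm '' K →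
        (∀ a, δe a x = 0) ∧ (∀ a b, δw a b x = 0) ∧ ∀ a b, δw₀ a b x = 0) →
      HasDerivAt (fun s : ℝ => integralChart I x₀ K
        (gravityLagrangian I ℓ k (e + s • δe) (w + s • δw) (w₀ + s • δw₀))) 0 0

end FieldEquations

end TGFT

end

open TGFT
open scoped ContDiff

/-! The whole argument rests on three properties of the Levi-Civita polynomial ⟨…⟩: it is symmetric
(`isSymmPoly_leviCivita`), it is invariant under the adjoint action (`polyAct_leviCivita`), and it
pairs exactly one boost component with n Lorentz components (`insertFirst_leviCivita_of_P`,
`insertFirst_leviCivita_of_J`).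

Symmetry and invariance give the triangle equation Q(A₂ ← A₀) = Q(A₂ ← A₁) + Q(A₁ ← A₀) + dQ(A₂ ← A₁
← A₀) (`transOn_triangle`, `transgression_triangle`). Put U = A₁ - A₀, W = A₂ - A₁ and let F be the
curvature of A₀ + tU + sW. Then ∂F/∂t = DU and ∂F/∂s = DW, and the Bianchi identity together with
invariance gives ∂ₛ⟨U Fⁿ⟩ - ∂ₜ⟨W Fⁿ⟩ = n d⟨W U Fⁿ⁻¹⟩. Green's theorem on the triangle 0 ≤ s ≤ t ≤ 1
integrates this identity; the three edges carry the three transgression forms. All integrands are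
polynomial in t and s (`IsPolyFamily`), so exchanging d with the integrals is mere linearity.

The algebra splits as boosts plus Lorentz subalgebra, with [J,J] and [P,P] Lorentz and [J,P] boost.
Hence ω, R and e² are Lorentz-valued, while e and the torsion T are boost-valued. A transgression
between two Lorentz connections contains no boost and vanishes, which is part 2. Along ω + te the
curvature is R + t²e² + tT, and T drops out next to e, so Q(e+ω ← ω) is the Lanczos–Lovelock form.
The triangle equation with middle vertex ω then gives part 1.

For part 3, write A = e + ω and let a be its variation. Two triangle equations show that the varied
transgression form equals the original one plus Q(A + sa ← A), up to exact terms that are supported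
in K and integrate to zero (`transgression_variation`); the variation of ω̄ enters only through
these. The derivative at s = 0 is therefore (n+1) ∫⟨a Fⁿ⟩ with F the curvature of A
(`hasDerivAt_integral_inChart_transgression`), up to the factor k. The fundamental lemma of the
calculus of variations (`eq_zero_of_forall_integral_wedge_eq_zero`) turns its vanishing into ⟨G Fⁿ⟩
= 0 for every generator G. Since F = (R + e²) + T, the grading rewrites these equations as ⟨P
(R+e²)ⁿ⟩ = 0 and n⟨J T (R+e²)ⁿ⁻¹⟩ = 0.

Local computations take place on the target of an extended chart with derivatives within that set,
so that boundary points need no separate treatment: the target has unique derivatives and lies in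
the closure of its interior. -/

noncomputable section

set_option maxSynthPendingDepth 3
set_option linter.unusedSectionVars false

namespace TGFT

open Set Topology MeasureTheory
open scoped ContDiff Manifold

/-! ### The wedge product: bilinearity, graded commutativity, associativity. -/

section WedgeAlgebra

variable {E U V W X Y : Type*}
  [NormedAddCommGroup E] [NormedSpace ℝ E] [NormedAddCommGroup U] [NormedSpace ℝ U]
  [NormedAddCommGroup V] [NormedSpace ℝ V]
  [NormedAddCommGroup W] [NormedSpace ℝ W] [NormedAddCommGroup X] [NormedSpace ℝ X]
  [NormedAddCommGroup Y] [NormedSpace ℝ Y]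

theorem wedge_apply' {p q l : ℕ} (B : V →L[ℝ] W →L[ℝ] X) (h : p + q = l)
    (α : E [⋀^Fin p]→L[ℝ] V) (β : E [⋀^Fin q]→L[ℝ] W) (v : Fin l → E) :
    wedge B h α β v = ((p.factorial : ℝ) * q.factorial)⁻¹ •
      ∑ σ : Equiv.Perm (Fin l), Equiv.Perm.sign σ •
        B (α fun i => v (σ (Fin.cast h (Fin.castAdd q i))))
          (β fun j => v (σ (Fin.cast h (Fin.natAdd p j)))) := by
  subst h; exact wedge_apply B α β v

theorem wedge_compContinuousLinearMap {E' : Type*} [NormedAddCommGroup E'] [NormedSpace ℝ E']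
    {p q l : ℕ} (B : V →L[ℝ] W →L[ℝ] X) (h : p + q = l)
    (α : E [⋀^Fin p]→L[ℝ] V) (β : E [⋀^Fin q]→L[ℝ] W) (f : E' →L[ℝ] E) :
    (wedge B h α β).compContinuousLinearMap f =
      wedge B h (α.compContinuousLinearMap f) (β.compContinuousLinearMap f) := by
  ext v
  simp [wedge_apply', Function.comp_def]

theorem wedge_neg_pairing {p q l : ℕ} (B : V →L[ℝ] W →L[ℝ] X) (h : p + q = l)
    (α : E [⋀^Fin p]→L[ℝ] V) (β : E [⋀^Fin q]→L[ℝ] W) :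
    wedge (-B) h α β = - wedge B h α β := by
  ext v
  simp [wedge_apply']

theorem norm_wedge_le {p q l : ℕ} (B : V →L[ℝ] W →L[ℝ] X) (h : p + q = l)
    (α : E [⋀^Fin p]→L[ℝ] V) (β : E [⋀^Fin q]→L[ℝ] W) :
    ‖wedge B h α β‖ ≤ (((p.factorial : ℝ) * q.factorial)⁻¹ * l.factorial * ‖B‖) * ‖α‖ * ‖β‖ := by
  subst h
  refine ContinuousAlternatingMap.opNorm_le_bound _ (by positivity) fun v => ?_
  rw [wedge_apply, norm_smul, Real.norm_of_nonneg (by positivity)]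
  have key : ∀ σ : Equiv.Perm (Fin (p + q)), ‖Equiv.Perm.sign σ •
        B (α fun i => v (σ (Fin.castAdd q i))) (β fun j => v (σ (Fin.natAdd p j)))‖ ≤
      ‖B‖ * ‖α‖ * ‖β‖ * ∏ i, ‖v i‖ := by
    intro σ
    have h1 : ‖Equiv.Perm.sign σ •
        B (α fun i => v (σ (Fin.castAdd q i))) (β fun j => v (σ (Fin.natAdd p j)))‖ =
        ‖B (α fun i => v (σ (Fin.castAdd q i))) (β fun j => v (σ (Fin.natAdd p j)))‖ := by
      rcases Int.units_eq_one_or (Equiv.Perm.sign σ) with h | h <;> simp [h]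
    rw [h1, ← Equiv.prod_comp σ, Fin.prod_univ_add]
    calc _ ≤ ‖B‖ * ‖α fun i => v (σ (Fin.castAdd q i))‖ * ‖β fun j => v (σ (Fin.natAdd p j))‖ :=
          B.le_opNorm₂ _ _
      _ ≤ ‖B‖ * (‖α‖ * ∏ i, ‖v (σ (Fin.castAdd q i))‖) * (‖β‖ * ∏ j, ‖v (σ (Fin.natAdd p j))‖) := by
          gcongr
          · exact α.le_opNorm _
          · exact β.le_opNorm _
      _ = _ := by ring
  calc _ ≤ ((p.factorial : ℝ) * q.factorial)⁻¹ * ∑ _σ : Equiv.Perm (Fin (p + q)),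
        ‖B‖ * ‖α‖ * ‖β‖ * ∏ i, ‖v i‖ := by
        gcongr
        exact norm_sum_le_of_le _ fun σ _ => key σ
    _ = _ := by
        rw [Finset.sum_const, Finset.card_univ, Fintype.card_perm, Fintype.card_fin, nsmul_eq_mul]
        ring

/-- The wedge product as a continuous bilinear map. -/
def wedgeL {p q l : ℕ} (B : V →L[ℝ] W →L[ℝ] X) (h : p + q = l) :
    (E [⋀^Fin p]→L[ℝ] V) →L[ℝ] (E [⋀^Fin q]→L[ℝ] W) →L[ℝ] E [⋀^Fin l]→L[ℝ] X :=
  LinearMap.mkContinuous₂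
    (LinearMap.mk₂ ℝ (wedge B h)
      (fun α α' β => by
        ext v; simp [wedge_apply', Finset.sum_add_distrib])
      (fun c α β => by
        ext v; simp [wedge_apply', Finset.smul_sum, smul_comm c])
      (fun α β β' => by
        ext v; simp [wedge_apply', Finset.sum_add_distrib])
      (fun c α β => by
        ext v; simp [wedge_apply', Finset.smul_sum, smul_comm c]))
    _ (fun α β => norm_wedge_le B h α β)

@[simp] theorem wedgeL_apply {p q l : ℕ} (B : V →L[ℝ] W →L[ℝ] X) (h : p + q = l)
    (α : E [⋀^Fin p]→L[ℝ] V) (β : E [⋀^Fin q]→L[ℝ] W) : wedgeL B h α β = wedge B h α β := rfl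

section Linear
variable {p q l : ℕ} (B : V →L[ℝ] W →L[ℝ] X) (h : p + q = l)

theorem wedge_add_left (α α' : E [⋀^Fin p]→L[ℝ] V) (β : E [⋀^Fin q]→L[ℝ] W) :
    wedge B h (α + α') β = wedge B h α β + wedge B h α' β := (wedgeL B h).map_add₂ α α' β
theorem wedge_add_right (α : E [⋀^Fin p]→L[ℝ] V) (β β' : E [⋀^Fin q]→L[ℝ] W) :
    wedge B h α (β + β') = wedge B h α β + wedge B h α β' := (wedgeL B h α).map_add β β'
theorem wedge_smul_left (c : ℝ) (α : E [⋀^Fin p]→L[ℝ] V) (β : E [⋀^Fin q]→L[ℝ] W) :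
    wedge B h (c • α) β = c • wedge B h α β := (wedgeL B h).map_smul₂ c α β
theorem wedge_smul_right (c : ℝ) (α : E [⋀^Fin p]→L[ℝ] V) (β : E [⋀^Fin q]→L[ℝ] W) :
    wedge B h α (c • β) = c • wedge B h α β := (wedgeL B h α).map_smul c β
theorem wedge_zero_left (β : E [⋀^Fin q]→L[ℝ] W) :
    wedge B h (0 : E [⋀^Fin p]→L[ℝ] V) β = 0 := (wedgeL B h).map_zero₂ β
theorem wedge_zero_right (α : E [⋀^Fin p]→L[ℝ] V) :
    wedge B h α (0 : E [⋀^Fin q]→L[ℝ] W) = 0 := (wedgeL B h α).map_zero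
theorem wedge_neg_left (α : E [⋀^Fin p]→L[ℝ] V) (β : E [⋀^Fin q]→L[ℝ] W) :
    wedge B h (-α) β = - wedge B h α β := (wedgeL B h).map_neg₂ α β
theorem wedge_sum_left {ι : Type*} (s : Finset ι) (α : ι → E [⋀^Fin p]→L[ℝ] V)
    (β : E [⋀^Fin q]→L[ℝ] W) :
    wedge B h (∑ i ∈ s, α i) β = ∑ i ∈ s, wedge B h (α i) β := by
  simp only [← wedgeL_apply, map_sum, sum_apply]
theorem wedge_sum_right {ι : Type*} (s : Finset ι) (α : E [⋀^Fin p]→L[ℝ] V)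
    (β : ι → E [⋀^Fin q]→L[ℝ] W) :
    wedge B h α (∑ i ∈ s, β i) = ∑ i ∈ s, wedge B h α (β i) := map_sum (wedgeL B h α) β s
end Linear

/-- The inner antisymmetrization is redundant: an inner permutation extends to all `p + q + r`
places, and reindexing the outer sum by it absorbs its sign. The (p+q)! equal copies cancel the
inner part of the outer normalization. -/
theorem wedge_wedge_left_apply {p q r m l : ℕ} (B₁ : X →L[ℝ] W →L[ℝ] Y) (B₂ : U →L[ℝ] V →L[ℝ] X)
    (h' : p + q = m) (h : m + r = l) (α : E [⋀^Fin p]→L[ℝ] U) (β : E [⋀^Fin q]→L[ℝ] V)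
    (γ : E [⋀^Fin r]→L[ℝ] W) (v : Fin l → E) :
    wedge B₁ h (wedge B₂ h' α β) γ v =
      ((p.factorial : ℝ) * q.factorial * r.factorial)⁻¹ •
      ∑ σ : Equiv.Perm (Fin l), Equiv.Perm.sign σ •
        B₁ (B₂ (α fun i => v (σ ⟨i, by omega⟩)) (β fun j => v (σ ⟨p + j, by omega⟩)))
          (γ fun k => v (σ ⟨p + q + k, by omega⟩)) := by
  subst h' h
  set S := ∑ σ : Equiv.Perm (Fin (p + q + r)), Equiv.Perm.sign σ •
        B₁ (B₂ (α fun i => v (σ ⟨i, by omega⟩)) (β fun j => v (σ ⟨p + j, by omega⟩)))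
          (γ fun k => v (σ ⟨p + q + k, by omega⟩)) with hS
  rw [wedge_apply]
  simp only [wedge_apply, map_smul, map_sum, smul_apply, sum_apply, Units.smul_def, map_zsmul]
  have key : ∀ τ : Equiv.Perm (Fin (p + q)),
      ∑ σ : Equiv.Perm (Fin (p + q + r)), ((Equiv.Perm.sign σ : ℤ)) •
        ((Equiv.Perm.sign τ : ℤ)) •
        B₁ (B₂ (α fun i => v (σ (Fin.castAdd r (τ (Fin.castAdd q i)))))
          (β fun j => v (σ (Fin.castAdd r (τ (Fin.natAdd p j))))))
          (γ fun k => v (σ (Fin.natAdd (p + q) k))) = S := by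
    intro τ
    let e : Equiv.Perm (Fin (p + q + r)) :=
      finSumFinEquiv.permCongr (Equiv.sumCongr τ (Equiv.refl (Fin r)))
    have e1 : ∀ i, e (Fin.castAdd r i) = Fin.castAdd r (τ i) := by
      intro i; simp [e, Equiv.permCongr_apply]
    have e2 : ∀ i, e (Fin.natAdd (p + q) i) = Fin.natAdd (p + q) i := by
      intro i; simp [e, Equiv.permCongr_apply]
    have e3 : Equiv.Perm.sign e = Equiv.Perm.sign τ := by
      have := Equiv.Perm.sign_sumCongr τ (1 : Equiv.Perm (Fin r))
      rw [Equiv.Perm.sign_one, mul_one] at this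
      rw [← this]
      exact Equiv.Perm.sign_permCongr _ _
    rw [hS]
    refine Fintype.sum_equiv (Equiv.mulRight e) _ _ fun σ => ?_
    rw [Equiv.coe_mulRight, Equiv.Perm.sign_mul, e3, smul_smul, Units.smul_def, Units.val_mul]
    congr 2
    · have h1 : ∀ i : Fin p, (⟨i, by omega⟩ : Fin (p + q + r)) = Fin.castAdd r (Fin.castAdd q i) :=
        fun i => rfl
      have h2 : ∀ j : Fin q, (⟨p + j, by omega⟩ : Fin (p + q + r)) =
          Fin.castAdd r (Fin.natAdd p j) := fun i => rfl
      simp only [Equiv.Perm.coe_mul, Function.comp, h1, h2, e1]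
    · have h3 : ∀ k : Fin r, (⟨p + q + k, by omega⟩ : Fin (p + q + r)) =
          Fin.natAdd (p + q) k := fun i => rfl
      simp only [Equiv.Perm.coe_mul, Function.comp, h3, e2]
  simp only [Finset.smul_sum]
  rw [Finset.sum_comm]
  have : ∀ τ ∈ (Finset.univ : Finset (Equiv.Perm (Fin (p + q)))), 
      ∑ σ : Equiv.Perm (Fin (p + q + r)), ((((p + q).factorial : ℝ) * r.factorial)⁻¹ •
        (Equiv.Perm.sign σ : ℤ) • ((p.factorial : ℝ) * q.factorial)⁻¹ • 
        (Equiv.Perm.sign τ : ℤ) •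
        B₁ (B₂ (α fun i => v (σ (Fin.castAdd r (τ (Fin.castAdd q i)))))
          (β fun j => v (σ (Fin.castAdd r (τ (Fin.natAdd p j))))))
          (γ fun k => v (σ (Fin.natAdd (p + q) k)))) =
       (((p + q).factorial : ℝ) * r.factorial)⁻¹ • ((p.factorial : ℝ) * q.factorial)⁻¹ • S := by
    intro τ _
    rw [← key τ, Finset.smul_sum, Finset.smul_sum]
    refine Finset.sum_congr rfl fun σ _ => ?_
    rw [smul_comm (Equiv.Perm.sign σ : ℤ) (((p.factorial : ℝ) * q.factorial)⁻¹)]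
  rw [Finset.sum_congr rfl this, Finset.sum_const, Finset.card_univ, Fintype.card_perm,
    Fintype.card_fin, ← Nat.cast_smul_eq_nsmul ℝ, smul_smul, smul_smul]
  congr 1
  have := Nat.factorial_ne_zero (p + q)
  field_simp

/-- Commutativity of the wedge product. -/
theorem wedge_comm {p q l : ℕ} (B : V →L[ℝ] W →L[ℝ] X) (h : p + q = l) (h' : q + p = l)
    (α : E [⋀^Fin p]→L[ℝ] V) (β : E [⋀^Fin q]→L[ℝ] W) :
    wedge B h α β = (-1 : ℝ) ^ (p * q) • wedge B.flip h' β α := by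
  ext v
  -- Rotation by `q` places moves the first block of `p` places behind the block of `q` places.
  let e : Equiv.Perm (Fin l) := (finRotate l) ^ q
  have hval : ∀ (k : ℕ) (i : Fin l), (((finRotate l) ^ k) i : ℕ) = (i + k) % l := by
    intro k
    induction k with
    | zero => intro i; simp [Nat.mod_eq_of_lt i.2]
    | succ k ih =>
      intro i
      have : 0 < l := i.pos
      obtain ⟨m, rfl⟩ : ∃ m, l = m + 1 := ⟨l - 1, by omega⟩
      rw [pow_succ', Equiv.Perm.coe_mul, Function.comp, finRotate_apply, Fin.val_add, ih,
        Fin.val_one', Nat.mod_add_mod, Nat.add_mod_mod, add_assoc]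
  have hsign : ((Equiv.Perm.sign e : ℤ) : ℝ) = (-1 : ℝ) ^ (p * q) := by
    rcases Nat.eq_zero_or_pos q with hq | hq
    · subst hq; simp [e]
    · have h1 : Equiv.Perm.sign e = ((-1) ^ (l - 1)) ^ q := by
        rw [map_pow, sign_finRotate]
      rw [h1]
      push_cast
      rw [← pow_mul]
      -- The rotation has sign (-1)^((l-1)q); the summand (q-1)q is even, which leaves (-1)^(pq).
      have : (l - 1) * q = p * q + (q - 1) * q := by
        rw [← add_mul]; congr 1; omega
      rw [this, pow_add, (Nat.even_mul_pred_self q |> fun h => by rwa [mul_comm] at h :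
        Even ((q - 1) * q)).neg_one_pow, mul_one]
  have hcast : ∀ (σ : Equiv.Perm (Fin l)) (x : X),
      Equiv.Perm.sign σ • x = ((Equiv.Perm.sign σ : ℤ) : ℝ) • x := by
    intro σ x; rw [Units.smul_def, Int.cast_smul_eq_zsmul]
  rw [ContinuousAlternatingMap.smul_apply, wedge_apply', wedge_apply',
    mul_comm (q.factorial : ℝ), smul_comm]
  congr 1
  rw [← Equiv.sum_comp (Equiv.mulRight e), Finset.smul_sum]
  refine Finset.sum_congr rfl fun σ _ => ?_
  have e1 : ∀ i : Fin p, e (Fin.cast h (Fin.castAdd q i)) = Fin.cast h' (Fin.natAdd q i) := by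
    intro i; ext; rw [hval]
    simp only [Fin.val_cast, Fin.val_castAdd, Fin.val_natAdd]
    rw [Nat.mod_eq_of_lt (by omega)]; omega
  have e2 : ∀ i : Fin q, e (Fin.cast h (Fin.natAdd p i)) = Fin.cast h' (Fin.castAdd p i) := by
    intro i; ext; rw [hval]
    simp only [Fin.val_cast, Fin.val_castAdd, Fin.val_natAdd]
    have : p + (i : ℕ) + q = i + l := by omega
    rw [this, Nat.add_mod_right, Nat.mod_eq_of_lt (by omega)]
  rw [Equiv.coe_mulRight, hcast, hcast, Equiv.Perm.sign_mul, Units.val_mul, Int.cast_mul, hsign,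
    smul_smul, mul_comm]
  simp only [Equiv.Perm.coe_mul, Function.comp, e1, e2, ContinuousLinearMap.flip_apply]

/-- Mirror image of `wedge_wedge_left_apply`. Both bracketings reduce to the same single sum over
permutations, so associativity becomes a pointwise condition on the pairings. -/
theorem wedge_wedge_right_apply {p q r m l : ℕ} (B₁ : U →L[ℝ] X →L[ℝ] Y) (B₂ : V →L[ℝ] W →L[ℝ] X)
    (h' : q + r = m) (h : p + m = l) (α : E [⋀^Fin p]→L[ℝ] U) (β : E [⋀^Fin q]→L[ℝ] V)
    (γ : E [⋀^Fin r]→L[ℝ] W) (v : Fin l → E) :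
    wedge B₁ h α (wedge B₂ h' β γ) v =
      ((p.factorial : ℝ) * q.factorial * r.factorial)⁻¹ •
      ∑ σ : Equiv.Perm (Fin l), Equiv.Perm.sign σ •
        B₁ (α fun i => v (σ ⟨i, by omega⟩)) (B₂ (β fun j => v (σ ⟨p + j, by omega⟩))
          (γ fun k => v (σ ⟨p + q + k, by omega⟩))) := by
  subst h' h
  set S := ∑ σ : Equiv.Perm (Fin (p + (q + r))), Equiv.Perm.sign σ •
        B₁ (α fun i => v (σ ⟨i, by omega⟩)) (B₂ (β fun j => v (σ ⟨p + j, by omega⟩))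
          (γ fun k => v (σ ⟨p + q + k, by omega⟩))) with hS
  rw [wedge_apply]
  simp only [wedge_apply, map_smul, map_sum, Units.smul_def, map_zsmul]
  have key : ∀ τ : Equiv.Perm (Fin (q + r)),
      ∑ σ : Equiv.Perm (Fin (p + (q + r))), ((Equiv.Perm.sign σ : ℤ)) •
        ((Equiv.Perm.sign τ : ℤ)) •
        B₁ (α fun i => v (σ (Fin.castAdd (q + r) i)))
          (B₂ (β fun j => v (σ (Fin.natAdd p (τ (Fin.castAdd r j)))))
          (γ fun k => v (σ (Fin.natAdd p (τ (Fin.natAdd q k)))))) = S := by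
    intro τ
    let e : Equiv.Perm (Fin (p + (q + r))) :=
      finSumFinEquiv.permCongr (Equiv.sumCongr (Equiv.refl (Fin p)) τ)
    have e1 : ∀ i, e (Fin.castAdd (q + r) i) = Fin.castAdd (q + r) i := by
      intro i; simp [e, Equiv.permCongr_apply]
    have e2 : ∀ i, e (Fin.natAdd p i) = Fin.natAdd p (τ i) := by
      intro i; simp [e, Equiv.permCongr_apply]
    have e3 : Equiv.Perm.sign e = Equiv.Perm.sign τ := by
      have := Equiv.Perm.sign_sumCongr (1 : Equiv.Perm (Fin p)) τ
      rw [Equiv.Perm.sign_one, one_mul] at this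
      rw [← this]
      exact Equiv.Perm.sign_permCongr _ _
    rw [hS]
    refine Fintype.sum_equiv (Equiv.mulRight e) _ _ fun σ => ?_
    rw [Equiv.coe_mulRight, Equiv.Perm.sign_mul, e3, smul_smul, Units.smul_def, Units.val_mul]
    have h1 : ∀ i : Fin p, (⟨i, by omega⟩ : Fin (p + (q + r))) = Fin.castAdd (q + r) i :=
        fun i => rfl
    have h2 : ∀ j : Fin q, (⟨p + j, by omega⟩ : Fin (p + (q + r))) =
          Fin.natAdd p (Fin.castAdd r j) := fun i => rfl
    have h3 : ∀ k : Fin r, (⟨p + q + k, by omega⟩ : Fin (p + (q + r))) =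
          Fin.natAdd p (Fin.natAdd q k) := fun i => by ext; simp [add_assoc]
    simp only [Equiv.Perm.coe_mul, Function.comp, h1, h2, h3, e1, e2]
  simp only [Finset.smul_sum]
  rw [Finset.sum_comm]
  have : ∀ τ ∈ (Finset.univ : Finset (Equiv.Perm (Fin (q + r)))), 
      ∑ σ : Equiv.Perm (Fin (p + (q + r))), (((p.factorial : ℝ) * (q + r).factorial)⁻¹ •
        (Equiv.Perm.sign σ : ℤ) • ((q.factorial : ℝ) * r.factorial)⁻¹ • 
        (Equiv.Perm.sign τ : ℤ) •
        B₁ (α fun i => v (σ (Fin.castAdd (q + r) i)))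
          (B₂ (β fun j => v (σ (Fin.natAdd p (τ (Fin.castAdd r j)))))
          (γ fun k => v (σ (Fin.natAdd p (τ (Fin.natAdd q k))))))) =
       ((p.factorial : ℝ) * (q + r).factorial)⁻¹ • ((q.factorial : ℝ) * r.factorial)⁻¹ • S := by
    intro τ _
    rw [← key τ, Finset.smul_sum, Finset.smul_sum]
    refine Finset.sum_congr rfl fun σ _ => ?_
    rw [smul_comm (Equiv.Perm.sign σ : ℤ) (((q.factorial : ℝ) * r.factorial)⁻¹)]
  rw [Finset.sum_congr rfl this, Finset.sum_const, Finset.card_univ, Fintype.card_perm,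
    Fintype.card_fin, ← Nat.cast_smul_eq_nsmul ℝ, smul_smul, smul_smul]
  congr 1
  have := Nat.factorial_ne_zero (q + r)
  field_simp

/-- Associativity of the wedge product. -/
theorem wedge_assoc {X' : Type*} [NormedAddCommGroup X'] [NormedSpace ℝ X'] {p q r m m' l : ℕ}
    (B₁ : X →L[ℝ] W →L[ℝ] Y) (B₂ : U →L[ℝ] V →L[ℝ] X)
    (C₁ : U →L[ℝ] X' →L[ℝ] Y) (C₂ : V →L[ℝ] W →L[ℝ] X')
    (h₂ : p + q = m) (h₁ : m + r = l) (h₂' : q + r = m') (h₁' : p + m' = l)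
    (α : E [⋀^Fin p]→L[ℝ] U) (β : E [⋀^Fin q]→L[ℝ] V) (γ : E [⋀^Fin r]→L[ℝ] W)
    (H : ∀ u b c, B₁ (B₂ (α u) b) c = C₁ (α u) (C₂ b c)) :
    wedge B₁ h₁ (wedge B₂ h₂ α β) γ = wedge C₁ h₁' α (wedge C₂ h₂' β γ) := by
  ext v
  simp only [wedge_wedge_left_apply, wedge_wedge_right_apply, H]

/-- Exchange of the last two factors of an iterated wedge product. -/
theorem wedge_wedge_swap {X' : Type*} [NormedAddCommGroup X'] [NormedSpace ℝ X'] {p q r m m' l : ℕ}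
    (B₁ : X →L[ℝ] W →L[ℝ] Y) (B₂ : U →L[ℝ] V →L[ℝ] X)
    (C₁ : X' →L[ℝ] V →L[ℝ] Y) (C₂ : U →L[ℝ] W →L[ℝ] X')
    (h₂ : p + q = m) (h₁ : m + r = l) (h₂' : p + r = m') (h₁' : m' + q = l)
    (α : E [⋀^Fin p]→L[ℝ] U) (β : E [⋀^Fin q]→L[ℝ] V) (γ : E [⋀^Fin r]→L[ℝ] W)
    (H : ∀ u b c, B₁ (B₂ (α u) b) c = C₁ (C₂ (α u) c) b) :
    wedge B₁ h₁ (wedge B₂ h₂ α β) γ =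
      (-1 : ℝ) ^ (q * r) • wedge C₁ h₁' (wedge C₂ h₂' α γ) β := by
  -- The last two factors are paired first, with values in maps out of `U`, and `ev` then applies
  -- the result to the first factor. In this form the exchange is associativity followed by
  -- commutativity of the last two factors.
  let T : V →L[ℝ] W →L[ℝ] (U →L[ℝ] Y) :=
    (ContinuousLinearMap.flipₗᵢ ℝ U W Y).toContinuousLinearEquiv.toContinuousLinearMap.comp
      ((ContinuousLinearMap.compL ℝ U X (W →L[ℝ] Y) B₁).comp B₂.flip)
  let ev : U →L[ℝ] (U →L[ℝ] Y) →L[ℝ] Y := (ContinuousLinearMap.id ℝ (U →L[ℝ] Y)).flip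
  have hT : ∀ u b c, B₁ (B₂ (α u) b) c = ev (α u) (T b c) := fun u b c => rfl
  have hT' : ∀ u c b, C₁ (C₂ (α u) c) b = ev (α u) (T.flip c b) := fun u c b => (H u b c).symm
  have e₃ : p + (q + r) = l := by omega
  rw [wedge_assoc B₁ B₂ ev T h₂ h₁ rfl e₃ α β γ hT,
    wedge_assoc C₁ C₂ ev T.flip h₂' h₁' (add_comm r q) e₃ α γ β hT',
    wedge_comm T rfl (add_comm r q), wedge_smul_right]

end WedgeAlgebra

/-! ### Filling the slots of symmetric multilinear forms with two-forms. -/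

section Fill

variable {E V : Type*} [NormedAddCommGroup E] [NormedSpace ℝ E] [NormedAddCommGroup V]
  [NormedSpace ℝ V]

theorem insertFirst_apply {r : ℕ} (f : Poly V (r + 1)) (a : V) (v : Fin r → V) :
    insertFirst V r f a v = f (Fin.cons a v) := rfl

/-- Symmetric multilinear forms. -/
def IsSymmPoly {r : ℕ} (f : Poly V r) : Prop :=
  ∀ (σ : Equiv.Perm (Fin r)) (v : Fin r → V), f (v ∘ σ) = f v

theorem IsSymmPoly.insertFirst {r : ℕ} {f : Poly V (r + 1)} (hf : IsSymmPoly f) (a : V) :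
    IsSymmPoly (insertFirst V r f a) := by
  intro σ v
  rw [insertFirst_apply, insertFirst_apply, ← hf (Equiv.Perm.decomposeFin.symm (0, σ)) (Fin.cons a v)]
  congr 1
  funext i
  refine Fin.cases ?_ (fun i => ?_) i <;> simp

theorem IsSymmPoly.insertFirst_comm {r : ℕ} {f : Poly V (r + 2)} (hf : IsSymmPoly f) (a b : V) :
    TGFT.insertFirst V r (TGFT.insertFirst V (r + 1) f a) b =
      TGFT.insertFirst V r (TGFT.insertFirst V (r + 1) f b) a := by
  ext v
  simp only [insertFirst_apply]
  rw [← hf (Equiv.swap 0 1)]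
  congr 1
  funext i
  refine Fin.cases ?_ (fun i => ?_) i
  · simp
  · refine Fin.cases ?_ (fun i => ?_) i
    · simp
    · have : Equiv.swap (0 : Fin (r + 2)) 1 i.succ.succ = i.succ.succ :=
        Equiv.swap_apply_of_ne_of_ne (by simp) (by simp [Fin.ext_iff])
      simp [this]

theorem IsSymmPoly.smul {r : ℕ} {f : Poly V r} (hf : IsSymmPoly f) (c : ℝ) :
    IsSymmPoly (c • f) := fun σ v => by simp [hf σ v]

theorem IsSymmPoly.zsmul {r : ℕ} {f : Poly V r} (hf : IsSymmPoly f) (c : ℤ) :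
    IsSymmPoly (c • f) := fun σ v => by simp [hf σ v]

theorem IsSymmPoly.sum {ι : Type*} {r : ℕ} (s : Finset ι) {f : ι → Poly V r}
    (hf : ∀ i ∈ s, IsSymmPoly (f i)) : IsSymmPoly (∑ i ∈ s, f i) := fun σ v => by
  simp only [sum_apply]
  exact Finset.sum_congr rfl fun i hi => hf i hi σ v

/-- Forms with values in the symmetric multilinear forms. -/
def SymmValued {p r : ℕ} (Ψ : E [⋀^Fin p]→L[ℝ] Poly V r) : Prop := ∀ v, IsSymmPoly (Ψ v)

theorem SymmValued.wedge_insertFirst {p q l r : ℕ} {Ψ : E [⋀^Fin p]→L[ℝ] Poly V (r + 1)}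
    (hΨ : SymmValued Ψ) (h : p + q = l) (Z : E [⋀^Fin q]→L[ℝ] V) :
    SymmValued (wedge (insertFirst V r) h Ψ Z) := by
  intro v
  rw [wedge_apply']
  exact (IsSymmPoly.sum _ fun σ _ => ((hΨ _).insertFirst _).zsmul _).smul _

theorem symmValued_const0 {r : ℕ} {f : Poly V r} (hf : IsSymmPoly f) :
    SymmValued (const0 (E := E) f) := fun _ => hf

theorem SymmValued.wedge_swap {p q q' m m' l r : ℕ} {Ψ : E [⋀^Fin p]→L[ℝ] Poly V (r + 2)}
    (hΨ : SymmValued Ψ) (h₂ : p + q = m) (h₁ : m + q' = l) (h₂' : p + q' = m') (h₁' : m' + q = l)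
    (Y : E [⋀^Fin q]→L[ℝ] V) (Z : E [⋀^Fin q']→L[ℝ] V) :
    wedge (insertFirst V r) h₁ (wedge (insertFirst V (r + 1)) h₂ Ψ Y) Z =
      (-1 : ℝ) ^ (q * q') •
        wedge (insertFirst V r) h₁' (wedge (insertFirst V (r + 1)) h₂' Ψ Z) Y :=
  wedge_wedge_swap _ _ _ _ h₂ h₁ h₂' h₁' Ψ Y Z fun u b c => (hΨ u).insertFirst_comm b c

/-- Change of the degree along an equality, as a continuous linear map. -/
def castDegL {p l : ℕ} (h : p = l) : (E [⋀^Fin p]→L[ℝ] V) →L[ℝ] (E [⋀^Fin l]→L[ℝ] V) :=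
  h ▸ ContinuousLinearMap.id ℝ _

theorem castDegL_apply {p l : ℕ} (h : p = l) (α : E [⋀^Fin p]→L[ℝ] V) :
    castDegL h α = castDeg h α := by subst h; rfl

theorem castDeg_rfl {p : ℕ} (α : E [⋀^Fin p]→L[ℝ] V) : castDeg rfl α = α := rfl

/-- `fill` as a continuous linear map in its first argument. -/
def fillL : {r p l : ℕ} → (p + 2 * r = l) → E [⋀^Fin 2]→L[ℝ] V →
      (E [⋀^Fin p]→L[ℝ] Poly V r) →L[ℝ] E [⋀^Fin l]→L[ℝ] ℝ
  | 0, _, _, h, _ =>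
      (ContinuousLinearMap.compContinuousAlternatingMapCLM (ι := Fin _) ℝ E (Poly V 0) ℝ
        ((continuousMultilinearCurryFin0 ℝ V ℝ).toContinuousLinearEquiv :
        Poly V 0 →L[ℝ] ℝ)).comp (castDegL h)
  | r + 1, _, _, h, F => (fillL (by omega) F).comp ((wedgeL (insertFirst V r) rfl).flip F)

theorem fillL_apply : {r p l : ℕ} → (h : p + 2 * r = l) → (F : E [⋀^Fin 2]→L[ℝ] V) →
    (Ψ : E [⋀^Fin p]→L[ℝ] Poly V r) → fillL h F Ψ = fill h Ψ F
  | 0, _, _, h, F, Ψ => by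
      rw [fillL, fill, ContinuousLinearMap.comp_apply, castDegL_apply]; rfl
  | r + 1, _, _, h, F, Ψ => by
      rw [fillL, fill, ContinuousLinearMap.comp_apply, fillL_apply]; rfl

section Linear
variable {r p l : ℕ} (h : p + 2 * r = l) (F : E [⋀^Fin 2]→L[ℝ] V)

theorem fill_add (Ψ Ψ' : E [⋀^Fin p]→L[ℝ] Poly V r) :
    fill h (Ψ + Ψ') F = fill h Ψ F + fill h Ψ' F := by
  simp only [← fillL_apply, map_add]
theorem fill_smul (c : ℝ) (Ψ : E [⋀^Fin p]→L[ℝ] Poly V r) :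
    fill h (c • Ψ) F = c • fill h Ψ F := by simp only [← fillL_apply, map_smul]
theorem fill_neg (Ψ : E [⋀^Fin p]→L[ℝ] Poly V r) : fill h (-Ψ) F = - fill h Ψ F := by
  rw [← fillL_apply, ← fillL_apply]
  exact (fillL h F).map_neg Ψ
theorem fill_zero : fill h (0 : E [⋀^Fin p]→L[ℝ] Poly V r) F = 0 := by
  simp only [← fillL_apply, map_zero]
theorem fill_sum {ι : Type*} (s : Finset ι) (Ψ : ι → E [⋀^Fin p]→L[ℝ] Poly V r) :
    fill h (∑ i ∈ s, Ψ i) F = ∑ i ∈ s, fill h (Ψ i) F := by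
  simp only [← fillL_apply, map_sum]
end Linear

theorem fill_compContinuousLinearMap {E' : Type*} [NormedAddCommGroup E'] [NormedSpace ℝ E']
    (f : E' →L[ℝ] E) : {r p l : ℕ} → (h : p + 2 * r = l) → (Ψ : E [⋀^Fin p]→L[ℝ] Poly V r) →
    (F : E [⋀^Fin 2]→L[ℝ] V) → (fill h Ψ F).compContinuousLinearMap f =
      fill h (Ψ.compContinuousLinearMap f) (F.compContinuousLinearMap f)
  | 0, _, _, h, Ψ, F => by subst h; rfl
  | r + 1, _, _, h, Ψ, F => by
      rw [fill, fill, fill_compContinuousLinearMap f, wedge_compContinuousLinearMap]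

/-- The derivative of `F ↦ Ψ Fʳ` in the direction `G`, divided by `r`, for symmetric `Ψ`. -/
def fillVar : {r p l : ℕ} → (p + 2 * r = l) → E [⋀^Fin p]→L[ℝ] Poly V r → E [⋀^Fin 2]→L[ℝ] V →
      E [⋀^Fin 2]→L[ℝ] V → E [⋀^Fin l]→L[ℝ] ℝ
  | 0, _, _, _, _, _, _ => 0
  | r + 1, _, _, h, Ψ, F, G => fill (by omega) (wedge (insertFirst V r) rfl Ψ G) F

/-- `fillVar` as a continuous linear map in its last argument. -/
def fillVarL : {r p l : ℕ} → (p + 2 * r = l) → E [⋀^Fin p]→L[ℝ] Poly V r → E [⋀^Fin 2]→L[ℝ] V →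
      (E [⋀^Fin 2]→L[ℝ] V) →L[ℝ] E [⋀^Fin l]→L[ℝ] ℝ
  | 0, _, _, _, _, _ => 0
  | r + 1, _, _, h, Ψ, F => (fillL (by omega) F).comp (wedgeL (insertFirst V r) rfl Ψ)

theorem fillVarL_apply {r p l : ℕ} (h : p + 2 * r = l) (Ψ : E [⋀^Fin p]→L[ℝ] Poly V r)
    (F G : E [⋀^Fin 2]→L[ℝ] V) : fillVarL h Ψ F G = fillVar h Ψ F G := by
  cases r with
  | zero => rfl
  | succ r => rw [fillVarL, fillVar, ContinuousLinearMap.comp_apply, fillL_apply]; rfl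

/-- Two-forms commute without sign, so the slot that receives `G` is immaterial. The factor `r`
covers `r = 0`, where `fillVar` is zero by convention and the right side need not be. -/
theorem smul_fillVar_wedge {r p l : ℕ} (h : p + 2 + 2 * r = l)
    {Ψ : E [⋀^Fin p]→L[ℝ] Poly V (r + 1)} (hΨ : SymmValued Ψ) (F G : E [⋀^Fin 2]→L[ℝ] V) :
    (r : ℝ) • fillVar h (wedge (insertFirst V r) rfl Ψ F) F G =
      (r : ℝ) • fill h (wedge (insertFirst V r) rfl Ψ G) F := by
  cases r with
  | zero => simp
  | succ r =>
    rw [fillVar, fill, hΨ.wedge_swap rfl rfl rfl rfl, (by decide : Even (2 * 2)).neg_one_pow,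
      one_smul]

/-- The derivative of `fill`. -/
theorem hasFDerivWithinAt_fill {G : Type*} [NormedAddCommGroup G] [NormedSpace ℝ G] {S : Set G}
    {x : G} : {r p l : ℕ} → (h : p + 2 * r = l) →
    {Ψ : G → E [⋀^Fin p]→L[ℝ] Poly V r} → {F : G → E [⋀^Fin 2]→L[ℝ] V} →
    {Ψ' : G →L[ℝ] E [⋀^Fin p]→L[ℝ] Poly V r} → {F' : G →L[ℝ] E [⋀^Fin 2]→L[ℝ] V} →
    SymmValued (Ψ x) →
    HasFDerivWithinAt Ψ Ψ' S x → HasFDerivWithinAt F F' S x →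
    HasFDerivWithinAt (fun y => fill h (Ψ y) (F y))
      ((fillL h (F x)).comp Ψ' + (r : ℝ) • (fillVarL h (Ψ x) (F x)).comp F') S x
  | 0, p, l, h, Ψ, F, Ψ', F', hs, hΨ, hF => by
      have h1 : HasFDerivWithinAt (fun y => fillL h (F x) (Ψ y)) ((fillL h (F x)).comp Ψ') S x :=
        (fillL h (F x)).hasFDerivAt.comp_hasFDerivWithinAt x hΨ
      simp only [fillL_apply] at h1
      refine h1.congr_fderiv ?_
      simp
  | r + 1, p, l, h, Ψ, F, Ψ', F', hs, hΨ, hF => by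
      have hw := (wedgeL (E := E) (l := p + 2) (insertFirst V r) rfl).hasFDerivWithinAt_of_bilinear
        hΨ hF
      have h' : p + 2 + 2 * r = l := by omega
      have := hasFDerivWithinAt_fill h' (hs.wedge_insertFirst rfl (F x)) hw hF
      refine this.congr_fderiv ?_
      apply ContinuousLinearMap.ext
      intro v
      -- Differentiating the newly filled slot gives one term with `F'`, the remaining slots give
      -- `r` of them; symmetry identifies all these terms, for a total of `r + 1`.
      have hcomm := smul_fillVar_wedge h' hs (F x) (F' v)
      have e1 : fillVar h (Ψ x) (F x) (F' v) =
        fill h' (wedge (insertFirst V r) rfl (Ψ x) (F' v)) (F x) := rfl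
      have e2 : fill h (Ψ' v) (F x) =
        fill h' (wedge (insertFirst V r) rfl (Ψ' v) (F x)) (F x) := rfl
      simp only [add_apply, smul_apply, ContinuousLinearMap.comp_apply, fillL_apply,
        fillVarL_apply, ContinuousLinearMap.precompR_apply, ContinuousLinearMap.precompL_apply,
        ContinuousLinearMap.compL_apply,
        wedgeL_apply, e1, e2, hcomm, fill_add]
      push_cast
      module

/-- The action of an endomorphism as a derivation on multilinear forms. -/
def polyAct (A : V →L[ℝ] V) (r : ℕ) : Poly V r →L[ℝ] Poly V r :=
  ∑ i : Fin r, ContinuousMultilinearMap.compContinuousLinearMapL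
    (fun j => if j = i then A else ContinuousLinearMap.id ℝ V)

theorem polyAct_apply (A : V →L[ℝ] V) (r : ℕ) (f : Poly V r) (v : Fin r → V) :
    polyAct A r f v = ∑ i, f (Function.update v i (A (v i))) := by
  simp only [polyAct, sum_apply]
  refine Finset.sum_congr rfl fun i _ => ?_
  change f _ = _
  congr 1
  funext j
  by_cases h : j = i
  · subst h; simp
  · simp [h]

theorem insertFirst_polyAct (A : V →L[ℝ] V) (r : ℕ) (f : Poly V (r + 1)) (z : V) :
    insertFirst V r (polyAct A (r + 1) f) z =
      polyAct A r (insertFirst V r f z) + insertFirst V r f (A z) := by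
  ext v
  simp only [insertFirst_apply, polyAct_apply, add_apply,
    Fin.sum_univ_succ, Fin.cons_zero, Fin.cons_succ, Fin.update_cons_zero, Fin.cons_update]
  rw [add_comm]

/-- Leibniz rule: an endomorphism acting on all slots acts on the free slots and on the one that has
been filled. -/
theorem wedge_insertFirst_polyAct (A : V →L[ℝ] V) {p q l r : ℕ} (h : p + q = l)
    (Ψ : E [⋀^Fin p]→L[ℝ] Poly V (r + 1)) (Z : E [⋀^Fin q]→L[ℝ] V) :
    wedge (insertFirst V r) h ((polyAct A (r + 1)).compContinuousAlternatingMap Ψ) Z =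
      (polyAct A r).compContinuousAlternatingMap (wedge (insertFirst V r) h Ψ Z) +
        wedge (insertFirst V r) h Ψ (A.compContinuousAlternatingMap Z) := by
  ext1 v
  simp only [wedge_apply', ContinuousAlternatingMap.add_apply,
    ContinuousLinearMap.compContinuousAlternatingMap_coe, Function.comp_apply, map_smul, map_sum,
    Units.smul_def, map_zsmul, insertFirst_polyAct, smul_add, Finset.sum_add_distrib]

/-- Once every slot is filled, the derivation can only hit one of the `r` copies of `F`, and by
symmetry these contributions agree. This is how invariance of the polynomial becomes an identity
between forms. -/
theorem fill_polyAct (A : V →L[ℝ] V) : {r p l : ℕ} → (h : p + 2 * r = l) →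
    {Ψ : E [⋀^Fin p]→L[ℝ] Poly V r} → SymmValued Ψ → (F : E [⋀^Fin 2]→L[ℝ] V) →
    fill h ((polyAct A r).compContinuousAlternatingMap Ψ) F =
      (r : ℝ) • fillVar h Ψ F (A.compContinuousAlternatingMap F)
  | 0, _, _, h, Ψ, hΨ, F => by
      subst h
      ext v
      simp only [fill, polyAct]
      simp [castDeg_rfl, fillVar]
  | r + 1, _, _, h, Ψ, hΨ, F => by
      rw [fill, wedge_insertFirst_polyAct, fill_add,
        fill_polyAct A _ (hΨ.wedge_insertFirst rfl F), smul_fillVar_wedge _ hΨ, fillVar]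
      push_cast
      rw [add_smul, one_smul]

/-- Precomposition of all arguments of a multilinear form with a linear map. -/
def polyPrecomp {W : Type*} [NormedAddCommGroup W] [NormedSpace ℝ W] (A : W →L[ℝ] V) (r : ℕ) :
    Poly V r →L[ℝ] Poly W r :=
  ContinuousMultilinearMap.compContinuousLinearMapL (fun _ => A)

theorem polyPrecomp_apply (A : V →L[ℝ] V) (r : ℕ) (f : Poly V r) (v : Fin r → V) :
    polyPrecomp A r f v = f (fun i => A (v i)) := rfl

theorem insertFirst_polyPrecomp (A : V →L[ℝ] V) (r : ℕ) (f : Poly V (r + 1)) (z : V) :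
    insertFirst V r (polyPrecomp A (r + 1) f) z =
      polyPrecomp A r (insertFirst V r f (A z)) := by
  ext v
  simp only [insertFirst_apply, polyPrecomp_apply]
  congr 1
  funext i
  refine Fin.cases ?_ (fun i => ?_) i <;> simp

theorem wedge_insertFirst_polyPrecomp (A : V →L[ℝ] V) {p q l r : ℕ} (h : p + q = l)
    (Ψ : E [⋀^Fin p]→L[ℝ] Poly V (r + 1)) (Z : E [⋀^Fin q]→L[ℝ] V) :
    wedge (insertFirst V r) h ((polyPrecomp A (r + 1)).compContinuousAlternatingMap Ψ) Z =
      (polyPrecomp A r).compContinuousAlternatingMap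
        (wedge (insertFirst V r) h Ψ (A.compContinuousAlternatingMap Z)) := by
  ext1 v
  simp only [wedge_apply', 
    ContinuousLinearMap.compContinuousAlternatingMap_coe, Function.comp_apply, map_smul, map_sum,
    Units.smul_def, map_zsmul, insertFirst_polyPrecomp]

/-- Transfers identities between multilinear forms to filled forms; applied later to the projections
on the two graded parts of the algebra. -/
theorem fill_polyPrecomp (A : V →L[ℝ] V) : {r p l : ℕ} → (h : p + 2 * r = l) →
    (Ψ : E [⋀^Fin p]→L[ℝ] Poly V r) → (F : E [⋀^Fin 2]→L[ℝ] V) →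
    fill h ((polyPrecomp A r).compContinuousAlternatingMap Ψ) F =
      fill h Ψ (A.compContinuousAlternatingMap F)
  | 0, _, _, h, Ψ, F => by
      subst h
      ext v
      simp only [fill, castDeg_rfl]
      change (polyPrecomp A 0 (Ψ v)) 0 = Ψ v 0
      rw [polyPrecomp_apply]
      congr 1
      exact Subsingleton.elim _ _
  | r + 1, _, _, h, Ψ, F => by
      rw [fill, fill, wedge_insertFirst_polyPrecomp, fill_polyPrecomp A]

/-- Multiplication of a real form from the left. -/
def smulPairing (V : Type*) [NormedAddCommGroup V] [NormedSpace ℝ V] : ℝ →L[ℝ] V →L[ℝ] V :=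
  ContinuousLinearMap.lsmul ℝ ℝ

/-- Real forms can be pulled out to the left of any wedge product. Together with the two results
below, this reduces Leibniz rules to moving coordinate one-forms to the front. -/
theorem wedge_smulPairing_wedge {U W X : Type*} [NormedAddCommGroup U] [NormedSpace ℝ U]
    [NormedAddCommGroup W] [NormedSpace ℝ W] [NormedAddCommGroup X] [NormedSpace ℝ X]
    (B : U →L[ℝ] W →L[ℝ] X) {q p s m m' l : ℕ} (h₁ : q + m = l) (h₂ : p + s = m)
    (h₁' : q + p = m') (h₂' : m' + s = l) (lam : E [⋀^Fin q]→L[ℝ] ℝ)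
    (α : E [⋀^Fin p]→L[ℝ] U) (β : E [⋀^Fin s]→L[ℝ] W) :
    wedge (smulPairing X) h₁ lam (wedge B h₂ α β) =
      wedge B h₂' (wedge (smulPairing U) h₁' lam α) β :=
  (wedge_assoc _ _ _ _ h₁' h₂' h₂ h₁ lam α β fun u b c => by simp [smulPairing]).symm

theorem wedge_wedge_smulPairing {U W X : Type*} [NormedAddCommGroup U] [NormedSpace ℝ U]
    [NormedAddCommGroup W] [NormedSpace ℝ W] [NormedAddCommGroup X] [NormedSpace ℝ X]
    (B : U →L[ℝ] W →L[ℝ] X) {q p s m m' l : ℕ} (h₁ : p + m = l) (h₂ : q + s = m)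
    (h₁' : p + s = m') (h₂' : q + m' = l) (lam : E [⋀^Fin q]→L[ℝ] ℝ)
    (α : E [⋀^Fin p]→L[ℝ] U) (β : E [⋀^Fin s]→L[ℝ] W) :
    wedge B h₁ α (wedge (smulPairing W) h₂ lam β) =
      (-1 : ℝ) ^ (p * q) • wedge (smulPairing X) h₂' lam (wedge B h₁' α β) := by
  rw [wedge_smulPairing_wedge B h₂' h₁' (add_comm q p) (by omega),
    wedge_comm (smulPairing U) (add_comm q p) rfl, mul_comm q p, wedge_smul_left, smul_smul,
    ← pow_add, ← two_mul, (even_two_mul _).neg_one_pow, one_smul]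
  exact (wedge_assoc _ _ _ _ rfl (by omega) h₂ h₁ α lam β fun u b c => by
    simp [smulPairing]).symm

theorem fill_wedge_smulPairing : {r q p m m' l : ℕ} → (h₁ : q + m = l) → (h₂ : p + 2 * r = m) →
    (h₁' : q + p = m') → (h₂' : m' + 2 * r = l) → (lam : E [⋀^Fin q]→L[ℝ] ℝ) →
    (Ψ : E [⋀^Fin p]→L[ℝ] Poly V r) → (F : E [⋀^Fin 2]→L[ℝ] V) →
    wedge (smulPairing ℝ) h₁ lam (fill h₂ Ψ F) =
      fill h₂' (wedge (smulPairing (Poly V r)) h₁' lam Ψ) F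
  | 0, _, _, _, _, _, h₁, h₂, h₁', h₂', lam, Ψ, F => by
      subst h₂ h₁' h₂'
      ext v
      simp only [fill, castDeg_rfl, ContinuousLinearMap.compContinuousAlternatingMap_coe,
        Function.comp_apply, wedge_apply', map_smul, map_sum, Units.smul_def, map_zsmul,
        smulPairing, ContinuousLinearMap.lsmul_apply]
      rfl
  | r + 1, q, p, m, m', l, h₁, h₂, h₁', h₂', lam, Ψ, F => by
      rw [fill, fill, fill_wedge_smulPairing (m' := m' + 2) h₁ _ (by omega) (by omega),
        wedge_smulPairing_wedge _ _ _ h₁' rfl]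

end Fill

/-! ### Antisymmetrization, the algebraic half of the exterior derivative. -/

section AlternatizeUncurry

open ContinuousAlternatingMap (alternatizeUncurryFin alternatizeUncurryFin_apply)

variable {E V W X : Type*} [NormedAddCommGroup E] [NormedSpace ℝ E] [NormedAddCommGroup V]
  [NormedSpace ℝ V] [NormedAddCommGroup W] [NormedSpace ℝ W] [NormedAddCommGroup X]
  [NormedSpace ℝ X]

/-- A zero-form takes no arguments, so all q! permutations contribute the same term and the
normalization cancels them. -/
theorem wedge_const0_apply {q l : ℕ} (B : V →L[ℝ] W →L[ℝ] X) (h : 0 + q = l) (h' : q = l) (c : V)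
    (Z : E [⋀^Fin q]→L[ℝ] W) (v : Fin l → E) :
    wedge B h (const0 c) Z v = B c (Z fun i => v (Fin.cast h' i)) := by
  subst h'
  rw [wedge_apply']
  have : ∀ σ : Equiv.Perm (Fin q), Equiv.Perm.sign σ • B ((const0 (E := E) c) fun i =>
      v (σ (Fin.cast h (Fin.castAdd q i)))) (Z fun j => v (σ (Fin.cast h (Fin.natAdd 0 j)))) =
      B c (Z v) := by
    intro σ
    have e : ∀ j : Fin q, Fin.cast h (Fin.natAdd 0 j) = j := fun j => by ext; simp
    simp only [e]
    have h2 : Z (fun j => v (σ j)) = Equiv.Perm.sign σ • Z v := Z.toAlternatingMap.map_perm v σ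
    rw [h2]
    change Equiv.Perm.sign σ • B c _ = _
    rw [Units.smul_def, Units.smul_def, map_zsmul, smul_smul, ← Units.val_mul, Int.units_mul_self]
    simp
  rw [Finset.sum_congr rfl fun σ _ => this σ, Finset.sum_const, Finset.card_univ,
    Fintype.card_perm, Fintype.card_fin, ← Nat.cast_smul_eq_nsmul ℝ, smul_smul]
  have := Nat.factorial_ne_zero q
  rw [Nat.factorial_zero, Nat.cast_one, one_mul, inv_mul_cancel₀ (by exact_mod_cast this), one_smul]
  rfl

theorem wedge_const0 {q : ℕ} (B : V →L[ℝ] W →L[ℝ] X) (c : V) (Z : E [⋀^Fin q]→L[ℝ] W) :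
    wedge B (zero_add q) (const0 c) Z = (B c).compContinuousAlternatingMap Z := by
  ext v
  rw [wedge_const0_apply B _ rfl]; rfl

/-- A permutation of `Fin (q + 1)` is given by the image `i` of `0` and a permutation of the
remaining entries. -/
def permOfFin (q : ℕ) (x : Fin (q + 1) × Equiv.Perm (Fin q)) : Equiv.Perm (Fin (q + 1)) :=
  x.1.cycleRange.symm * Equiv.Perm.decomposeFin.symm (0, x.2)

theorem permOfFin_zero (q : ℕ) (x : Fin (q + 1) × Equiv.Perm (Fin q)) :
    permOfFin q x 0 = x.1 := by
  simp [permOfFin]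

theorem permOfFin_succ (q : ℕ) (x : Fin (q + 1) × Equiv.Perm (Fin q)) (j : Fin q) :
    permOfFin q x j.succ = x.1.succAbove (x.2 j) := by
  simp [permOfFin]

theorem sign_permOfFin (q : ℕ) (x : Fin (q + 1) × Equiv.Perm (Fin q)) :
    Equiv.Perm.sign (permOfFin q x) = (-1) ^ (x.1 : ℕ) * Equiv.Perm.sign x.2 := by
  rw [permOfFin, Equiv.Perm.sign_mul, Equiv.Perm.sign_symm, Fin.sign_cycleRange,
    Equiv.Perm.decomposeFin.symm_sign]
  simp

theorem permOfFin_bijective (q : ℕ) : Function.Bijective (permOfFin q) := by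
  rw [Fintype.bijective_iff_injective_and_card]
  constructor
  · rintro ⟨i, σ⟩ ⟨j, τ⟩ h
    have h0 : i = j := by
      simpa only [permOfFin_zero] using congrArg (fun π : Equiv.Perm (Fin (q + 1)) => π 0) h
    subst h0
    have : (0, σ) = ((0 : Fin (q + 1)), τ) :=
      Equiv.Perm.decomposeFin.symm.injective (mul_left_cancel h)
    simp only [Prod.mk.injEq, true_and] at this ⊢
    exact this
  · simp [Fintype.card_perm, Nat.factorial_succ]

/-- Antisymmetrization of `v ↦ B (a v) Z` for a one-form `a` is the wedge product of `a` and `Z`. -/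
theorem alternatizeUncurryFin_eq_wedge {q : ℕ} (B : V →L[ℝ] W →L[ℝ] X) (h : 1 + q = q + 1)
    (a : E [⋀^Fin 1]→L[ℝ] V) (Z : E [⋀^Fin q]→L[ℝ] W) (φ : E →L[ℝ] E [⋀^Fin q]→L[ℝ] X)
    (H : ∀ v u, φ v u = B (a fun _ => v) (Z u)) :
    alternatizeUncurryFin φ = wedge B h a Z := by
  ext v
  -- Permutations are grouped by the image of 0. For a fixed image the q! permutations of the other
  -- places give equal terms, since `Z` is alternating.
  rw [alternatizeUncurryFin_apply, wedge_apply',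
    ← (Equiv.ofBijective _ (permOfFin_bijective q)).sum_comp, Fintype.sum_prod_type]
  simp only [Equiv.ofBijective_apply]
  have h1 : ∀ i : Fin 1, Fin.cast h (Fin.castAdd q i) = 0 := by intro i; ext; simp
  have h2 : ∀ j : Fin q, Fin.cast h (Fin.natAdd 1 j) = j.succ := by
    intro i; ext; simp
  have : ∀ (i : Fin (q + 1)) (σ : Equiv.Perm (Fin q)),
      Equiv.Perm.sign (permOfFin q (i, σ)) •
        B (a fun k => v (permOfFin q (i, σ) (Fin.cast h (Fin.castAdd q k))))
          (Z fun j => v (permOfFin q (i, σ) (Fin.cast h (Fin.natAdd 1 j)))) =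
      (-1 : ℤ) ^ (i : ℕ) • φ (v i) (i.removeNth v) := by
    intro i σ
    simp only [h1, h2, permOfFin_zero, permOfFin_succ, H]
    have h3 : Z (fun j => v (i.succAbove (σ j))) = Equiv.Perm.sign σ • Z (i.removeNth v) :=
      Z.toAlternatingMap.map_perm (i.removeNth v) σ
    rw [h3, sign_permOfFin, Units.smul_def, Units.smul_def, map_zsmul, smul_smul, Units.val_mul,
      mul_assoc, ← Units.val_mul, Int.units_mul_self]
    simp
  simp only [this, Finset.sum_const, Finset.card_univ, Fintype.card_perm, Fintype.card_fin,
    ← Finset.smul_sum]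
  rw [← Nat.cast_smul_eq_nsmul ℝ, smul_smul]
  have := Nat.factorial_ne_zero q
  rw [Nat.factorial_one, Nat.cast_one, one_mul, inv_mul_cancel₀ (by exact_mod_cast this), one_smul]

/-- A continuous linear form as a one-form. -/
def oneForm (lam : E →L[ℝ] V) : E [⋀^Fin 1]→L[ℝ] V :=
  ContinuousAlternatingMap.ofSubsingleton ℝ E V (0 : Fin 1) lam

@[simp] theorem oneForm_apply (lam : E →L[ℝ] V) (v : Fin 1 → E) : oneForm lam v = lam (v 0) := rfl

section Basis

variable [FiniteDimensional ℝ E]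

/-- The coordinate formula for the exterior derivative: a linear map is the sum of its values on a
basis times the dual coordinates. It makes the antisymmetrization commute with every operation
through which coordinate one-forms can be pulled. -/
theorem alternatizeUncurryFin_eq_sum {ι : Type*} [Fintype ι] (b : Module.Basis ι ℝ E) {q : ℕ}
    (φ : E →L[ℝ] E [⋀^Fin q]→L[ℝ] X) :
    alternatizeUncurryFin φ = ∑ k, wedge (smulPairing X) (add_comm 1 q)
      (oneForm (LinearMap.toContinuousLinearMap (b.coord k))) (φ (b k)) := by
  have h1 : φ = ∑ k, (LinearMap.toContinuousLinearMap (b.coord k)).smulRight (φ (b k)) := by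
    refine ContinuousLinearMap.coe_inj.1 (b.ext fun i => ?_)
    classical simp [Finsupp.single_apply]
  have h2 : ∀ k, alternatizeUncurryFin
      ((LinearMap.toContinuousLinearMap (b.coord k)).smulRight (φ (b k))) =
      wedge (smulPairing X) (add_comm 1 q)
      (oneForm (LinearMap.toContinuousLinearMap (b.coord k))) (φ (b k)) := fun k =>
    alternatizeUncurryFin_eq_wedge _ _ _ _ _ fun v u => by simp [smulPairing]
  conv_lhs => rw [h1]
  rw [← ContinuousAlternatingMap.alternatizeUncurryFinCLM_apply, map_sum]
  exact Finset.sum_congr rfl fun k _ => h2 k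

theorem alternatizeUncurryFin_wedge_left {p q l : ℕ} (B : V →L[ℝ] W →L[ℝ] X) (h : p + q = l)
    (h' : p + 1 + q = l + 1) (φ : E →L[ℝ] E [⋀^Fin p]→L[ℝ] V) (β : E [⋀^Fin q]→L[ℝ] W) :
    alternatizeUncurryFin (((wedgeL B h).flip β).comp φ) =
      wedge B h' (alternatizeUncurryFin φ) β := by
  let b := Module.finBasis ℝ E
  rw [alternatizeUncurryFin_eq_sum b, alternatizeUncurryFin_eq_sum b, wedge_sum_left]
  refine Finset.sum_congr rfl fun k _ => ?_
  exact wedge_smulPairing_wedge B _ _ _ _ _ _ _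

theorem alternatizeUncurryFin_wedge_right {p q l : ℕ} (B : V →L[ℝ] W →L[ℝ] X) (h : p + q = l)
    (h' : p + (q + 1) = l + 1) (α : E [⋀^Fin p]→L[ℝ] V) (φ : E →L[ℝ] E [⋀^Fin q]→L[ℝ] W) :
    alternatizeUncurryFin ((wedgeL B h α).comp φ) =
      (-1 : ℝ) ^ p • wedge B h' α (alternatizeUncurryFin φ) := by
  let b := Module.finBasis ℝ E
  rw [alternatizeUncurryFin_eq_sum b, alternatizeUncurryFin_eq_sum b, wedge_sum_right,
    Finset.smul_sum]
  refine Finset.sum_congr rfl fun k _ => ?_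
  rw [wedge_wedge_smulPairing B h' (add_comm 1 q) h (add_comm 1 l), mul_one, smul_smul, ← mul_pow]
  simp

theorem alternatizeUncurryFin_fill {r p l : ℕ} (h : p + 2 * r = l) (h' : p + 1 + 2 * r = l + 1)
    (φ : E →L[ℝ] E [⋀^Fin p]→L[ℝ] Poly V r) (F : E [⋀^Fin 2]→L[ℝ] V) :
    alternatizeUncurryFin ((fillL h F).comp φ) = fill h' (alternatizeUncurryFin φ) F := by
  let b := Module.finBasis ℝ E
  rw [alternatizeUncurryFin_eq_sum b, alternatizeUncurryFin_eq_sum b, fill_sum]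
  refine Finset.sum_congr rfl fun k _ => ?_
  rw [ContinuousLinearMap.comp_apply, fillL_apply]
  exact fill_wedge_smulPairing _ _ _ _ _ _ _

/-- Applied with φ the covariant derivative of the curvature: the Bianchi identity removes all terms
in which a derivative falls on `F`. -/
theorem alternatizeUncurryFin_fillVar {r p l : ℕ} (h : p + 2 * r = l)
    (Ψ : E [⋀^Fin p]→L[ℝ] Poly V r) (F : E [⋀^Fin 2]→L[ℝ] V)
    (φ : E →L[ℝ] E [⋀^Fin 2]→L[ℝ] V) (hφ : alternatizeUncurryFin φ = 0) :
    alternatizeUncurryFin ((fillVarL h Ψ F).comp φ) = 0 := by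
  cases r with
  | zero =>
    have : (fillVarL h Ψ F).comp φ = 0 := by ext; simp [fillVarL]
    rw [this, ← ContinuousAlternatingMap.alternatizeUncurryFinCLM_apply, map_zero]
  | succ r =>
    rw [fillVarL, ContinuousLinearMap.comp_assoc, alternatizeUncurryFin_fill _ (by omega),
      alternatizeUncurryFin_wedge_right _ _ (by omega), hφ, wedge_zero_right, smul_zero, fill_zero]

end Basis

/-- The map `v ↦ B (a v) Z` for a one-form `a`. -/
def contractPairing {q : ℕ} (B : V →L[ℝ] W →L[ℝ] X) (a : E [⋀^Fin 1]→L[ℝ] V)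
    (Z : E [⋀^Fin q]→L[ℝ] W) : E →L[ℝ] E [⋀^Fin q]→L[ℝ] X :=
  ((wedgeL B (zero_add q)).flip Z).comp
    ((ContinuousAlternatingMap.constOfIsEmptyLIE ℝ E V (Fin 0)).toContinuousLinearEquiv.toContinuousLinearMap.comp
      ((ContinuousAlternatingMap.ofSubsingletonLIE (𝕜 := ℝ) (E := E) (F := V) (0 : Fin 1)).symm a))

theorem contractPairing_apply {q : ℕ} (B : V →L[ℝ] W →L[ℝ] X) (a : E [⋀^Fin 1]→L[ℝ] V)
    (Z : E [⋀^Fin q]→L[ℝ] W) (v : E) :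
    contractPairing B a Z v = (B (a fun _ => v)).compContinuousAlternatingMap Z :=
  wedge_const0 B (a fun _ => v) Z

theorem alternatizeUncurryFin_contractPairing {q : ℕ} (B : V →L[ℝ] W →L[ℝ] X)
    (a : E [⋀^Fin 1]→L[ℝ] V) (Z : E [⋀^Fin q]→L[ℝ] W) :
    alternatizeUncurryFin (contractPairing B a Z) = wedge B (add_comm 1 q) a Z :=
  alternatizeUncurryFin_eq_wedge _ _ _ _ _ fun v u => by rw [contractPairing_apply]; rfl

end AlternatizeUncurry

/-! ### The brackets ⟨Z Fⁿ⟩ and ⟨Y Z Fⁿ⁻¹⟩. -/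

section Angle

variable {E V : Type*} [NormedAddCommGroup E] [NormedSpace ℝ E] [NormedAddCommGroup V]
  [NormedSpace ℝ V] {n : ℕ}

theorem angle₁_add (f : Poly V (n + 1)) {p l : ℕ} (h : p + 2 * n = l)
    (Z Z' : E [⋀^Fin p]→L[ℝ] V) (F : E [⋀^Fin 2]→L[ℝ] V) :
    angle₁ f h (Z + Z') F = angle₁ f h Z F + angle₁ f h Z' F := by
  rw [angle₁, wedge_add_right, fill_add]; rfl

theorem angle₁_smul (f : Poly V (n + 1)) {p l : ℕ} (h : p + 2 * n = l) (c : ℝ)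
    (Z : E [⋀^Fin p]→L[ℝ] V) (F : E [⋀^Fin 2]→L[ℝ] V) :
    angle₁ f h (c • Z) F = c • angle₁ f h Z F := by
  rw [angle₁, wedge_smul_right, fill_smul]; rfl

theorem angle₁_sum (f : Poly V (n + 1)) {p l : ℕ} (h : p + 2 * n = l) {ι : Type*} (s : Finset ι)
    (Z : ι → E [⋀^Fin p]→L[ℝ] V) (F : E [⋀^Fin 2]→L[ℝ] V) :
    angle₁ f h (∑ i ∈ s, Z i) F = ∑ i ∈ s, angle₁ f h (Z i) F := by
  rw [angle₁, wedge_sum_right, fill_sum]; rfl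

theorem angle₁_compContinuousLinearMap {E' : Type*} [NormedAddCommGroup E'] [NormedSpace ℝ E']
    (g : E' →L[ℝ] E) (f : Poly V (n + 1)) {p l : ℕ} (h : p + 2 * n = l)
    (Z : E [⋀^Fin p]→L[ℝ] V) (F : E [⋀^Fin 2]→L[ℝ] V) :
    (angle₁ f h Z F).compContinuousLinearMap g =
      angle₁ f h (Z.compContinuousLinearMap g) (F.compContinuousLinearMap g) := by
  rw [angle₁, fill_compContinuousLinearMap, wedge_compContinuousLinearMap]; rfl

theorem angle₂_compContinuousLinearMap {E' : Type*} [NormedAddCommGroup E'] [NormedSpace ℝ E']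
    (g : E' →L[ℝ] E) (f : Poly V (n + 1)) {p q l : ℕ} (h : p + q + 2 * n = l + 2)
    (Y : E [⋀^Fin p]→L[ℝ] V) (Z : E [⋀^Fin q]→L[ℝ] V) (F : E [⋀^Fin 2]→L[ℝ] V) :
    (angle₂ f h Y Z F).compContinuousLinearMap g =
      angle₂ f h (Y.compContinuousLinearMap g) (Z.compContinuousLinearMap g)
        (F.compContinuousLinearMap g) := by
  cases n with
  | zero => rfl
  | succ n =>
    simp only [angle₂]
    rw [fill_compContinuousLinearMap, wedge_compContinuousLinearMap,
      wedge_compContinuousLinearMap]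
    rfl

theorem angle₂_zero_left (f : Poly V (n + 1)) {p q l : ℕ} (h : p + q + 2 * n = l + 2)
    (Z : E [⋀^Fin q]→L[ℝ] V) (F : E [⋀^Fin 2]→L[ℝ] V) :
    angle₂ f h (0 : E [⋀^Fin p]→L[ℝ] V) Z F = 0 := by
  cases n with
  | zero => rfl
  | succ n => rw [angle₂, wedge_zero_right, wedge_zero_left, fill_zero]

theorem angle₂_zero_right (f : Poly V (n + 1)) {p q l : ℕ} (h : p + q + 2 * n = l + 2)
    (Y : E [⋀^Fin p]→L[ℝ] V) (F : E [⋀^Fin 2]→L[ℝ] V) :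
    angle₂ f h Y (0 : E [⋀^Fin q]→L[ℝ] V) F = 0 := by
  cases n with
  | zero => rfl
  | succ n => rw [angle₂, wedge_zero_right, fill_zero]

theorem angle₂_swap {f : Poly V (n + 1)} (hf : IsSymmPoly f) {p q l : ℕ}
    (h : p + q + 2 * n = l + 2) (h' : q + p + 2 * n = l + 2)
    (Y : E [⋀^Fin p]→L[ℝ] V) (Z : E [⋀^Fin q]→L[ℝ] V) (F : E [⋀^Fin 2]→L[ℝ] V) :
    angle₂ f h Y Z F = (-1 : ℝ) ^ (p * q) • angle₂ f h' Z Y F := by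
  cases n with
  | zero => simp [angle₂]
  | succ n =>
    rw [angle₂, angle₂, (symmValued_const0 hf).wedge_swap _ _ (zero_add q) (add_comm q p),
      fill_smul]
    congr 1
    have : ∀ {m m' : ℕ} (e : m = m') (h₁ : q + p = m) (h₂ : q + p = m')
        (k₁ : m + 2 * n = l) (k₂ : m' + 2 * n = l),
        fill k₁ (wedge (insertFirst V n) h₁ (wedge (insertFirst V (n + 1)) (zero_add q)
          (const0 f) Z) Y) F =
        fill k₂ (wedge (insertFirst V n) h₂ (wedge (insertFirst V (n + 1)) (zero_add q)
          (const0 f) Z) Y) F := by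
      rintro m _ rfl _ _ _ _; rfl
    exact this (add_comm p q) _ _ _ _

/-- The derivative of `τ ↦ ⟨Z F(τ)ⁿ⟩`. -/
theorem hasDerivAt_angle₁ {f : Poly V (n + 1)} (hf : IsSymmPoly f) {p l : ℕ}
    (h : p + 2 * n = l) (h' : p + 2 + 2 * n = l + 2) (Z : E [⋀^Fin p]→L[ℝ] V)
    {F : ℝ → E [⋀^Fin 2]→L[ℝ] V} {F' : E [⋀^Fin 2]→L[ℝ] V} {τ : ℝ} (hF : HasDerivAt F F' τ) :
    HasDerivAt (fun τ => angle₁ f h Z (F τ)) ((n : ℝ) • angle₂ f h' Z F' (F τ)) τ := by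
  have hs := (symmValued_const0 (E := E) hf).wedge_insertFirst (zero_add p) Z
  have := hasFDerivWithinAt_fill (S := univ) (x := τ) h
    (Ψ := fun _ => wedge (insertFirst V n) (zero_add p) (const0 f) Z) hs
    (hasFDerivWithinAt_const _ _ _) hF.hasFDerivAt.hasFDerivWithinAt
  rw [hasFDerivWithinAt_univ] at this
  refine (this.hasDerivAt).congr_deriv ?_
  cases n with
  | zero => simp [angle₂]
  | succ n =>
    simp only [ContinuousLinearMap.comp_zero, zero_add, smul_apply,
      ContinuousLinearMap.comp_apply, fillVarL_apply, ContinuousLinearMap.toSpanSingleton_apply,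
      one_smul]
    rfl

end Angle

/-! ### Leibniz rule, Bianchi identity and covariant differentiation on a subset of a vector space.
-/

section LocalCalculus

open ContinuousAlternatingMap (alternatizeUncurryFin)

variable {E V W X : Type*} [NormedAddCommGroup E] [NormedSpace ℝ E] [FiniteDimensional ℝ E]
  [NormedAddCommGroup V] [NormedSpace ℝ V] [NormedAddCommGroup W] [NormedSpace ℝ W]
  [NormedAddCommGroup X] [NormedSpace ℝ X]

/-- The Leibniz rule for the exterior derivative. -/
theorem extDerivWithin_wedge {p q l : ℕ} (B : V →L[ℝ] W →L[ℝ] X) (h : p + q = l)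
    (h₁ : p + 1 + q = l + 1) (h₂ : p + (q + 1) = l + 1)
    {α : E → E [⋀^Fin p]→L[ℝ] V} {β : E → E [⋀^Fin q]→L[ℝ] W} {S : Set E} {y : E}
    (hS : UniqueDiffWithinAt ℝ S y) (hα : DifferentiableWithinAt ℝ α S y)
    (hβ : DifferentiableWithinAt ℝ β S y) :
    extDerivWithin (fun z => wedge B h (α z) (β z)) S y =
      wedge B h₁ (extDerivWithin α S y) (β y) +
        (-1 : ℝ) ^ p • wedge B h₂ (α y) (extDerivWithin β S y) := by
  have hd := (wedgeL (E := E) B h).hasFDerivWithinAt_of_bilinear hα.hasFDerivWithinAt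
    hβ.hasFDerivWithinAt
  have e : fderivWithin ℝ (fun z => wedge B h (α z) (β z)) S y =
      ((wedgeL B h).flip (β y)).comp (fderivWithin ℝ α S y) +
        (wedgeL B h (α y)).comp (fderivWithin ℝ β S y) := by
    refine (hd.fderivWithin hS).trans ?_
    rw [add_comm]
    rfl
  rw [extDerivWithin, e, ContinuousAlternatingMap.alternatizeUncurryFin_add,
    alternatizeUncurryFin_wedge_left B h h₁, alternatizeUncurryFin_wedge_right B h h₂]
  rfl

/-- Continuous Lie brackets. -/
structure IsLieBracket (br : V →L[ℝ] V →L[ℝ] V) : Prop where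
  antisymm : ∀ x y, br x y = - br y x
  jacobi : ∀ x y z, br x (br y z) + br y (br z x) + br z (br x y) = 0

variable {br : V →L[ℝ] V →L[ℝ] V}

theorem IsLieBracket.wedge_comm (hbr : IsLieBracket br) {p q l : ℕ} (h : p + q = l)
    (h' : q + p = l) (α : E [⋀^Fin p]→L[ℝ] V) (β : E [⋀^Fin q]→L[ℝ] V) :
    wedge br h α β = -((-1 : ℝ) ^ (p * q) • wedge br h' β α) := by
  have : br.flip = -br := by
    ext x y
    simpa using hbr.antisymm y x
  rw [TGFT.wedge_comm br h h', this, wedge_neg_pairing, smul_neg]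

/-- The rotation of three arguments is even, so three times the antisymmetrized double bracket is a
signed sum of cyclic sums, each of which vanishes by the Jacobi identity. -/
theorem IsLieBracket.wedge_wedge_self (hbr : IsLieBracket br) {m l : ℕ} (h' : 1 + 1 = m)
    (h : 1 + m = l) (a : E [⋀^Fin 1]→L[ℝ] V) :
    wedge br h a (wedge br h' a a) = 0 := by
  subst h'
  have hl : l = 3 := by omega
  subst hl
  ext v
  rw [wedge_wedge_right_apply]
  have key : ∑ σ : Equiv.Perm (Fin 3), Equiv.Perm.sign σ •
      br (a fun i => v (σ ⟨i, by omega⟩)) (br (a fun j => v (σ ⟨1 + j, by omega⟩))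
          (a fun k => v (σ ⟨1 + 1 + k, by omega⟩))) = 0 := by
    let A : Fin 3 → V := fun i => a fun _ => v i
    let g : (Fin 3 → Fin 3) → V := fun τ => br (A (τ 0)) (br (A (τ 1)) (A (τ 2)))
    have h0 : ∀ σ : Equiv.Perm (Fin 3), br (a fun i => v (σ ⟨i, by omega⟩))
        (br (a fun j => v (σ ⟨1 + j, by omega⟩)) (a fun k => v (σ ⟨1 + 1 + k, by omega⟩))) =
        g σ := by
      intro σ
      have e1 : (fun i : Fin 1 => v (σ ⟨i, by omega⟩)) = fun _ => v (σ 0) := by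
        funext i; fin_cases i; rfl
      have e2 : (fun i : Fin 1 => v (σ ⟨1 + i, by omega⟩)) = fun _ => v (σ 1) := by
        funext i; fin_cases i; rfl
      have e3 : (fun i : Fin 1 => v (σ ⟨1 + 1 + i, by omega⟩)) = fun _ => v (σ 2) := by
        funext i; fin_cases i; rfl
      simp only [e1, e2, e3, g, A]
    simp only [h0]
    set c : Equiv.Perm (Fin 3) := finRotate 3 with hc
    have hs : Equiv.Perm.sign c = 1 := by rw [hc, sign_finRotate]; decide
    have r1 : ∑ σ : Equiv.Perm (Fin 3), Equiv.Perm.sign σ • g σ =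
        ∑ σ : Equiv.Perm (Fin 3), Equiv.Perm.sign σ • g (σ * c : Equiv.Perm (Fin 3)) :=
      (Fintype.sum_equiv (Equiv.mulRight c) _ _ fun σ => by simp [hs]).symm
    have r2 : ∑ σ : Equiv.Perm (Fin 3), Equiv.Perm.sign σ • g σ =
        ∑ σ : Equiv.Perm (Fin 3), Equiv.Perm.sign σ • g (σ * c * c : Equiv.Perm (Fin 3)) :=
      r1.trans (Fintype.sum_equiv (Equiv.mulRight c) _ _ fun σ => by simp [hs]).symm
    have r3 : (3 : ℝ) • ∑ σ : Equiv.Perm (Fin 3), Equiv.Perm.sign σ • g σ = 0 := by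
      have : (3 : ℝ) • ∑ σ : Equiv.Perm (Fin 3), Equiv.Perm.sign σ • g σ =
          ∑ σ : Equiv.Perm (Fin 3), Equiv.Perm.sign σ • g σ +
          ∑ σ : Equiv.Perm (Fin 3), Equiv.Perm.sign σ • g (σ * c : Equiv.Perm (Fin 3)) +
          ∑ σ : Equiv.Perm (Fin 3), Equiv.Perm.sign σ • g (σ * c * c : Equiv.Perm (Fin 3)) := by
        rw [← r1, ← r2]; module
      rw [this, ← Finset.sum_add_distrib, ← Finset.sum_add_distrib]
      refine Finset.sum_eq_zero fun σ _ => ?_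
      rw [← smul_add, ← smul_add]
      have c0 : c 0 = 1 := by decide
      have c1 : c 1 = 2 := by decide
      have c2 : c 2 = 0 := by decide
      simp only [g, Equiv.Perm.coe_mul, Function.comp, c0, c1, c2]
      rw [hbr.jacobi, smul_zero]
    exact (smul_eq_zero.1 r3).resolve_left (by norm_num)
  rw [key, smul_zero]; rfl

variable (br) in
/-- The curvature of a one-form on a subset `S` of a vector space. -/
def curvOn (S : Set E) (A : E → E [⋀^Fin 1]→L[ℝ] V) (y : E) : E [⋀^Fin 2]→L[ℝ] V :=
  extDerivWithin A S y + (1 / 2 : ℝ) • wedge br rfl (A y) (A y)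

theorem contDiffOn_extDerivWithin {p : ℕ} {S : Set E} (hS : UniqueDiffOn ℝ S)
    {α : E → E [⋀^Fin p]→L[ℝ] V} (hα : ContDiffOn ℝ ∞ α S) :
    ContDiffOn ℝ ∞ (extDerivWithin α S) S := by
  have h1 : ContDiffOn ℝ ∞ (fderivWithin ℝ α S) S := hα.fderivWithin hS (by simp)
  exact (ContinuousAlternatingMap.alternatizeUncurryFinCLM ℝ E V).contDiff.comp_contDiffOn h1

theorem contDiffOn_wedge {p q l : ℕ} {k : WithTop ℕ∞} (B : V →L[ℝ] W →L[ℝ] X) (h : p + q = l)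
    {G : Type*} [NormedAddCommGroup G] [NormedSpace ℝ G] {S : Set G}
    {α : G → E [⋀^Fin p]→L[ℝ] V} {β : G → E [⋀^Fin q]→L[ℝ] W}
    (hα : ContDiffOn ℝ k α S) (hβ : ContDiffOn ℝ k β S) :
    ContDiffOn ℝ k (fun z => wedge B h (α z) (β z)) S :=
  ((wedgeL (E := E) B h).contDiff.comp_contDiffOn hα).clm_apply hβ

theorem contDiffOn_curvOn {S : Set E} (hS : UniqueDiffOn ℝ S) {A : E → E [⋀^Fin 1]→L[ℝ] V}
    (hA : ContDiffOn ℝ ∞ A S) : ContDiffOn ℝ ∞ (curvOn br S A) S :=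
  (contDiffOn_extDerivWithin hS hA).add ((contDiffOn_wedge _ _ hA hA).const_smul _)

/-- The Bianchi identity. -/
theorem IsLieBracket.extDerivWithin_curvOn (hbr : IsLieBracket br) {S : Set E}
    (hS : UniqueDiffOn ℝ S) {A : E → E [⋀^Fin 1]→L[ℝ] V} (hA : ContDiffOn ℝ ∞ A S) {y : E}
    (hy : y ∈ S) (hy' : y ∈ closure (interior S)) :
    extDerivWithin (curvOn br S A) S y + wedge br rfl (A y) (curvOn br S A y) = 0 := by
  have hAd : DifferentiableWithinAt ℝ A S y := (hA.differentiableOn (by simp)) y hy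
  have hdd := extDerivWithin_extDerivWithin_apply (hA y hy)
    (by rw [minSmoothness_of_isRCLikeNormedField]; exact WithTop.coe_le_coe.2 (le_top : (2 : ℕ∞) ≤ ⊤)) hS hy' hy
  have h1 : DifferentiableWithinAt ℝ (extDerivWithin A S) S y :=
    ((contDiffOn_extDerivWithin hS hA).differentiableOn (by simp)) y hy
  have h2 : DifferentiableWithinAt ℝ (fun z => wedge br (rfl : 1 + 1 = 2) (A z) (A z)) S y :=
    ((contDiffOn_wedge br rfl hA hA).differentiableOn (by simp)) y hy
  have e1 : curvOn br S A = extDerivWithin A S +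
      (1 / 2 : ℝ) • fun z => wedge br (rfl : 1 + 1 = 2) (A z) (A z) := rfl
  -- Here ddA = 0, d(½[A,A]) = -[A,dA] cancels the bracket of `A` with dA, and the cubic term
  -- vanishes by Jacobi.
  rw [e1, extDerivWithin_add (hS y hy) h1 (h2.const_smul _), extDerivWithin_smul _ _ (hS y hy), hdd,
    extDerivWithin_wedge br rfl (by norm_num) (by norm_num) (hS y hy) hAd hAd,
    hbr.wedge_comm (by norm_num : 1 + 1 + 1 = 2 + 1) (by norm_num : 1 + (1 + 1) = 2 + 1)]
  simp only [Pi.add_apply, Pi.smul_apply, wedge_add_right, wedge_smul_right,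
    hbr.wedge_wedge_self]
  norm_num
  module

/-- The two mixed terms coincide because the bracket of one-forms is symmetric; they combine into
the covariant derivative DU. -/
theorem curvOn_add_smul (hbr : IsLieBracket br) {S : Set E} {A U : E → E [⋀^Fin 1]→L[ℝ] V}
    {y : E} (hS : UniqueDiffWithinAt ℝ S y) (hA : DifferentiableWithinAt ℝ A S y)
    (hU : DifferentiableWithinAt ℝ U S y) (τ : ℝ) :
    curvOn br S (A + τ • U) y = curvOn br S A y +
      τ • (extDerivWithin U S y + wedge br rfl (A y) (U y)) +
      τ ^ 2 • (1 / 2 : ℝ) • wedge br rfl (U y) (U y) := by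
  rw [curvOn, curvOn, extDerivWithin_add hS hA (hU.const_smul τ), extDerivWithin_smul _ _ hS]
  simp only [Pi.add_apply, Pi.smul_apply, wedge_add_right, wedge_smul_right, wedge_add_left,
    wedge_smul_left]
  rw [hbr.wedge_comm rfl rfl (U y) (A y)]
  norm_num
  module

theorem hasDerivAt_curvOn (hbr : IsLieBracket br) {S : Set E} {A U : E → E [⋀^Fin 1]→L[ℝ] V}
    {y : E} (hS : UniqueDiffWithinAt ℝ S y) (hA : DifferentiableWithinAt ℝ A S y)
    (hU : DifferentiableWithinAt ℝ U S y) (τ : ℝ) :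
    HasDerivAt (fun τ : ℝ => curvOn br S (A + τ • U) y)
      (extDerivWithin U S y + wedge br rfl ((A + τ • U) y) (U y)) τ := by
  simp only [curvOn_add_smul hbr hS hA hU]
  have h1 : HasDerivAt (fun τ : ℝ => curvOn br S A y +
      τ • (extDerivWithin U S y + wedge br rfl (A y) (U y)) +
      τ ^ 2 • (1 / 2 : ℝ) • wedge br rfl (U y) (U y))
      ((0 + (1 : ℝ) • (extDerivWithin U S y + wedge br rfl (A y) (U y))) +
      ((2 : ℕ) * τ ^ (2 - 1)) • (1 / 2 : ℝ) • wedge br rfl (U y) (U y)) τ :=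
    ((hasDerivAt_const _ _).add ((hasDerivAt_id τ).smul_const _)).add
      ((hasDerivAt_pow 2 τ).smul_const _)
  refine h1.congr_deriv ?_
  simp only [Pi.add_apply, Pi.smul_apply, wedge_add_left, wedge_smul_left]
  norm_num
  module

/-- `d⟨Y Z Fⁿ⁻¹⟩ = ⟨DY Z Fⁿ⁻¹⟩ - ⟨Y DZ Fⁿ⁻¹⟩` for one-forms `Y`, `Z`, a two-form `F` with `DF = 0`,
and an invariant polynomial, where `D` is the covariant derivative. -/
theorem extDerivWithin_angle₂ {n l : ℕ} {f : Poly V (n + 1)} (hf : IsSymmPoly f)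
    (hinv : ∀ x, polyAct (br x) (n + 1) f = 0) (h : 1 + 1 + 2 * n = l + 2)
    (h₁ : 2 + 1 + 2 * n = l + 1 + 2) (h₂ : 1 + 2 + 2 * n = l + 1 + 2)
    {S : Set E} {y : E} (hS : UniqueDiffWithinAt ℝ S y) (A : E [⋀^Fin 1]→L[ℝ] V)
    {Y Z : E → E [⋀^Fin 1]→L[ℝ] V} {F : E → E [⋀^Fin 2]→L[ℝ] V}
    (hY : DifferentiableWithinAt ℝ Y S y) (hZ : DifferentiableWithinAt ℝ Z S y)
    (hF : DifferentiableWithinAt ℝ F S y)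
    (hDF : extDerivWithin F S y + wedge br rfl A (F y) = 0) :
    extDerivWithin (fun z => angle₂ f h (Y z) (Z z) (F z)) S y =
      angle₂ f h₁ (extDerivWithin Y S y + wedge br rfl A (Y y)) (Z y) (F y) -
        angle₂ f h₂ (Y y) (extDerivWithin Z S y + wedge br rfl A (Z y)) (F y) := by
  cases n with
  | zero =>
    simp only [angle₂, sub_zero]
    rw [extDerivWithin, fderivWithin_fun_const]
    exact map_zero (ContinuousAlternatingMap.alternatizeUncurryFinCLM ℝ E ℝ)
  | succ m =>
    have hl : 2 + 2 * m = l := by omega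
    let I₁ := insertFirst V (m + 1)
    let I₀ := insertFirst V m
    let Y₁ : E → E [⋀^Fin 1]→L[ℝ] Poly V (m + 1) := fun z => wedge I₁ (zero_add 1) (const0 f) (Y z)
    let Φ : E → E [⋀^Fin 2]→L[ℝ] Poly V m := fun z => wedge I₀ rfl (Y₁ z) (Z z)
    let Y' := fderivWithin ℝ Y S y
    let Z' := fderivWithin ℝ Z S y
    let F' := fderivWithin ℝ F S y
    let K : (E [⋀^Fin 1]→L[ℝ] V) →L[ℝ] E [⋀^Fin 1]→L[ℝ] Poly V (m + 1) :=
      wedgeL I₁ (zero_add 1) (const0 f)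
    have hY₁ : HasFDerivWithinAt Y₁ (K.comp Y') S y :=
      K.hasFDerivAt.comp_hasFDerivWithinAt y hY.hasFDerivWithinAt
    let Lz : (E [⋀^Fin 1]→L[ℝ] Poly V (m + 1)) →L[ℝ] E [⋀^Fin 2]→L[ℝ] Poly V m :=
      (wedgeL I₀ rfl).flip (Z y)
    let Ly : (E [⋀^Fin 1]→L[ℝ] V) →L[ℝ] E [⋀^Fin 2]→L[ℝ] Poly V m := wedgeL I₀ rfl (Y₁ y)
    have hΦ : HasFDerivWithinAt Φ (Ly.comp Z' + Lz.comp (K.comp Y')) S y :=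
      (wedgeL (E := E) I₀ rfl).hasFDerivWithinAt_of_bilinear hY₁ hZ.hasFDerivWithinAt
    have hsY : SymmValued (Y₁ y) := (symmValued_const0 hf).wedge_insertFirst _ _
    have hs : SymmValued (Φ y) := hsY.wedge_insertFirst _ _
    have hd := hasFDerivWithinAt_fill hl hs hΦ hF.hasFDerivWithinAt
    have hval : ∀ z, fill hl (Φ z) (F z) = angle₂ f h (Y z) (Z z) (F z) := fun z => rfl
    -- Invariance under the Lie algebra element `A v`: the brackets with `Y`, with `Z` and with the
    -- copies of `F` sum to zero.
    have hinv' : ∀ v, fill hl (wedge I₀ rfl (K (contractPairing br A (Y y) v)) (Z y)) (F y) +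
        fill hl (wedge I₀ rfl (Y₁ y) (contractPairing br A (Z y) v)) (F y) +
        (m : ℝ) • fillVar hl (Φ y) (F y) (contractPairing br A (F y) v) = 0 := by
      intro v
      set x := br (A fun _ => v)
      have e1 := wedge_insertFirst_polyAct x (zero_add 1) (const0 (E := E) f) (Y y)
      have e0 : (polyAct x (m + 1 + 1)).compContinuousAlternatingMap (const0 (E := E) f) = 0 := by
        ext1 u
        exact hinv _
      rw [e0, wedge_zero_left] at e1
      have e2 := wedge_insertFirst_polyAct x rfl (Y₁ y) (Z y)
      have e3 := fill_polyAct x hl hs (F y)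
      have e4 : (polyAct x (m + 1)).compContinuousAlternatingMap (Y₁ y) =
          - wedge I₁ (zero_add 1) (const0 f) (x.compContinuousAlternatingMap (Y y)) :=
        eq_neg_of_add_eq_zero_left e1.symm
      rw [e4, wedge_neg_left] at e2
      rw [contractPairing_apply, contractPairing_apply, contractPairing_apply, ← e3, ← fill_add,
        ← fill_add]
      have e5 : wedge I₀ rfl (K (x.compContinuousAlternatingMap (Y y))) (Z y) +
          wedge I₀ rfl (Y₁ y) (x.compContinuousAlternatingMap (Z y)) +
          (polyAct x m).compContinuousAlternatingMap (Φ y) = 0 := by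
        rw [add_assoc, add_comm (wedge I₀ rfl (Y₁ y) _)]
        change _ + ((polyAct x m).compContinuousAlternatingMap (wedge I₀ rfl (Y₁ y) (Z y)) + _) = 0
        rw [← e2]
        exact add_neg_cancel _
      rw [e5, fill_zero]
    let L := fillL hl (F y)
    -- Adding this zero replaces all three ordinary derivatives by covariant ones, before any
    -- antisymmetrization.
    have hfd : fderivWithin ℝ (fun z => angle₂ f h (Y z) (Z z) (F z)) S y =
        L.comp (Lz.comp (K.comp (Y' + contractPairing br A (Y y)))) +
        L.comp (Ly.comp (Z' + contractPairing br A (Z y))) +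
        (m : ℝ) • (fillVarL hl (Φ y) (F y)).comp (F' + contractPairing br A (F y)) := by
      rw [← funext hval, hd.fderivWithin hS]
      apply ContinuousLinearMap.ext
      intro v
      have := hinv' v
      simp only [← fillL_apply, ← fillVarL_apply] at this
      simp only [add_apply, smul_apply, ContinuousLinearMap.comp_apply, map_add, smul_add]
      have e : ∀ (a b c d e g : E [⋀^Fin l]→L[ℝ] ℝ), d + e + g = 0 →
          b + a + c = a + d + (b + e) + (c + g) := by
        intro a b c d e g h0
        rw [show a + d + (b + e) + (c + g) = b + a + c + (d + e + g) by abel, h0, add_zero]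
      exact e _ _ _ _ _ _ this
    -- Antisymmetrized, the covariant derivative of `F` is DF, which is zero by hypothesis.
    have hF0 : alternatizeUncurryFin (F' + contractPairing br A (F y)) = 0 := by
      rw [ContinuousAlternatingMap.alternatizeUncurryFin_add,
        alternatizeUncurryFin_contractPairing]
      exact hDF
    rw [extDerivWithin, hfd, ContinuousAlternatingMap.alternatizeUncurryFin_add,
      ContinuousAlternatingMap.alternatizeUncurryFin_add,
      ContinuousAlternatingMap.alternatizeUncurryFin_smul, alternatizeUncurryFin_fillVar _ _ _ _ hF0,
      smul_zero, add_zero, alternatizeUncurryFin_fill hl (by omega),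
      alternatizeUncurryFin_fill hl (by omega)]
    have k1 : alternatizeUncurryFin (Lz.comp (K.comp (Y' + contractPairing br A (Y y)))) =
        wedge I₀ rfl (wedge I₁ (zero_add 2) (const0 f)
          (extDerivWithin Y S y + wedge br rfl A (Y y))) (Z y) := by
      rw [alternatizeUncurryFin_wedge_left _ _ rfl, alternatizeUncurryFin_wedge_right _ _ (zero_add 2),
        ContinuousAlternatingMap.alternatizeUncurryFin_add, alternatizeUncurryFin_contractPairing]
      simp only [pow_zero, one_smul]
      rfl
    -- The minus sign comes from moving the differentiation past the one-form `Y`.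
    have k2 : alternatizeUncurryFin (Ly.comp (Z' + contractPairing br A (Z y))) =
        - wedge I₀ rfl (Y₁ y) (extDerivWithin Z S y + wedge br rfl A (Z y)) := by
      rw [show Ly.comp (Z' + contractPairing br A (Z y)) =
        (wedgeL I₀ rfl (Y₁ y)).comp (Z' + contractPairing br A (Z y)) from rfl,
        alternatizeUncurryFin_wedge_right (p := 1) (q := 1) (l := 2) _ _ rfl,
        ContinuousAlternatingMap.alternatizeUncurryFin_add, alternatizeUncurryFin_contractPairing]
      simp only [pow_one, neg_smul, one_smul]
      rfl
    rw [k1, k2, fill_neg, ← sub_eq_add_neg]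
    rfl

end LocalCalculus

/-! ### Contractions with the Levi-Civita symbol. -/

section EpsilonSums

variable {n : ℕ}

/-- The sum `∑ ε_{a₁ … a_{2n+1}} Y₁^{a₁ a₂} ⋯ Yₙ^{a_{2n-1} a_{2n}} x^{a_{2n+1}}`. -/
def epsSum (x : Fin (2 * n + 1) → ℝ) (Y : Fin n → Fin (2 * n + 1) → Fin (2 * n + 1) → ℝ) : ℝ :=
  ∑ a : Fin (2 * n + 1) → Fin (2 * n + 1),
    epsilon a * (x (a (Fin.last (2 * n))) * ∏ j, Y j (a (pos j 0)) (a (pos j 1)))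

/-- The positions of the indices, as pairs and a last one. -/
def posEquiv (n : ℕ) : (Fin n × Fin 2) ⊕ Unit ≃ Fin (2 * n + 1) :=
  Equiv.ofBijective (Sum.elim (fun x => pos x.1 x.2) fun _ => Fin.last (2 * n)) <| by
    rw [Fintype.bijective_iff_injective_and_card]
    constructor
    · rintro (⟨j, s⟩ | _) (⟨k, t⟩ | _) h
      · obtain ⟨rfl, rfl⟩ := pos_inj h; rfl
      · exact absurd h (pos_ne_last j s)
      · exact absurd h.symm (pos_ne_last k t)
      · rfl
    · simp [mul_comm]

@[simp] theorem posEquiv_inl (j : Fin n) (s : Fin 2) : posEquiv n (Sum.inl (j, s)) = pos j s := rfl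
@[simp] theorem posEquiv_inr (u : Unit) : posEquiv n (Sum.inr u) = Fin.last (2 * n) := rfl

theorem epsilon_comp_perm (a : Fin (2 * n + 1) → Fin (2 * n + 1))
    (σ : Equiv.Perm (Fin (2 * n + 1))) :
    epsilon (a ∘ σ) = ((Equiv.Perm.sign σ : ℤ) : ℝ) * epsilon a := by
  unfold epsilon
  have := Matrix.det_permute σ
    ((1 : Matrix (Fin (2 * n + 1)) (Fin (2 * n + 1)) ℝ).submatrix a id)
  rwa [Matrix.submatrix_submatrix] at this

theorem epsilon_eq_zero {a : Fin (2 * n + 1) → Fin (2 * n + 1)} (ha : ¬ Function.Injective a) :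
    epsilon a = 0 := by
  simp only [Function.Injective, not_forall] at ha
  obtain ⟨x, y, hxy, hne⟩ := ha
  exact Matrix.det_zero_of_row_eq hne (by
    funext k
    exact congrArg (fun i => (1 : Matrix (Fin (2 * n + 1)) (Fin (2 * n + 1)) ℝ) i k) hxy)

/-- A permutation of the pairs moves the first and the second members alike, hence acts on the
positions as an even permutation and leaves ε unchanged. -/
theorem epsSum_perm (x : Fin (2 * n + 1) → ℝ)
    (Y : Fin n → Fin (2 * n + 1) → Fin (2 * n + 1) → ℝ) (τ : Equiv.Perm (Fin n)) :
    epsSum x (Y ∘ τ) = epsSum x Y := by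
  let e₀ : Equiv.Perm ((Fin n × Fin 2) ⊕ Unit) :=
    Equiv.sumCongr (Equiv.prodCongrLeft fun _ => τ) (Equiv.refl Unit)
  let e : Equiv.Perm (Fin (2 * n + 1)) := (posEquiv n).permCongr e₀
  have h1 : ∀ j s, e (pos j s) = pos (τ j) s := by
    intro j s
    rw [← posEquiv_inl, Equiv.permCongr_apply, Equiv.symm_apply_apply]; rfl
  have h2 : e (Fin.last (2 * n)) = Fin.last (2 * n) := by
    rw [← posEquiv_inr (), Equiv.permCongr_apply, Equiv.symm_apply_apply]; rfl
  have h3 : Equiv.Perm.sign e = 1 := by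
    have e1 : Equiv.Perm.sign e = Equiv.Perm.sign e₀ := Equiv.Perm.sign_permCongr _ _
    have e2 : Equiv.Perm.sign e₀ =
        Equiv.Perm.sign (Equiv.prodCongrLeft fun _ : Fin 2 => τ) *
          Equiv.Perm.sign (1 : Equiv.Perm Unit) := Equiv.Perm.sign_sumCongr _ _
    rw [e1, e2, Equiv.Perm.sign_prodCongrLeft]
    simp
  unfold epsSum
  refine Fintype.sum_equiv (Equiv.arrowCongr e (Equiv.refl _)) _ _ fun a => ?_
  set b := (Equiv.arrowCongr e (Equiv.refl (Fin (2 * n + 1)))) a with hb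
  have hab : a = b ∘ e := by funext i; simp [hb, Equiv.arrowCongr]
  rw [hab, epsilon_comp_perm, h3]
  simp only [Function.comp, h1, h2]
  rw [← Equiv.prod_comp τ (fun j => Y j (b (pos j 0)) (b (pos j 1)))]
  simp

theorem epsSum_update_add (x : Fin (2 * n + 1) → ℝ)
    (Y : Fin n → Fin (2 * n + 1) → Fin (2 * n + 1) → ℝ) (j : Fin n)
    (A B : Fin (2 * n + 1) → Fin (2 * n + 1) → ℝ) :
    epsSum x (Function.update Y j (A + B)) =
      epsSum x (Function.update Y j A) + epsSum x (Function.update Y j B) := by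
  unfold epsSum
  rw [← Finset.sum_add_distrib]
  refine Finset.sum_congr rfl fun a _ => ?_
  simp only [← Finset.mul_prod_erase Finset.univ _ (Finset.mem_univ j), Function.update_self]
  have : ∀ C, ∏ l ∈ Finset.univ.erase j, Function.update Y j C l (a (pos l 0)) (a (pos l 1)) =
      ∏ l ∈ Finset.univ.erase j, Y l (a (pos l 0)) (a (pos l 1)) := fun C =>
    Finset.prod_congr rfl fun l hl => by rw [Function.update_of_ne (Finset.ne_of_mem_erase hl)]
  rw [this, this, this]
  simp only [Pi.add_apply]
  ring

theorem epsSum_update_smul (x : Fin (2 * n + 1) → ℝ)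
    (Y : Fin n → Fin (2 * n + 1) → Fin (2 * n + 1) → ℝ) (j : Fin n) (c : ℝ)
    (A : Fin (2 * n + 1) → Fin (2 * n + 1) → ℝ) :
    epsSum x (Function.update Y j (c • A)) = c * epsSum x (Function.update Y j A) := by
  unfold epsSum
  rw [Finset.mul_sum]
  refine Finset.sum_congr rfl fun a _ => ?_
  simp only [← Finset.mul_prod_erase Finset.univ _ (Finset.mem_univ j), Function.update_self]
  have : ∀ C, ∏ l ∈ Finset.univ.erase j, Function.update Y j C l (a (pos l 0)) (a (pos l 1)) =
      ∏ l ∈ Finset.univ.erase j, Y l (a (pos l 0)) (a (pos l 1)) := fun C =>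
    Finset.prod_congr rfl fun l hl => by rw [Function.update_of_ne (Finset.ne_of_mem_erase hl)]
  rw [this, this]
  simp only [Pi.smul_apply, smul_eq_mul]
  ring

theorem epsSum_smul (c : ℝ) (x : Fin (2 * n + 1) → ℝ)
    (Y : Fin n → Fin (2 * n + 1) → Fin (2 * n + 1) → ℝ) :
    epsSum (c • x) Y = c * epsSum x Y := by
  unfold epsSum
  rw [Finset.mul_sum]
  refine Finset.sum_congr rfl fun a _ => ?_
  simp only [Pi.smul_apply, smul_eq_mul]
  ring

/-- Exchange of two vectors inserted at the last position and at position `s` of the pair `j`. -/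
theorem epsSum_exchange (x y z : Fin (2 * n + 1) → ℝ)
    (Y : Fin n → Fin (2 * n + 1) → Fin (2 * n + 1) → ℝ) (j : Fin n) (s : Fin 2)
    (M : (Fin (2 * n + 1) → ℝ) → Fin (2 * n + 1) → Fin (2 * n + 1) → ℝ)
    (hM : ∀ (w : Fin (2 * n + 1) → ℝ) (a : Fin (2 * n + 1) → Fin (2 * n + 1)),
      M w (a (pos j 0)) (a (pos j 1)) = w (a (pos j s)) * z (a (pos j (1 - s)))) :
    epsSum x (Function.update Y j (M y)) = - epsSum y (Function.update Y j (M x)) := by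
  let e : Equiv.Perm (Fin (2 * n + 1)) := Equiv.swap (pos j s) (Fin.last (2 * n))
  unfold epsSum
  rw [← Finset.sum_neg_distrib]
  refine Fintype.sum_equiv (Equiv.arrowCongr e (Equiv.refl _)) _ _ fun a => ?_
  set b := (Equiv.arrowCongr e (Equiv.refl (Fin (2 * n + 1)))) a with hb
  have hab : a = b ∘ e := by funext i; simp [hb, Equiv.arrowCongr]
  have h1 : ∀ l t, l ≠ j → e (pos l t) = pos l t := fun l t hl =>
    Equiv.swap_apply_of_ne_of_ne (fun h => hl (pos_inj h).1) (pos_ne_last l t)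
  have h2 : e (pos j s) = Fin.last (2 * n) := Equiv.swap_apply_left _ _
  have h3 : e (Fin.last (2 * n)) = pos j s := Equiv.swap_apply_right _ _
  have h4 : e (pos j (1 - s)) = pos j (1 - s) :=
    Equiv.swap_apply_of_ne_of_ne (fun h => by
      have := (pos_inj h).2
      revert this; fin_cases s <;> decide) (pos_ne_last _ _)
  simp only [← Finset.mul_prod_erase Finset.univ _ (Finset.mem_univ j), Function.update_self, hM]
  rw [hab, epsilon_swap _ _ _ (pos_ne_last j s)]
  simp only [Function.comp]
  have h5 : ∏ l ∈ Finset.univ.erase j, Function.update Y j (M y) l (b (e (pos l 0))) (b (e (pos l 1)))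
      = ∏ l ∈ Finset.univ.erase j, Function.update Y j (M x) l (b (pos l 0)) (b (pos l 1)) :=
    Finset.prod_congr rfl fun l hl => by
      have := Finset.ne_of_mem_erase hl
      rw [Function.update_of_ne this, Function.update_of_ne this, h1 l 0 this, h1 l 1 this]
  rw [h5, h2, h3, h4]
  ring

/-- The antisymmetric product of the `c`-th basis vector with `y`. -/
def basisWedge (c : Fin (2 * n + 1)) (y : Fin (2 * n + 1) → ℝ) (u v : Fin (2 * n + 1)) : ℝ :=
  (if u = c then 1 else 0) * y v - (if v = c then 1 else 0) * y u

theorem epsSum_basisWedge (c : Fin (2 * n + 1)) (x y : Fin (2 * n + 1) → ℝ)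
    (Y : Fin n → Fin (2 * n + 1) → Fin (2 * n + 1) → ℝ) (j : Fin n) :
    epsSum x (Function.update Y j (basisWedge c y)) =
      - epsSum y (Function.update Y j (basisWedge c x)) := by
  let z : Fin (2 * n + 1) → ℝ := fun u => if u = c then 1 else 0
  -- The antisymmetric product is a difference of two tensor products, with the free vector in the
  -- second and in the first place of the pair; `epsSum_exchange` applies to each.
  have h : ∀ w, basisWedge c w = (fun u v => w v * z u) + (-1 : ℝ) • fun u v => w u * z v := by
    intro w; funext u v; simp [basisWedge, z]; ring
  rw [h x, h y]
  simp only [epsSum_update_add, epsSum_update_smul]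
  rw [epsSum_exchange x y z Y j 1 (fun w u v => w v * z u) (fun w a => rfl),
    epsSum_exchange x y z Y j 0 (fun w u v => w u * z v) (fun w a => rfl)]
  ring

/-- Each index value occurs exactly once in a nonvanishing component of `ε`. -/
theorem epsSum_eq_sum_delta (c : Fin (2 * n + 1)) (x : Fin (2 * n + 1) → ℝ)
    (Y : Fin n → Fin (2 * n + 1) → Fin (2 * n + 1) → ℝ) :
    epsSum x Y = epsSum (fun u => if u = c then x u else 0) Y +
      ∑ j, epsSum x (Function.update Y j fun u v =>
        ((if u = c then 1 else 0) + (if v = c then 1 else 0)) * Y j u v) := by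
  unfold epsSum
  rw [Finset.sum_comm, ← Finset.sum_add_distrib]
  refine Finset.sum_congr rfl fun a _ => ?_
  by_cases ha : Function.Injective a
  · have hb := Finite.injective_iff_bijective.1 ha
    -- For injective `a` the index value `c` occurs at exactly one position; the sum of deltas over
    -- all positions is split into the pairs and the last place.
    have h1 : (∑ p, if a p = c then (1 : ℝ) else 0) = 1 := by
      obtain ⟨q, hq⟩ := hb.2 c
      rw [Finset.sum_eq_single q]
      · simp [hq]
      · intro p _ hp
        rw [if_neg]
        rintro h; exact hp (ha (h.trans hq.symm))
      · simp
    rw [← (posEquiv n).sum_comp, Fintype.sum_sum_type, Fintype.sum_prod_type] at h1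
    simp only [posEquiv_inl, posEquiv_inr, Fin.sum_univ_two, Finset.univ_unique,
      Finset.sum_singleton] at h1
    replace h1 : (∑ j, ((if a (pos j 0) = c then (1 : ℝ) else 0) +
        (if a (pos j 1) = c then 1 else 0))) + (if a (Fin.last (2 * n)) = c then 1 else 0) = 1 := h1
    have h2 : ∀ j, ∏ l, Function.update Y j (fun u v =>
        ((if u = c then 1 else 0) + (if v = c then 1 else 0)) * Y j u v) l
          (a (pos l 0)) (a (pos l 1)) =
        ((if a (pos j 0) = c then 1 else 0) + (if a (pos j 1) = c then 1 else 0)) *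
          ∏ l, Y l (a (pos l 0)) (a (pos l 1)) := by
      intro j
      rw [← Finset.mul_prod_erase Finset.univ _ (Finset.mem_univ j),
        ← Finset.mul_prod_erase Finset.univ (fun l => Y l (a (pos l 0)) (a (pos l 1)))
          (Finset.mem_univ j), Function.update_self, mul_assoc]
      congr 2
      exact Finset.prod_congr rfl fun l hl => by
        rw [Function.update_of_ne (Finset.ne_of_mem_erase hl)]
    simp only [h2]
    have h3 : (if a (Fin.last (2 * n)) = c then x (a (Fin.last (2 * n))) else 0) =
        (if a (Fin.last (2 * n)) = c then 1 else 0) * x (a (Fin.last (2 * n))) := by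
      split_ifs <;> simp
    rw [h3]
    simp only [← Finset.mul_sum, mul_left_comm (x _), ← Finset.sum_mul]
    linear_combination (-epsilon a * (x (a (Fin.last (2 * n))) *
      ∏ l, Y l (a (pos l 0)) (a (pos l 1)))) * h1
  · simp [epsilon_eq_zero ha]

theorem exists_perm_succAbove (σ : Equiv.Perm (Fin (n + 1))) (k : Fin (n + 1)) :
    ∃ τ : Equiv.Perm (Fin n), ∀ l, σ (k.succAbove l) = (σ k).succAbove (τ l) := by
  have h : ∀ l, ∃ m, (σ k).succAbove m = σ (k.succAbove l) := fun l =>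
    Fin.exists_succAbove_eq fun h => Fin.succAbove_ne k l (σ.injective h)
  choose g hg using h
  have hinj : Function.Injective g := fun l m hlm => by
    have : σ (k.succAbove l) = σ (k.succAbove m) := by rw [← hg, ← hg, hlm]
    exact Fin.succAbove_right_injective (σ.injective this)
  exact ⟨Equiv.ofBijective g (Finite.injective_iff_bijective.1 hinj), fun l => (hg l).symm⟩

/-- `epsSum` with the arguments `Y i`, `i ≠ k`. -/
def epsSumOmit (k : Fin (n + 1)) (x : Fin (2 * n + 1) → ℝ)
    (Y : Fin (n + 1) → Fin (2 * n + 1) → Fin (2 * n + 1) → ℝ) : ℝ :=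
  epsSum x fun l => Y (k.succAbove l)

/-- Relabelling the arguments only permutes the pairs among the remaining ones, which costs no sign.
Summed over `k`, this is the symmetry of the Levi-Civita polynomial. -/
theorem epsSumOmit_perm (σ : Equiv.Perm (Fin (n + 1))) (k : Fin (n + 1))
    (x : Fin (2 * n + 1) → ℝ) (Y : Fin (n + 1) → Fin (2 * n + 1) → Fin (2 * n + 1) → ℝ) :
    epsSumOmit k x (Y ∘ σ) = epsSumOmit (σ k) x Y := by
  obtain ⟨τ, hτ⟩ := exists_perm_succAbove σ k
  unfold epsSumOmit
  rw [← epsSum_perm x (fun l => Y ((σ k).succAbove l)) τ]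
  congr 1
  funext l
  simp [hτ]

theorem epsSumOmit_congr {k : Fin (n + 1)} {x : Fin (2 * n + 1) → ℝ}
    {Y Y' : Fin (n + 1) → Fin (2 * n + 1) → Fin (2 * n + 1) → ℝ} (h : ∀ i, i ≠ k → Y i = Y' i) :
    epsSumOmit k x Y = epsSumOmit k x Y' := by
  unfold epsSumOmit
  congr 1
  funext l
  exact h _ (Fin.succAbove_ne k l)

theorem update_succAbove {α : Type*} (k : Fin (n + 1)) (j : Fin n) (Y : Fin (n + 1) → α) (M : α) :
    (fun l => Function.update Y (k.succAbove j) M (k.succAbove l)) =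
      Function.update (fun l => Y (k.succAbove l)) j M := by
  funext l
  by_cases h : l = j
  · subst h; simp
  · rw [Function.update_of_ne h, Function.update_of_ne fun h' =>
      h (Fin.succAbove_right_injective h')]

/-- Antisymmetry of ε exchanges `x i` and `x k`; swapping the labels `i` and `k` then turns the
result into the expression for the other omitted index, since neither sum involves `Y i` or `Y k`.
-/
theorem epsSumOmit_basisWedge (c : Fin (2 * n + 1)) (x : Fin (n + 1) → Fin (2 * n + 1) → ℝ)
    (Y : Fin (n + 1) → Fin (2 * n + 1) → Fin (2 * n + 1) → ℝ) {i k : Fin (n + 1)} (hik : i ≠ k) :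
    epsSumOmit k (x k) (Function.update Y i (basisWedge c (x i))) =
      - epsSumOmit i (x i) (Function.update Y k (basisWedge c (x k))) := by
  have h1 : epsSumOmit k (x k) (Function.update Y i (basisWedge c (x i))) =
      - epsSumOmit k (x i) (Function.update Y i (basisWedge c (x k))) := by
    obtain ⟨j, rfl⟩ := Fin.exists_succAbove_eq hik
    unfold epsSumOmit
    rw [update_succAbove, update_succAbove, epsSum_basisWedge]
  have h2 := epsSumOmit_perm (Equiv.swap i k) k (x i) (Function.update Y k (basisWedge c (x k)))
  rw [Equiv.swap_apply_right] at h2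
  rw [h1, ← h2]
  congr 1
  refine epsSumOmit_congr fun l hl => ?_
  by_cases hli : l = i
  · subst hli; simp
  · rw [Function.comp_apply, Equiv.swap_apply_of_ne_of_ne hli hl, Function.update_of_ne hli,
      Function.update_of_ne hl]

/-- The summand is antisymmetric in the omitted and the replaced index, so the double sum equals its
own negative. These are the terms of the invariance identity in which a boost acts on a Lorentz
component. -/
theorem sum_epsSumOmit_basisWedge (c : Fin (2 * n + 1)) (x : Fin (n + 1) → Fin (2 * n + 1) → ℝ)
    (Y : Fin (n + 1) → Fin (2 * n + 1) → Fin (2 * n + 1) → ℝ) :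
    ∑ k, ∑ j, epsSumOmit k (x k)
      (Function.update Y (k.succAbove j) (basisWedge c (x (k.succAbove j)))) = 0 := by
  let g : Fin (n + 1) → Fin (n + 1) → ℝ := fun k i =>
    if i = k then 0 else epsSumOmit k (x k) (Function.update Y i (basisWedge c (x i)))
  have h1 : ∀ k, ∑ j, epsSumOmit k (x k)
      (Function.update Y (k.succAbove j) (basisWedge c (x (k.succAbove j)))) = ∑ i, g k i := by
    intro k
    rw [Fin.sum_univ_succAbove _ k]
    simp [g, Fin.succAbove_ne]
  simp only [h1]
  have h2 : ∀ k i, g k i = - g i k := by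
    intro k i
    by_cases h : i = k
    · simp [g, h]
    · simp only [g, if_neg h, if_neg (Ne.symm h)]
      exact epsSumOmit_basisWedge c x Y h
  have h3 : ∑ k, ∑ i, g k i = - ∑ k, ∑ i, g k i := by
    conv_lhs => rw [Finset.sum_comm]
    rw [← Finset.sum_neg_distrib]
    refine Finset.sum_congr rfl fun i _ => ?_
    rw [← Finset.sum_neg_distrib]
    exact Finset.sum_congr rfl fun k _ => h2 _ _
  linarith

/-- The vanishing of `∑ₖ ∑ ε_{a₁ … a_{2n} a} Y_k^{a c} ∏_{i ≠ k} Y_i`. -/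
theorem sum_epsSumOmit_column (c : Fin (2 * n + 1))
    (Y : Fin (n + 1) → Fin (2 * n + 1) → Fin (2 * n + 1) → ℝ)
    (hY : ∀ i u v, Y i u v = - Y i v u) :
    ∑ k, epsSumOmit k (fun u => Y k u c) Y = 0 := by
  rw [← neg_eq_zero, ← sum_epsSumOmit_basisWedge c (fun i u => Y i u c) Y,
    ← Finset.sum_neg_distrib]
  refine Finset.sum_congr rfl fun k _ => ?_
  have h0 : ∀ i u, Y i u u = 0 := fun i u => by have := hY i u u; linarith
  unfold epsSumOmit
  -- The index `c` must occur somewhere. At the last place it selects a diagonal entry, which is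
  -- zero; in a pair it turns that argument into minus the antisymmetric product of the basis vector
  -- with column `c`. What remains is the preceding double sum, with the columns as vectors.
  rw [epsSum_eq_sum_delta c]
  have h1 : epsSum (fun u => if u = c then Y k u c else 0) (fun l => Y (k.succAbove l)) = 0 := by
    refine Finset.sum_eq_zero fun a _ => ?_
    by_cases h : a (Fin.last (2 * n)) = c
    · simp [h, h0]
    · simp [h]
  rw [h1, zero_add, ← Finset.sum_neg_distrib]
  refine Finset.sum_congr rfl fun j _ => ?_
  rw [update_succAbove]
  have h2 : (fun u v => ((if u = c then (1 : ℝ) else 0) + (if v = c then 1 else 0)) *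
      Y (k.succAbove j) u v) = (-1 : ℝ) • basisWedge c fun u => Y (k.succAbove j) u c := by
    funext u v
    simp only [basisWedge, Pi.smul_apply, smul_eq_mul]
    by_cases hu : u = c <;> by_cases hv : v = c <;> simp [hu, hv, h0]
    exact hY _ _ _
  rw [h2, epsSum_update_smul]
  ring

end EpsilonSums

/-! ### The grading of so(2n,2) and the invariance of the Levi-Civita polynomial. -/

section AdSAlgebra

attribute [local instance] LieRing.ofAssociativeRing

variable {n : ℕ}

theorem bracket_apply (X Y : AdS n) : bracket n X Y = ⁅X, Y⁆ := rfl

theorem toMat_lie (X Y : AdS n) : toMat n ⁅X, Y⁆ = toMat n X * toMat n Y - toMat n Y * toMat n X :=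
  rfl

theorem isLieBracket_bracket : IsLieBracket (bracket n) where
  antisymm X Y := by rw [bracket_apply, bracket_apply, lie_skew]
  jacobi X Y Z := by simp only [bracket_apply]; exact lie_jacobi X Y Z

theorem toMat_apply_eta (X : AdS n) (A B : Fin (2 * n) ⊕ Fin 2) :
    toMat n X A B * eta B = - (toMat n X B A * eta A) := by
  have h : toMat n X ∈ LieAlgebra.Orthogonal.so' (Fin (2 * n)) (Fin 2) ℝ := X.2
  rw [LieAlgebra.Orthogonal.so', mem_skewAdjointMatricesLieSubalgebra,
    mem_skewAdjointMatricesSubmodule, Matrix.IsSkewAdjoint, Matrix.IsAdjointPair] at h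
  have h1 := congrFun (congrFun h B) A
  simp only [LieAlgebra.Orthogonal.indefiniteDiagonal, Matrix.mul_diagonal,
    Matrix.diagonal_mul, Matrix.transpose_apply, Matrix.neg_apply] at h1
  change toMat n X A B * eta A = eta B * -(toMat n X B A) at h1
  have h2 := eta_sq A
  have h3 := eta_sq B
  linear_combination (eta A * eta B) * h1 - (toMat n X A B * eta B) * h2 -
    (toMat n X B A * eta A) * h3

theorem compJ_apply (a b : Fin (2 * n + 1)) (X : AdS n) :
    compJ a b X = eta (lor b) * toMat n X (lor a) (lor b) := rfl

theorem compP_apply (ℓ : ℝ) (a : Fin (2 * n + 1)) (X : AdS n) :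
    compP ℓ a X = -ℓ * toMat n X (lor a) (Sum.inr 1) := rfl

theorem compJ_antisymm (a b : Fin (2 * n + 1)) (X : AdS n) : compJ a b X = - compJ b a X := by
  rw [compJ_apply, compJ_apply]
  linarith [toMat_apply_eta X (lor a) (lor b)]

theorem lor_cases (A : Fin (2 * n) ⊕ Fin 2) : A = Sum.inr 1 ∨ ∃ a, A = lor a := by
  rcases A with i | i
  · exact Or.inr ⟨i.succ, by simp [lor]⟩
  · fin_cases i
    · exact Or.inr ⟨0, by simp [lor]⟩
    · exact Or.inl rfl

/-- The components separate points: skew-adjointness determines the last row of the matrix from its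
last column and kills the last diagonal entry. Identities in the algebra can therefore be checked on
components. -/
theorem eq_zero_of_components {ℓ : ℝ} (hℓ : ℓ ≠ 0) {X : AdS n} (hP : ∀ a, compP ℓ a X = 0)
    (hJ : ∀ a b, compJ a b X = 0) : X = 0 := by
  refine toMat_injective ?_
  rw [map_zero]
  have hP' : ∀ a, toMat n X (lor a) (Sum.inr 1) = 0 := fun a => by
    have := hP a
    rw [compP_apply] at this
    simpa [hℓ] using this
  have heta : ∀ A : Fin (2 * n) ⊕ Fin 2, eta A ≠ 0 := fun A h => by
    have := eta_sq A; rw [h] at this; norm_num at this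
  ext A B
  rcases lor_cases A with rfl | ⟨a, rfl⟩ <;> rcases lor_cases B with rfl | ⟨b, rfl⟩
  · have := toMat_apply_eta X (Sum.inr 1) (Sum.inr 1)
    have h : eta (Sum.inr 1 : Fin (2 * n) ⊕ Fin 2) ≠ 0 := heta _
    have : toMat n X (Sum.inr 1) (Sum.inr 1) * eta (Sum.inr 1 : Fin (2 * n) ⊕ Fin 2) = 0 := by
      linarith
    simpa [h] using this
  · have := toMat_apply_eta X (Sum.inr 1) (lor b)
    rw [hP', zero_mul, neg_zero] at this
    simpa [heta] using this
  · exact hP' a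
  · have := hJ a b
    rw [compJ_apply] at this
    simpa [heta] using this

/-- The projection to the span of the boosts. -/
def projP (ℓ : ℝ) : AdS n →L[ℝ] AdS n := ∑ a, (compP ℓ a).smulRight (P ℓ a)

/-- The projection to the Lorentz subalgebra. -/
def projJ : AdS n →L[ℝ] AdS n := (1 / 2 : ℝ) • ∑ a, ∑ b, (compJ a b).smulRight (J a b)

theorem projP_apply (ℓ : ℝ) (X : AdS n) : projP ℓ X = ∑ a, compP ℓ a X • P ℓ a := by
  simp [projP]

theorem projJ_apply (X : AdS n) : projJ X = (1 / 2 : ℝ) • ∑ a, ∑ b, compJ a b X • J a b := by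
  simp [projJ]

theorem compP_projJ (ℓ : ℝ) (a : Fin (2 * n + 1)) (X : AdS n) : compP ℓ a (projJ X) = 0 := by
  simp [projJ_apply, compP_J]

theorem compJ_projP (ℓ : ℝ) (a b : Fin (2 * n + 1)) (X : AdS n) :
    compJ a b (projP ℓ X) = 0 := by
  simp [projP_apply, compJ_P]

theorem compP_projP {ℓ : ℝ} (hℓ : ℓ ≠ 0) (a : Fin (2 * n + 1)) (X : AdS n) :
    compP ℓ a (projP ℓ X) = compP ℓ a X := by
  simp [projP_apply, compP_P ℓ hℓ]

theorem compJ_projJ (a b : Fin (2 * n + 1)) (X : AdS n) :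
    compJ a b (projJ X) = compJ a b X := by
  have : ∀ c d : Fin (2 * n + 1), compJ c d X • compJ a b (J c d) =
      (if a = c then if b = d then compJ c d X else 0 else 0) -
      (if a = d then if b = c then compJ c d X else 0 else 0) := by
    intro c d
    rw [compJ_J]
    by_cases h1 : a = c <;> by_cases h2 : b = d <;> by_cases h3 : a = d <;>
      by_cases h4 : b = c <;> simp_all
  rw [projJ_apply]
  simp only [map_smul, map_sum, this, Finset.sum_sub_distrib]
  have e2 : ∑ c, ∑ d, (if a = d then if b = c then compJ c d X else 0 else 0) = compJ b a X := by
    simp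
  have e1 : ∑ c, ∑ d, (if a = c then if b = d then compJ c d X else 0 else 0) = compJ a b X := by
    rw [Finset.sum_comm]
    simp
  rw [e1, e2, compJ_antisymm b a, smul_eq_mul]
  ring

theorem projP_add_projJ {ℓ : ℝ} (hℓ : ℓ ≠ 0) (X : AdS n) : projP ℓ X + projJ X = X := by
  rw [← sub_eq_zero]
  refine eq_zero_of_components hℓ (fun a => ?_) fun a b => ?_
  · simp [compP_projJ, compP_projP hℓ]
  · simp [compJ_projP, compJ_projJ]

theorem single_mul_apply_eq {m : Type*} [Fintype m] [DecidableEq m] (A B : m) (c : ℝ)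
    (N : Matrix m m ℝ) (i j : m) :
    (Matrix.single A B c * N) i j = if i = A then c * N B j else 0 := by
  rcases eq_or_ne i A with rfl | h
  · simp
  · simp [h]

theorem mul_single_apply_eq {m : Type*} [Fintype m] [DecidableEq m] (A B : m) (c : ℝ)
    (N : Matrix m m ℝ) (i j : m) :
    (N * Matrix.single A B c) i j = if j = B then N i A * c else 0 := by
  rcases eq_or_ne j B with rfl | h
  · simp
  · simp [h]

theorem toMat_bracket_P (ℓ : ℝ) (c : Fin (2 * n + 1)) (X : AdS n) (A B : Fin (2 * n) ⊕ Fin 2) :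
    toMat n ⁅P ℓ c, X⁆ A B = ℓ⁻¹ * ((if A = lor c then -toMat n X (Sum.inr 1) B else 0) -
      (if A = Sum.inr 1 then eta (lor c) * toMat n X (lor c) B else 0) +
      (if B = Sum.inr 1 then toMat n X A (lor c) else 0) +
      if B = lor c then toMat n X A (Sum.inr 1) * eta (lor c) else 0) := by
  have hP : toMat n (P ℓ c) = ℓ⁻¹ • (Matrix.single (lor c) (Sum.inr 1) (eta (Sum.inr 1)) -
      Matrix.single (Sum.inr 1) (lor c) (eta (lor c))) := rfl
  have e1 : eta (Sum.inr 1 : Fin (2 * n) ⊕ Fin 2) = -1 := rfl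
  rw [toMat_lie, hP, Matrix.smul_mul, Matrix.mul_smul, ← smul_sub, Matrix.smul_apply, smul_eq_mul,
    Matrix.sub_mul, Matrix.mul_sub, Matrix.sub_apply, Matrix.sub_apply, Matrix.sub_apply,
    single_mul_apply_eq, single_mul_apply_eq, mul_single_apply_eq, mul_single_apply_eq, e1]
  congr 1
  split_ifs <;> ring

theorem compP_bracket_P {ℓ : ℝ} (hℓ : ℓ ≠ 0) (a c : Fin (2 * n + 1)) (X : AdS n) :
    compP ℓ a ⁅P ℓ c, X⁆ = - eta (lor c) * compJ a c X := by
  have e1 : eta (Sum.inr 1 : Fin (2 * n) ⊕ Fin 2) = -1 := rfl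
  have e2 := eta_sq (lor c)
  have h00 : toMat n X (Sum.inr 1) (Sum.inr 1) = 0 := by
    have := toMat_apply_eta X (Sum.inr 1) (Sum.inr 1)
    rw [e1] at this
    linarith
  rw [compP_apply, compJ_apply, toMat_bracket_P, h00, if_neg (lor_ne a), if_pos rfl,
    if_neg (lor_ne c).symm]
  have h3 : ℓ * ℓ⁻¹ = 1 := mul_inv_cancel₀ hℓ
  have h4 : (if lor a = lor c then -(0 : ℝ) else 0) = 0 := by split_ifs <;> simp
  rw [h4]
  linear_combination (-toMat n X (lor a) (lor c)) * h3 + toMat n X (lor a) (lor c) * e2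

theorem compJ_bracket_P {ℓ : ℝ} (hℓ : ℓ ≠ 0) (a b c : Fin (2 * n + 1)) (X : AdS n) :
    compJ a b ⁅P ℓ c, X⁆ = (ℓ ^ 2)⁻¹ * basisWedge c (fun d => compP ℓ d X) a b := by
  have e1 : eta (Sum.inr 1 : Fin (2 * n) ⊕ Fin 2) = -1 := rfl
  have e2 := eta_sq (lor c)
  have h1 := toMat_apply_eta X (Sum.inr 1) (lor b)
  rw [e1] at h1
  rw [compJ_apply, toMat_bracket_P, if_neg (lor_ne a), if_neg (lor_ne b), basisWedge]
  simp only [compP_apply, lor_inj.eq_iff]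
  have h3 : (ℓ ^ 2)⁻¹ * ℓ = ℓ⁻¹ := by field_simp
  rw [← h3]
  by_cases h4 : a = c <;> by_cases h5 : b = c
  · subst h4 h5
    simp only [if_true]
    linear_combination (-((ℓ ^ 2)⁻¹ * ℓ)) * h1 +
      ((ℓ ^ 2)⁻¹ * ℓ * toMat n X (lor b) (Sum.inr 1)) * e2
  · simp only [h4, h5, if_true, if_false]
    linear_combination (-((ℓ ^ 2)⁻¹ * ℓ)) * h1
  · simp only [h4, h5, if_true, if_false]
    linear_combination ((ℓ ^ 2)⁻¹ * ℓ * toMat n X (lor a) (Sum.inr 1)) * e2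
  · simp [h4, h5]

/-- The boosts generate the algebra, so that invariance only has to be checked on them. -/
theorem smul_lie_P {ℓ : ℝ} (hℓ : ℓ ≠ 0) (a b : Fin (2 * n + 1)) :
    J a b = ℓ ^ 2 • ⁅P (n := n) ℓ a, P ℓ b⁆ := by
  rw [← sub_eq_zero]
  refine eq_zero_of_components hℓ (fun u => ?_) fun u v => ?_
  · rw [map_sub, map_smul, compP_bracket_P hℓ, compP_J, compJ_P]
    simp
  · rw [map_sub, map_smul, compJ_bracket_P hℓ, compJ_J]
    simp only [basisWedge, compP_P ℓ hℓ, smul_eq_mul]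
    rw [← mul_assoc, mul_inv_cancel₀ (pow_ne_zero 2 hℓ)]
    rw [one_mul, ite_and, ite_and, ite_mul, ite_mul, one_mul, one_mul, zero_mul, zero_mul]
    by_cases h3 : u = b <;> by_cases h4 : v = a <;> simp only [h3, h4, if_true, if_false, sub_self]

/-- This and the next two results form the ℤ/2-grading: the Lorentz part is a subalgebra, two boosts
bracket into it, and Lorentz generators map boosts to boosts. Each follows from the block form of
the two matrices. -/
theorem compP_bracket_of_J {ℓ : ℝ} (hℓ : ℓ ≠ 0) {X Y : AdS n} (hX : ∀ a, compP ℓ a X = 0)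
    (hY : ∀ a, compP ℓ a Y = 0) (a : Fin (2 * n + 1)) : compP ℓ a ⁅X, Y⁆ = 0 := by
  have h : ∀ Z : AdS n, (∀ a, compP ℓ a Z = 0) → ∀ a, toMat n Z (lor a) (Sum.inr 1) = 0 :=
    fun Z hZ a => by simpa [compP_apply, hℓ] using hZ a
  have hs : ∀ Z : AdS n, toMat n Z (Sum.inr 1) (Sum.inr 1) = 0 := fun Z => by
    have := toMat_apply_eta Z (Sum.inr 1) (Sum.inr 1)
    have e1 : eta (Sum.inr 1 : Fin (2 * n) ⊕ Fin 2) = -1 := rfl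
    rw [e1] at this
    linarith
  have hm : ∀ Z W : AdS n, (∀ a, compP ℓ a Z = 0) → (∀ a, compP ℓ a W = 0) →
      (toMat n Z * toMat n W) (lor a) (Sum.inr 1) = 0 := fun Z W hZ hW => by
    rw [Matrix.mul_apply]
    refine Finset.sum_eq_zero fun B _ => ?_
    rcases lor_cases B with rfl | ⟨b, rfl⟩
    · rw [hs, mul_zero]
    · rw [h W hW, mul_zero]
  rw [compP_apply, toMat_lie, Matrix.sub_apply, hm X Y hX hY, hm Y X hY hX]
  simp

theorem compP_bracket_of_P {ℓ : ℝ} {X Y : AdS n} (hX : ∀ a b, compJ a b X = 0)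
    (hY : ∀ a b, compJ a b Y = 0) (a : Fin (2 * n + 1)) : compP ℓ a ⁅X, Y⁆ = 0 := by
  have h : ∀ Z : AdS n, (∀ a b, compJ a b Z = 0) → ∀ a b, toMat n Z (lor a) (lor b) = 0 :=
    fun Z hZ a b => by
      have h1 := hZ a b
      have h2 := eta_sq (lor b)
      rw [compJ_apply] at h1
      linear_combination (eta (lor b)) * h1 - toMat n Z (lor a) (lor b) * h2
  have hs : ∀ Z : AdS n, toMat n Z (Sum.inr 1) (Sum.inr 1) = 0 := fun Z => by
    have := toMat_apply_eta Z (Sum.inr 1) (Sum.inr 1)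
    have e1 : eta (Sum.inr 1 : Fin (2 * n) ⊕ Fin 2) = -1 := rfl
    rw [e1] at this
    linarith
  have hm : ∀ Z W : AdS n, (∀ a b, compJ a b Z = 0) → (∀ a b, compJ a b W = 0) →
      (toMat n Z * toMat n W) (lor a) (Sum.inr 1) = 0 := fun Z W hZ hW => by
    rw [Matrix.mul_apply]
    refine Finset.sum_eq_zero fun B _ => ?_
    rcases lor_cases B with rfl | ⟨b, rfl⟩
    · rw [hs, mul_zero]
    · rw [h Z hZ, zero_mul]
  rw [compP_apply, toMat_lie, Matrix.sub_apply, hm X Y hX hY, hm Y X hY hX]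
  simp

theorem compJ_bracket_of_J_P {ℓ : ℝ} (hℓ : ℓ ≠ 0) {X Y : AdS n} (hX : ∀ a, compP ℓ a X = 0)
    (hY : ∀ a b, compJ a b Y = 0) (a b : Fin (2 * n + 1)) : compJ a b ⁅X, Y⁆ = 0 := by
  have e1 : eta (Sum.inr 1 : Fin (2 * n) ⊕ Fin 2) = -1 := rfl
  have h : ∀ a, toMat n X (lor a) (Sum.inr 1) = 0 :=
    fun a => by simpa [compP_apply, hℓ] using hX a
  have h' : ∀ a, toMat n X (Sum.inr 1) (lor a) = 0 := fun a => by
    have h1 := toMat_apply_eta X (lor a) (Sum.inr 1)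
    have h2 := eta_sq (lor a)
    rw [h, e1] at h1
    linear_combination -(toMat n X (Sum.inr 1) (lor a)) * h2 + (eta (lor a)) * h1
  have hY' : ∀ a b, toMat n Y (lor a) (lor b) = 0 := fun a b => by
      have h1 := hY a b
      have h2 := eta_sq (lor b)
      rw [compJ_apply] at h1
      linear_combination (eta (lor b)) * h1 - toMat n Y (lor a) (lor b) * h2
  rw [compJ_apply, toMat_lie, Matrix.sub_apply, Matrix.mul_apply, Matrix.mul_apply,
    Finset.sum_eq_zero, Finset.sum_eq_zero]
  · simp
  · intro B _
    rcases lor_cases B with rfl | ⟨c, rfl⟩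
    · rw [h', mul_zero]
    · rw [hY', zero_mul]
  · intro B _
    rcases lor_cases B with rfl | ⟨c, rfl⟩
    · rw [h, zero_mul]
    · rw [hY', mul_zero]

theorem leviCivita_eq (ℓ : ℝ) (Z : Fin (n + 1) → AdS n) :
    leviCivita n ℓ Z = ℓ⁻¹ * ∑ i, epsSumOmit i (fun u => compP ℓ u (Z i))
      (fun j u v => compJ u v (Z j)) :=
  leviCivita_apply ℓ Z

theorem isSymmPoly_leviCivita (ℓ : ℝ) : IsSymmPoly (leviCivita n ℓ) := by
  intro σ Z
  rw [leviCivita_eq, leviCivita_eq,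
    ← Equiv.sum_comp σ fun i => epsSumOmit i (fun u => compP ℓ u (Z i)) fun j u v => compJ u v (Z j)]
  congr 1
  refine Finset.sum_congr rfl fun i _ => ?_
  rw [← epsSumOmit_perm]
  rfl

theorem epsSumOmit_smul (c : ℝ) (k : Fin (n + 1)) (x : Fin (2 * n + 1) → ℝ)
    (Y : Fin (n + 1) → Fin (2 * n + 1) → Fin (2 * n + 1) → ℝ) :
    epsSumOmit k (fun u => c * x u) Y = c * epsSumOmit k x Y :=
  epsSum_smul c x _

theorem epsSumOmit_update_smul (c : ℝ) (k : Fin (n + 1)) (j : Fin n) (x : Fin (2 * n + 1) → ℝ)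
    (Y : Fin (n + 1) → Fin (2 * n + 1) → Fin (2 * n + 1) → ℝ)
    (A : Fin (2 * n + 1) → Fin (2 * n + 1) → ℝ) :
    epsSumOmit k x (Function.update Y (k.succAbove j) fun u v => c * A u v) =
      c * epsSumOmit k x (Function.update Y (k.succAbove j) A) := by
  unfold epsSumOmit
  rw [update_succAbove, update_succAbove]
  exact epsSum_update_smul x _ j c A

/-- Acting on the argument that supplies the boost component, `P ℓ c` produces a column of its
Lorentz matrix; acting on another argument, it produces the antisymmetric product of the `c`-th
basis vector with that argument's boost components. The two families of terms vanish separately, by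
`sum_epsSumOmit_column` and `sum_epsSumOmit_basisWedge`. -/
theorem polyAct_leviCivita_P {ℓ : ℝ} (hℓ : ℓ ≠ 0) (c : Fin (2 * n + 1)) :
    polyAct (bracket n (P ℓ c)) (n + 1) (leviCivita n ℓ) = 0 := by
  ext Z
  rw [polyAct_apply]
  simp only [leviCivita_eq, zero_apply]
  rw [← Finset.mul_sum, Finset.sum_comm]
  have key : ∀ k : Fin (n + 1), ∑ i, epsSumOmit k
      (fun u => compP ℓ u (Function.update Z i (bracket n (P ℓ c) (Z i)) k))
      (fun j u v => compJ u v (Function.update Z i (bracket n (P ℓ c) (Z i)) j)) =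
      -eta (lor c) * epsSumOmit k (fun u => compJ u c (Z k)) (fun j u v => compJ u v (Z j)) +
      (ℓ ^ 2)⁻¹ * ∑ j, epsSumOmit k (fun u => compP ℓ u (Z k))
        (Function.update (fun j u v => compJ u v (Z j)) (k.succAbove j)
          (basisWedge c fun u => compP ℓ u (Z (k.succAbove j)))) := by
    intro k
    rw [Fin.sum_univ_succAbove _ k, Finset.mul_sum]
    congr 1
    · rw [← epsSumOmit_smul]
      simp only [Function.update_self, bracket_apply, compP_bracket_P hℓ]
      exact epsSumOmit_congr fun i hi => by rw [Function.update_of_ne hi]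
    · refine Finset.sum_congr rfl fun j _ => ?_
      rw [← epsSumOmit_update_smul, Function.update_of_ne (Fin.ne_succAbove k j)]
      refine epsSumOmit_congr fun i _ => ?_
      by_cases h : i = k.succAbove j
      · subst h
        simp only [Function.update_self, bracket_apply, compJ_bracket_P hℓ]
      · simp only [Function.update_of_ne h]
  simp only [key]
  rw [Finset.sum_add_distrib, ← Finset.mul_sum, ← Finset.mul_sum,
    sum_epsSumOmit_basisWedge c (fun k u => compP ℓ u (Z k)),
    sum_epsSumOmit_column c (fun j u v => compJ u v (Z j)) fun i u v => compJ_antisymm u v (Z i)]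
  simp

/-- In the difference of the two iterated actions, the terms hitting two different slots agree and
cancel; those hitting the same slot twice combine into the commutator. -/
theorem polyAct_commutator {V : Type*} [NormedAddCommGroup V] [NormedSpace ℝ V] {r : ℕ}
    {f : Poly V r} {A B C : V →L[ℝ] V} (hA : polyAct A r f = 0) (hB : polyAct B r f = 0)
    (hC : ∀ v, C v = A (B v) - B (A v)) : polyAct C r f = 0 := by
  ext v
  have h : ∀ A B : V →L[ℝ] V, polyAct A r (polyAct B r f) v =
      ∑ i, ∑ j, if j = i then f (Function.update v i (B (A (v i)))) else
        f (Function.update (Function.update v i (A (v i))) j (B (v j))) := by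
    intro A B
    simp only [polyAct_apply]
    refine Finset.sum_congr rfl fun i _ => Finset.sum_congr rfl fun j _ => ?_
    split_ifs with h
    · subst h; simp
    · rw [Function.update_of_ne h]
  have h1 := h A B
  have h2 := h B A
  rw [hB, map_zero, zero_apply] at h1
  rw [hA, map_zero, zero_apply, Finset.sum_comm] at h2
  have h3 : polyAct C r f v = 0 := by
    rw [← sub_self (0 : ℝ)]
    refine Eq.trans ?_ (congrArg₂ (fun a b : ℝ => a - b) h2 h1).symm
    rw [polyAct_apply, ← Finset.sum_sub_distrib]
    refine Finset.sum_congr rfl fun i _ => ?_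
    rw [← Finset.sum_sub_distrib, Finset.sum_eq_single i]
    · simp only [if_true, hC]
      rw [sub_eq_add_neg, f.map_update_add, ← neg_one_smul ℝ (B _), f.map_update_smul]
      simp [sub_eq_add_neg]
    · intro j _ hj
      rw [if_neg hj.symm, if_neg hj, Function.update_comm hj, sub_self]
    · simp
  exact h3

/-- The Levi-Civita polynomial is invariant under the adjoint action. -/
theorem polyAct_leviCivita {ℓ : ℝ} (hℓ : ℓ ≠ 0) (X : AdS n) :
    polyAct (bracket n X) (n + 1) (leviCivita n ℓ) = 0 := by
  -- The elements that annihilate the polynomial form a subspace; it contains the boosts, hence by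
  -- commutators the Lorentz generators, and these span.
  let S : Submodule ℝ (AdS n) :=
    { carrier := {X | polyAct (bracket n X) (n + 1) (leviCivita n ℓ) = 0}
      add_mem' := fun {X Y} hX hY => by
        have hX' : polyAct (bracket n X) (n + 1) (leviCivita n ℓ) = 0 := hX
        have hY' : polyAct (bracket n Y) (n + 1) (leviCivita n ℓ) = 0 := hY
        ext v
        have h1 := congrArg (fun f => f v) hX'
        have h2 := congrArg (fun f => f v) hY'
        simp only [polyAct_apply, zero_apply] at h1 h2 ⊢
        simp only [map_add, add_apply, ContinuousMultilinearMap.map_update_add,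
          Finset.sum_add_distrib, h1, h2, add_zero]
      zero_mem' := by
        change polyAct (bracket n 0) (n + 1) (leviCivita n ℓ) = 0
        ext v
        rw [polyAct_apply]
        refine Finset.sum_eq_zero fun i _ => ?_
        rw [map_zero]
        exact ContinuousMultilinearMap.map_coord_zero _ i (by simp)
      smul_mem' := fun c X hX => by
        have hX' : polyAct (bracket n X) (n + 1) (leviCivita n ℓ) = 0 := hX
        ext v
        have h1 := congrArg (fun f => f v) hX'
        simp only [polyAct_apply, zero_apply] at h1 ⊢
        simp only [map_smul, smul_apply, ContinuousMultilinearMap.map_update_smul,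
          ← Finset.smul_sum, h1, smul_zero] }
  have hP : ∀ a, P ℓ a ∈ S := polyAct_leviCivita_P hℓ
  have hJ : ∀ a b, J a b ∈ S := fun a b => by
    rw [smul_lie_P hℓ a b]
    refine S.smul_mem _ (polyAct_commutator (hP a) (hP b) fun v => ?_)
    simp only [bracket_apply, lie_lie]
  change X ∈ S
  rw [← projP_add_projJ hℓ X, projP_apply, projJ_apply]
  exact S.add_mem (S.sum_mem fun a _ => S.smul_mem _ (hP a)) (S.smul_mem _
    (S.sum_mem fun a _ => S.sum_mem fun b _ => S.smul_mem _ (hJ a b)))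

theorem leviCivita_cons_of_P (ℓ : ℝ) {z : AdS n} (hz : ∀ a b, compJ a b z = 0)
    (v : Fin n → AdS n) : leviCivita n ℓ (Fin.cons z v) =
      ℓ⁻¹ * epsSum (fun u => compP ℓ u z) (fun j u u' => compJ u u' (v j)) := by
  rw [leviCivita_eq, Fin.sum_univ_succ, Finset.sum_eq_zero fun j _ => ?_]
  · simp [epsSumOmit]
  · obtain ⟨l, hl⟩ := Fin.exists_succAbove_eq (Fin.succ_ne_zero j).symm
    unfold epsSumOmit epsSum
    refine Finset.sum_eq_zero fun a _ => ?_
    rw [Finset.prod_eq_zero (Finset.mem_univ l)]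
    · simp
    · simp only [hl, Fin.cons_zero, hz]

/-- A boost in the first slot uses up the only place for one, so the other slots see just the
Lorentz parts of their arguments. -/
theorem insertFirst_leviCivita_of_P (ℓ : ℝ) {z : AdS n} (hz : ∀ a b, compJ a b z = 0) :
    polyPrecomp projJ n (insertFirst (AdS n) n (leviCivita n ℓ) z) =
      insertFirst (AdS n) n (leviCivita n ℓ) z := by
  ext v
  rw [polyPrecomp_apply, insertFirst_apply, insertFirst_apply, leviCivita_cons_of_P ℓ hz,
    leviCivita_cons_of_P ℓ hz]
  simp only [compJ_projJ]

/-- With a Lorentz generator in the first slot, exactly one other slot contributes its boost part;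
scaling all boost parts by `τ` therefore scales the value by `τ`. The case `τ = 0` says that Lorentz
arguments alone give zero. -/
theorem insertFirst_leviCivita_of_J {ℓ : ℝ} (hℓ : ℓ ≠ 0) {z : AdS n} (hz : ∀ a, compP ℓ a z = 0)
    (τ : ℝ) :
    polyPrecomp (projJ + τ • projP ℓ) n (insertFirst (AdS n) n (leviCivita n ℓ) z) =
      τ • insertFirst (AdS n) n (leviCivita n ℓ) z := by
  ext v
  rw [polyPrecomp_apply, smul_apply, insertFirst_apply, insertFirst_apply, leviCivita_eq,
    leviCivita_eq, smul_eq_mul, mul_left_comm τ, Finset.mul_sum (a := τ)]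
  refine congrArg (fun x : ℝ => ℓ⁻¹ * x) (Finset.sum_congr rfl fun i _ => ?_)
  rw [← epsSumOmit_smul]
  have h1 : (fun u => compP ℓ u ((Fin.cons z fun i => (projJ + τ • projP ℓ : AdS n →L[ℝ] AdS n) (v i) :
      Fin (n + 1) → AdS n) i)) = fun u => τ * compP ℓ u ((Fin.cons z v : Fin (n + 1) → AdS n) i) := by
    funext u
    refine Fin.cases ?_ (fun i => ?_) i
    · simp [hz]
    · simp [compP_projJ, compP_projP hℓ]
  rw [h1]
  congr 1
  funext j u u'
  refine Fin.cases ?_ (fun i => ?_) j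
  · simp
  · simp [compJ_projJ, compJ_projP]

end AdSAlgebra

/-! ### Families depending polynomially on two parameters, and their integrals. -/

section PolynomialFamilies

variable {E X Y Z V : Type*} [NormedAddCommGroup E] [NormedSpace ℝ E]
  [NormedAddCommGroup X] [NormedSpace ℝ X] [NormedAddCommGroup Y] [NormedSpace ℝ Y]
  [NormedAddCommGroup Z] [NormedSpace ℝ Z] [NormedAddCommGroup V] [NormedSpace ℝ V]

/-- Families of functions on `S` that depend polynomially on two real parameters, with smooth
coefficients. -/
def IsPolyFamily (S : Set E) (φ : ℝ → ℝ → E → X) : Prop :=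
  ∃ (ι : Type) (_ : Fintype ι) (a b : ι → ℕ) (c : ι → E → X), (∀ i, ContDiffOn ℝ ∞ (c i) S) ∧
    ∀ t s, ∀ y ∈ S, φ t s y = ∑ i, (t ^ a i * s ^ b i) • c i y

variable {S : Set E}

theorem IsPolyFamily.congr {φ ψ : ℝ → ℝ → E → X} (hφ : IsPolyFamily S φ)
    (h : ∀ t s, ∀ y ∈ S, ψ t s y = φ t s y) : IsPolyFamily S ψ := by
  obtain ⟨ι, _, a, b, c, hc, e⟩ := hφ
  exact ⟨ι, _, a, b, c, hc, fun t s y hy => (h t s y hy).trans (e t s y hy)⟩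

theorem isPolyFamily_const {c : E → X} (hc : ContDiffOn ℝ ∞ c S) :
    IsPolyFamily S (fun _ _ => c) :=
  ⟨Unit, inferInstance, fun _ => 0, fun _ => 0, fun _ => c, fun _ => hc, fun t s y _ => by simp⟩

theorem IsPolyFamily.add {φ ψ : ℝ → ℝ → E → X} (hφ : IsPolyFamily S φ) (hψ : IsPolyFamily S ψ) :
    IsPolyFamily S (fun t s y => φ t s y + ψ t s y) := by
  obtain ⟨ι, _, a, b, c, hc, e⟩ := hφ
  obtain ⟨ι', _, a', b', c', hc', e'⟩ := hψ
  refine ⟨ι ⊕ ι', inferInstance, Sum.elim a a', Sum.elim b b', Sum.elim c c', ?_, ?_⟩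
  · rintro (i | i)
    exacts [hc i, hc' i]
  · intro t s y hy
    simp [e t s y hy, e' t s y hy]

theorem IsPolyFamily.fst_smul {φ : ℝ → ℝ → E → X} (hφ : IsPolyFamily S φ) :
    IsPolyFamily S (fun t s y => t • φ t s y) := by
  obtain ⟨ι, _, a, b, c, hc, e⟩ := hφ
  refine ⟨ι, inferInstance, fun i => a i + 1, b, c, hc, fun t s y hy => ?_⟩
  simp only []
  rw [e t s y hy, Finset.smul_sum]
  refine Finset.sum_congr rfl fun i _ => ?_
  rw [smul_smul]
  congr 1
  ring

theorem IsPolyFamily.snd_smul {φ : ℝ → ℝ → E → X} (hφ : IsPolyFamily S φ) :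
    IsPolyFamily S (fun t s y => s • φ t s y) := by
  obtain ⟨ι, _, a, b, c, hc, e⟩ := hφ
  refine ⟨ι, inferInstance, a, fun i => b i + 1, c, hc, fun t s y hy => ?_⟩
  simp only []
  rw [e t s y hy, Finset.smul_sum]
  refine Finset.sum_congr rfl fun i _ => ?_
  rw [smul_smul]
  congr 1
  ring

theorem IsPolyFamily.bilinear (B : X →L[ℝ] Y →L[ℝ] Z) {φ : ℝ → ℝ → E → X} {ψ : ℝ → ℝ → E → Y}
    (hφ : IsPolyFamily S φ) (hψ : IsPolyFamily S ψ) :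
    IsPolyFamily S (fun t s y => B (φ t s y) (ψ t s y)) := by
  obtain ⟨ι, _, a, b, c, hc, e⟩ := hφ
  obtain ⟨ι', _, a', b', c', hc', e'⟩ := hψ
  refine ⟨ι × ι', inferInstance, fun i => a i.1 + a' i.2, fun i => b i.1 + b' i.2,
    fun i y => B (c i.1 y) (c' i.2 y), fun i => B.isBoundedBilinearMap.contDiff.comp₂_contDiffOn
      (hc i.1) (hc' i.2), fun t s y hy => ?_⟩
  simp only []
  rw [e t s y hy, e' t s y hy, Fintype.sum_prod_type, map_sum B, sum_apply]
  refine Finset.sum_congr rfl fun i _ => ?_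
  rw [map_sum]
  refine Finset.sum_congr rfl fun j _ => ?_
  rw [map_smul B, smul_apply, map_smul, smul_smul]
  congr 1
  ring

theorem IsPolyFamily.clm (B : X →L[ℝ] Z) {φ : ℝ → ℝ → E → X} (hφ : IsPolyFamily S φ) :
    IsPolyFamily S (fun t s y => B (φ t s y)) := by
  obtain ⟨ι, _, a, b, c, hc, e⟩ := hφ
  refine ⟨ι, inferInstance, a, b, fun i y => B (c i y), fun i => B.contDiff.comp_contDiffOn (hc i),
    fun t s y hy => ?_⟩
  simp [e t s y hy]

variable {G : Type*} [NormedAddCommGroup G] [NormedSpace ℝ G]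

theorem IsPolyFamily.wedge {p q l : ℕ} (B : X →L[ℝ] Y →L[ℝ] Z) (h : p + q = l)
    {φ : ℝ → ℝ → E → G [⋀^Fin p]→L[ℝ] X} {ψ : ℝ → ℝ → E → G [⋀^Fin q]→L[ℝ] Y}
    (hφ : IsPolyFamily S φ) (hψ : IsPolyFamily S ψ) :
    IsPolyFamily S (fun t s y => wedge B h (φ t s y) (ψ t s y)) :=
  hφ.bilinear (wedgeL B h) hψ

theorem IsPolyFamily.fill : {r p l : ℕ} → (h : p + 2 * r = l) →
    {Ψ : ℝ → ℝ → E → G [⋀^Fin p]→L[ℝ] Poly V r} → {F : ℝ → ℝ → E → G [⋀^Fin 2]→L[ℝ] V} →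
    IsPolyFamily S Ψ → IsPolyFamily S F → IsPolyFamily S (fun t s y => fill h (Ψ t s y) (F t s y))
  | 0, p, _, h, Ψ, F, hΨ, hF => by
      refine (hΨ.clm (fillL (E := G) h (0 : G [⋀^Fin 2]→L[ℝ] V))).congr fun t s y _ => ?_
      rw [fillL_apply]
      rfl
  | r + 1, p, _, h, Ψ, F, hΨ, hF => by
      simp only [TGFT.fill]
      exact (hΨ.wedge _ _ hF).fill _ hF

theorem IsPolyFamily.angle₁ {n p l : ℕ} (f : Poly V (n + 1)) (h : p + 2 * n = l)
    {Z : ℝ → ℝ → E → G [⋀^Fin p]→L[ℝ] V} {F : ℝ → ℝ → E → G [⋀^Fin 2]→L[ℝ] V}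
    (hZ : IsPolyFamily S Z) (hF : IsPolyFamily S F) :
    IsPolyFamily S (fun t s y => angle₁ f h (Z t s y) (F t s y)) :=
  ((isPolyFamily_const contDiffOn_const).wedge _ _ hZ).fill h hF

theorem IsPolyFamily.angle₂ {n p q l : ℕ} (f : Poly V (n + 1)) (h : p + q + 2 * n = l + 2)
    {Y : ℝ → ℝ → E → G [⋀^Fin p]→L[ℝ] V}
    {Z : ℝ → ℝ → E → G [⋀^Fin q]→L[ℝ] V} {F : ℝ → ℝ → E → G [⋀^Fin 2]→L[ℝ] V}
    (hY : IsPolyFamily S Y) (hZ : IsPolyFamily S Z) (hF : IsPolyFamily S F) :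
    IsPolyFamily S (fun t s y => angle₂ f h (Y t s y) (Z t s y) (F t s y)) := by
  cases n with
  | zero => exact isPolyFamily_const contDiffOn_const
  | succ m => exact (((isPolyFamily_const contDiffOn_const).wedge _ _ hY).wedge _ _ hZ).fill _ hF

theorem extDerivWithin_fun_sum_smul {ι : Type*} [Fintype ι] {p : ℕ} {y : E}
    (hS : UniqueDiffWithinAt ℝ S y) (w : ι → ℝ) {c : ι → E → E [⋀^Fin p]→L[ℝ] X}
    (hc : ∀ i, DifferentiableWithinAt ℝ (c i) S y) :
    extDerivWithin (fun z => ∑ i, w i • c i z) S y = ∑ i, w i • extDerivWithin (c i) S y := by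
  unfold extDerivWithin
  rw [fderivWithin_fun_sum hS fun i _ => (hc i).fun_const_smul (w i)]
  have : ∀ i, fderivWithin ℝ (fun z => w i • c i z) S y = w i • fderivWithin ℝ (c i) S y :=
    fun i => fderivWithin_fun_const_smul hS (hc i) (w i)
  simp only [this]
  exact (map_sum (ContinuousAlternatingMap.alternatizeUncurryFinCLM ℝ E X) _ _).trans
    (Finset.sum_congr rfl fun i _ => map_smul _ _ _)

theorem IsPolyFamily.extDerivWithin {p : ℕ} [FiniteDimensional ℝ E] (hS : UniqueDiffOn ℝ S)
    {φ : ℝ → ℝ → E → E [⋀^Fin p]→L[ℝ] X} (hφ : IsPolyFamily S φ) :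
    IsPolyFamily S (fun t s y => extDerivWithin (φ t s) S y) := by
  obtain ⟨ι, _, a, b, c, hc, e⟩ := hφ
  refine ⟨ι, inferInstance, a, b, fun i => _root_.extDerivWithin (c i) S,
    fun i => contDiffOn_extDerivWithin hS (hc i), fun t s y hy => ?_⟩
  exact (extDerivWithin_congr (fun z hz => e t s z hz) (e t s y hy)).trans
    (extDerivWithin_fun_sum_smul (hS y hy) _ fun i => ((hc i).differentiableOn (by simp)) y hy)

theorem isPolyFamily_curvOn [FiniteDimensional ℝ E] {br : V →L[ℝ] V →L[ℝ] V} (hS : UniqueDiffOn ℝ S)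
    {A U W : E → E [⋀^Fin 1]→L[ℝ] V} (hA : ContDiffOn ℝ ∞ A S) (hU : ContDiffOn ℝ ∞ U S)
    (hW : ContDiffOn ℝ ∞ W S) :
    IsPolyFamily S (fun t s y => curvOn br S (A + t • U + s • W) y) := by
  have h : IsPolyFamily S (fun t s => A + t • U + s • W) :=
    ((isPolyFamily_const hA).add (isPolyFamily_const hU).fst_smul).add
      (isPolyFamily_const hW).snd_smul
  exact (h.extDerivWithin hS).add ((h.wedge br rfl h).clm ((1 / 2 : ℝ) • ContinuousLinearMap.id ℝ _))

theorem integral_monomial (a b : ℕ) :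
    ∫ t in (0 : ℝ)..1, ∫ s in (0 : ℝ)..t, t ^ a * s ^ b = (((b : ℝ) + 1) * (a + b + 2))⁻¹ := by
  have h : ∀ t : ℝ, ∫ s in (0 : ℝ)..t, t ^ a * s ^ b = ((b : ℝ) + 1)⁻¹ * t ^ (a + b + 1) := by
    intro t
    rw [intervalIntegral.integral_const_mul, integral_pow]
    field_simp
    ring
  simp only [h]
  rw [intervalIntegral.integral_const_mul, integral_pow, mul_inv]
  congr 1
  field_simp
  push_cast
  ring

/-- The weights `w` let one formula serve for the integrals themselves and for derivatives of
monomials, whose exponents appear as factors. -/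
theorem integral_integral_sum_monomial [CompleteSpace X] {ι : Type*} [Fintype ι] (w : ι → ℝ)
    (a b : ι → ℕ) (c : ι → X) :
    ∫ t in (0 : ℝ)..1, ∫ s in (0 : ℝ)..t, ∑ i, (w i * (t ^ a i * s ^ b i)) • c i =
      ∑ i, (w i * (((b i : ℝ) + 1) * (a i + b i + 2))⁻¹) • c i := by
  have h : ∀ t : ℝ, ∫ s in (0 : ℝ)..t, ∑ i, (w i * (t ^ a i * s ^ b i)) • c i =
      ∑ i, (w i * ∫ s in (0 : ℝ)..t, t ^ a i * s ^ b i) • c i := by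
    intro t
    rw [intervalIntegral.integral_finsetSum fun i _ =>
      Continuous.intervalIntegrable (by fun_prop) _ _]
    refine Finset.sum_congr rfl fun i _ => ?_
    rw [intervalIntegral.integral_smul_const, intervalIntegral.integral_const_mul]
  simp only [h]
  rw [intervalIntegral.integral_finsetSum]
  · refine Finset.sum_congr rfl fun i _ => ?_
    rw [intervalIntegral.integral_smul_const, intervalIntegral.integral_const_mul,
      integral_monomial]
  · intro i _
    refine Continuous.intervalIntegrable ?_ _ _
    simp only [intervalIntegral.integral_const_mul, integral_pow]
    fun_prop

theorem IsPolyFamily.contDiffOn_integral [CompleteSpace X] {φ : ℝ → ℝ → E → X}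
    (hφ : IsPolyFamily S φ) :
    ContDiffOn ℝ ∞ (fun y => ∫ t in (0 : ℝ)..1, ∫ s in (0 : ℝ)..t, φ t s y) S := by
  obtain ⟨ι, _, a, b, c, hc, e⟩ := hφ
  refine (ContDiffOn.sum (s := Finset.univ) fun i _ =>
    (hc i).const_smul (1 * (((b i : ℝ) + 1) * (a i + b i + 2))⁻¹)).congr fun y hy => ?_
  refine Eq.trans ?_ (integral_integral_sum_monomial (fun _ => 1) a b fun i => c i y)
  simp only [fun t s => e t s y hy, one_mul]

/-- For a finite sum of monomials with form coefficients, the integral and the exterior derivative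
act on different factors, so no theorem on differentiation under the integral is needed. -/
theorem IsPolyFamily.extDerivWithin_integral {p : ℕ} [FiniteDimensional ℝ E] [CompleteSpace X]
    (hS : UniqueDiffOn ℝ S)
    {φ : ℝ → ℝ → E → E [⋀^Fin p]→L[ℝ] X} (hφ : IsPolyFamily S φ) {y : E} (hy : y ∈ S) :
    _root_.extDerivWithin (fun y => ∫ t in (0 : ℝ)..1, ∫ s in (0 : ℝ)..t, φ t s y) S y =
      ∫ t in (0 : ℝ)..1, ∫ s in (0 : ℝ)..t, _root_.extDerivWithin (φ t s) S y := by
  obtain ⟨ι, _, a, b, c, hc, e⟩ := hφ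
  have hd : ∀ i, DifferentiableWithinAt ℝ (c i) S y :=
    fun i => ((hc i).differentiableOn (by simp)) y hy
  have e1 : ∀ t s, _root_.extDerivWithin (φ t s) S y =
      ∑ i, (1 * (t ^ a i * s ^ b i)) • _root_.extDerivWithin (c i) S y := fun t s => by
    simp only [one_mul]
    exact (extDerivWithin_congr (fun z hz => e t s z hz) (e t s y hy)).trans
      (extDerivWithin_fun_sum_smul (hS y hy) _ hd)
  have e2 : ∀ z ∈ S, ∫ t in (0 : ℝ)..1, ∫ s in (0 : ℝ)..t, φ t s z =
      ∑ i, (1 * (((b i : ℝ) + 1) * (a i + b i + 2))⁻¹) • c i z := fun z hz => by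
    rw [← integral_integral_sum_monomial]
    simp only [fun t s => e t s z hz, one_mul]
  rw [extDerivWithin_congr e2 (e2 y hy), extDerivWithin_fun_sum_smul (hS y hy) _ hd]
  simp only [e1, integral_integral_sum_monomial]

theorem integral_sum_monomial [CompleteSpace X] {ι : Type*} [Fintype ι] (w : ι → ℝ) (a : ι → ℕ)
    (c : ι → X) : ∫ t in (0 : ℝ)..1, ∑ i, (w i * t ^ a i) • c i =
      ∑ i, (w i * ((a i : ℝ) + 1)⁻¹) • c i := by
  rw [intervalIntegral.integral_finsetSum fun i _ =>
      Continuous.intervalIntegrable (by fun_prop) _ _]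
  refine Finset.sum_congr rfl fun i _ => ?_
  rw [intervalIntegral.integral_smul_const, intervalIntegral.integral_const_mul, integral_pow]
  simp

/-- Green's theorem on the triangle with vertices `(0, 0)`, `(1, 0)` and `(1, 1)`, for
polynomials. -/
theorem IsPolyFamily.integral_green [CompleteSpace X] {g h : ℝ → ℝ → E → X} {g' h' : ℝ → ℝ → X}
    (hg : IsPolyFamily S g) (hh : IsPolyFamily S h) {y : E} (hy : y ∈ S)
    (hg' : ∀ t s, HasDerivAt (fun s => g t s y) (g' t s) s)
    (hh' : ∀ t s, HasDerivAt (fun t => h t s y) (h' t s) t) :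
    ∫ t in (0 : ℝ)..1, ∫ s in (0 : ℝ)..t, (g' t s - h' t s) =
      (∫ t in (0 : ℝ)..1, (g t t y + h t t y)) - (∫ t in (0 : ℝ)..1, g t 0 y) -
        ∫ s in (0 : ℝ)..1, h 1 s y := by
  obtain ⟨ι, _, a, b, c, -, e⟩ := hg
  obtain ⟨ι', _, a', b', c', -, e'⟩ := hh
  have e1 : ∀ t s, g' t s = ∑ i, (b i * (t ^ a i * s ^ (b i - 1))) • c i y := fun t s => by
    refine (hg' t s).unique ?_
    simp only [fun t s => e t s y hy]
    refine HasDerivAt.fun_sum fun i _ => HasDerivAt.smul_const ?_ _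
    exact (((hasDerivAt_pow (b i) s).const_mul (t ^ a i)).congr_deriv (by ring))
  have e2 : ∀ t s, h' t s = ∑ i, (a' i * (t ^ (a' i - 1) * s ^ b' i)) • c' i y := fun t s => by
    refine (hh' t s).unique ?_
    simp only [fun t s => e' t s y hy]
    refine HasDerivAt.fun_sum fun i _ => HasDerivAt.smul_const ?_ _
    exact (((hasDerivAt_pow (a' i) t).mul_const (s ^ b' i)).congr_deriv (by ring))
  have e3 : ∀ t s, g' t s - h' t s = ∑ i : ι ⊕ ι',
      (Sum.elim (fun i => (b i : ℝ)) (fun i => -(a' i : ℝ)) i *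
        (t ^ Sum.elim a (fun i => a' i - 1) i * s ^ Sum.elim (fun i => b i - 1) b' i)) •
        Sum.elim (fun i => c i y) (fun i => c' i y) i := fun t s => by
    rw [e1, e2]
    simp [Fintype.sum_sum_type, sub_eq_add_neg]
  have e4 : ∀ t, g t t y + h t t y = ∑ i : ι ⊕ ι',
      (1 * t ^ Sum.elim (fun i => a i + b i) (fun i => a' i + b' i) i) •
        Sum.elim (fun i => c i y) (fun i => c' i y) i := fun t => by
    rw [e _ _ y hy, e' _ _ y hy]
    simp [Fintype.sum_sum_type, pow_add]
  have e5 : ∀ t, g t 0 y = ∑ i, (0 ^ b i * t ^ a i) • c i y := fun t => by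
    rw [e _ _ y hy]
    simp only [mul_comm]
  have e6 : ∀ s, h 1 s y = ∑ i, (1 * s ^ b' i) • c' i y := fun t => by
    rw [e' _ _ y hy]
    simp only [one_pow]
  simp only [e3, e4, e5, e6, integral_integral_sum_monomial, integral_sum_monomial]
  simp only [Fintype.sum_sum_type, Sum.elim_inl, Sum.elim_inr]
  -- The truncated exponent `b i - 1` at `b i = 0` is harmless because of the factor `b i`; in that
  -- case the term `0 ^ b i` equals 1 and cancels the diagonal contribution.
  have k1 : ∀ i, (b i : ℝ) * ((((b i - 1 : ℕ) : ℝ) + 1) * (a i + (b i - 1 : ℕ) + 2))⁻¹ =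
      1 * (((a i + b i : ℕ) : ℝ) + 1)⁻¹ - 0 ^ b i * ((a i : ℝ) + 1)⁻¹ := fun i => by
    rcases b i with _ | m
    · simp
    · simp only [Nat.add_sub_cancel, zero_pow (Nat.succ_ne_zero m)]
      push_cast
      field_simp
      ring
  have k2 : ∀ i, -(a' i : ℝ) * ((((b' i : ℕ) : ℝ) + 1) * ((a' i - 1 : ℕ) + b' i + 2))⁻¹ =
      1 * (((a' i + b' i : ℕ) : ℝ) + 1)⁻¹ - 1 * ((b' i : ℝ) + 1)⁻¹ := fun i => by
    rcases a' i with _ | m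
    · simp
    · simp only [Nat.add_sub_cancel]
      push_cast
      field_simp
      ring
  simp only [k1, k2, sub_smul, Finset.sum_sub_distrib]
  abel

end PolynomialFamilies

/-! ### The triangle equation in a vector space. -/

section Triangle

variable {E V : Type*} [NormedAddCommGroup E] [NormedSpace ℝ E] [FiniteDimensional ℝ E]
  [NormedAddCommGroup V] [NormedSpace ℝ V] {n : ℕ}

/-- The transgression form of connections on a subset of a vector space. -/
def transOn (br : V →L[ℝ] V →L[ℝ] V) (f : Poly V (n + 1)) (S : Set E)
    (A₁ A₀ : E → E [⋀^Fin 1]→L[ℝ] V) (y : E) : E [⋀^Fin (2 * n + 1)]→L[ℝ] ℝ :=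
  (n + 1 : ℝ) • ∫ t in (0 : ℝ)..1,
    angle₁ f (add_comm 1 (2 * n)) ((A₁ - A₀) y) (curvOn br S (A₀ + t • (A₁ - A₀)) y)

/-- The transgression form of three connections on a subset of a vector space. -/
def transOn₂ (br : V →L[ℝ] V →L[ℝ] V) (f : Poly V (n + 1)) (S : Set E)
    (A₂ A₁ A₀ : E → E [⋀^Fin 1]→L[ℝ] V) (y : E) : E [⋀^Fin (2 * n)]→L[ℝ] ℝ :=
  ((n : ℝ) * (n + 1)) • ∫ t in (0 : ℝ)..1, ∫ s in (0 : ℝ)..t,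
    angle₂ f (add_comm 2 (2 * n)) ((A₂ - A₁) y) ((A₁ - A₀) y)
      (curvOn br S (A₀ + t • (A₁ - A₀) + s • (A₂ - A₁)) y)

variable {br : V →L[ℝ] V →L[ℝ] V} {f : Poly V (n + 1)} {S : Set E}
  {A₂ A₁ A₀ : E → E [⋀^Fin 1]→L[ℝ] V}

theorem contDiffOn_transOn₂ (hS : UniqueDiffOn ℝ S) (h₂ : ContDiffOn ℝ ∞ A₂ S)
    (h₁ : ContDiffOn ℝ ∞ A₁ S) (h₀ : ContDiffOn ℝ ∞ A₀ S) :
    ContDiffOn ℝ ∞ (transOn₂ br f S A₂ A₁ A₀) S :=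
  (((isPolyFamily_const (h₂.sub h₁)).angle₂ f _ (isPolyFamily_const (h₁.sub h₀))
    (isPolyFamily_curvOn hS h₀ (h₁.sub h₀) (h₂.sub h₁))).contDiffOn_integral).const_smul _

/-- The triangle equation. -/
theorem transOn_triangle (hbr : IsLieBracket br) (hf : IsSymmPoly f)
    (hinv : ∀ x, polyAct (br x) (n + 1) f = 0) (hS : UniqueDiffOn ℝ S)
    (h₂ : ContDiffOn ℝ ∞ A₂ S) (h₁ : ContDiffOn ℝ ∞ A₁ S) (h₀ : ContDiffOn ℝ ∞ A₀ S) {y : E}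
    (hy : y ∈ S) (hy' : y ∈ closure (interior S)) :
    transOn br f S A₂ A₀ y = transOn br f S A₂ A₁ y + transOn br f S A₁ A₀ y +
      extDerivWithin (transOn₂ br f S A₂ A₁ A₀) S y := by
  set U := A₁ - A₀ with hU
  set W := A₂ - A₁ with hW
  have hUc : ContDiffOn ℝ ∞ U S := h₁.sub h₀
  have hWc : ContDiffOn ℝ ∞ W S := h₂.sub h₁
  have hd : ∀ {A : E → E [⋀^Fin 1]→L[ℝ] V}, ContDiffOn ℝ ∞ A S → DifferentiableWithinAt ℝ A S y :=
    fun h => (h.differentiableOn (by simp)) y hy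
  let A : ℝ → ℝ → E → E [⋀^Fin 1]→L[ℝ] V := fun t s => A₀ + t • U + s • W
  have hA : ∀ t s, ContDiffOn ℝ ∞ (A t s) S := fun t s =>
    (h₀.add (hUc.const_smul t)).add (hWc.const_smul s)
  let F : ℝ → ℝ → E → E [⋀^Fin 2]→L[ℝ] V := fun t s => curvOn br S (A t s)
  have hF : IsPolyFamily S F := isPolyFamily_curvOn hS h₀ hUc hWc
  have hg := (isPolyFamily_const hUc).angle₁ f (add_comm 1 (2 * n)) hF
  have hh := (isPolyFamily_const hWc).angle₁ f (add_comm 1 (2 * n)) hF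
  have hx := (isPolyFamily_const hWc).angle₂ f (add_comm 2 (2 * n)) (isPolyFamily_const hUc) hF
  have hn : 1 + 2 + 2 * n = 2 * n + 1 + 2 := by ring
  have hn' : 2 + 1 + 2 * n = 2 * n + 1 + 2 := by ring
  let DU : ℝ → ℝ → E [⋀^Fin 2]→L[ℝ] V := fun t s =>
    extDerivWithin U S y + wedge br rfl (A t s y) (U y)
  let DW : ℝ → ℝ → E [⋀^Fin 2]→L[ℝ] V := fun t s =>
    extDerivWithin W S y + wedge br rfl (A t s y) (W y)
  have hs : ∀ t s, HasDerivAt (fun s => F t s y) (DW t s) s := fun t s =>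
    hasDerivAt_curvOn hbr (hS y hy) (hd (h₀.add (hUc.const_smul t))) (hd hWc) s
  have ht : ∀ t s, HasDerivAt (fun t => F t s y) (DU t s) t := fun t s => by
    have := hasDerivAt_curvOn hbr (hS y hy) (hd (h₀.add (hWc.const_smul s))) (hd hUc) t
    have e : ∀ t, A t s = A₀ + s • W + t • U := fun t => add_right_comm _ _ _
    simp only [F, DU, e]
    exact this
  -- The edge s = t carries A₂ ← A₀, the edge s = 0 carries A₁ ← A₀, and the edge t = 1 carries A₂ ←
  -- A₁.
  have green := hg.integral_green hh hy
    (fun t s => hasDerivAt_angle₁ hf _ hn (U y) (hs t s))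
    (fun t s => hasDerivAt_angle₁ hf _ hn (W y) (ht t s))
  -- The curl of the pair (⟨U Fⁿ⟩, ⟨W Fⁿ⟩) is exact. Moving the two-form DW past the one-form `U`
  -- costs no sign.
  have hder : ∀ t s, (n : ℝ) • angle₂ f hn (U y) (DW t s) (F t s y) -
      (n : ℝ) • angle₂ f hn (W y) (DU t s) (F t s y) = (n : ℝ) •
      extDerivWithin (fun z => angle₂ f (add_comm 2 (2 * n)) (W z) (U z) (F t s z)) S y := by
    intro t s
    rw [extDerivWithin_angle₂ hf hinv _ hn' hn (hS y hy) (A t s y) (hd hWc) (hd hUc)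
      ((contDiffOn_curvOn hS (hA t s)).differentiableOn (by simp) y hy)
      (hbr.extDerivWithin_curvOn hS (hA t s) hy hy'), angle₂_swap hf hn hn' (U y), smul_sub]
    norm_num
    rfl
  simp only [hder, intervalIntegral.integral_smul] at green
  have hd₂ : extDerivWithin (transOn₂ br f S A₂ A₁ A₀) S y = (n + 1 : ℝ) • (n : ℝ) •
      ∫ t in (0 : ℝ)..1, ∫ s in (0 : ℝ)..t,
        extDerivWithin (fun z => angle₂ f (add_comm 2 (2 * n)) (W z) (U z) (F t s z)) S y := by
    have e := hx.extDerivWithin_integral hS hy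
    rw [← e, smul_smul, mul_comm (n + 1 : ℝ), ← extDerivWithin_smul _ _ (hS y hy)]
    rfl
  rw [hd₂, green]
  have q20 : transOn br f S A₂ A₀ y = (n + 1 : ℝ) • ∫ t in (0 : ℝ)..1,
      (angle₁ f (add_comm 1 (2 * n)) (U y) (F t t y) +
        angle₁ f (add_comm 1 (2 * n)) (W y) (F t t y)) := by
    have e1 : A₂ - A₀ = U + W := by rw [hU, hW]; abel
    have e2 : ∀ t : ℝ, A₀ + t • (U + W) = A t t := fun t => by
      simp only [A, smul_add]; abel
    simp only [transOn, e1, e2, Pi.add_apply, angle₁_add]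
    rfl
  have q10 : transOn br f S A₁ A₀ y = (n + 1 : ℝ) • ∫ t in (0 : ℝ)..1,
      angle₁ f (add_comm 1 (2 * n)) (U y) (F t 0 y) := by
    simp only [transOn, F, A, zero_smul, add_zero]
    rfl
  have q21 : transOn br f S A₂ A₁ y = (n + 1 : ℝ) • ∫ s in (0 : ℝ)..1,
      angle₁ f (add_comm 1 (2 * n)) (W y) (F 1 s y) := by
    have e1 : A₀ + (1 : ℝ) • U = A₁ := by rw [hU, one_smul]; abel
    simp only [transOn, F, A, e1]
    rfl
  rw [q20, q10, q21]
  simp only [smul_sub]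
  abel

end Triangle

/-! ### Forms in charts and independence of the exterior derivative of the chart. -/

section ChartForms

variable {E H M V W X : Type*} [NormedAddCommGroup E] [NormedSpace ℝ E] [TopologicalSpace H]
  [TopologicalSpace M] [ChartedSpace H M]
  [NormedAddCommGroup V] [NormedSpace ℝ V] [NormedAddCommGroup W] [NormedSpace ℝ W]
  [NormedAddCommGroup X] [NormedSpace ℝ X]
  (I : ModelWithCorners ℝ E H)

/-- The derivative of the inverse of the chart at `x₀`. -/
def chartInvDeriv (x₀ : M) (y : E) : E →L[ℝ] E :=
  mfderivWithin 𝓘(ℝ, E) I (extChartAt I x₀).symm (range I) y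

/-- The derivative of the chart at `x₀`. -/
def chartDeriv (x₀ x : M) : E →L[ℝ] E := mfderiv I 𝓘(ℝ, E) (extChartAt I x₀) x

theorem inChart_apply {k : ℕ} (x₀ : M) (α : DForm E M k V) (y : E) :
    inChart I x₀ α y =
      (α ((extChartAt I x₀).symm y)).compContinuousLinearMap (chartInvDeriv I x₀ y) := rfl

theorem extD_apply {k : ℕ} (x : M) (α : DForm E M k V) :
    extD I α x = (extDerivWithin (inChart I x α) (range I)
      (extChartAt I x x)).compContinuousLinearMap (chartDeriv I x x) := rfl

theorem inChart_add {k : ℕ} (x₀ : M) (α β : DForm E M k V) :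
    inChart I x₀ (α + β) = inChart I x₀ α + inChart I x₀ β := rfl

theorem inChart_sub {k : ℕ} (x₀ : M) (α β : DForm E M k V) :
    inChart I x₀ (α - β) = inChart I x₀ α - inChart I x₀ β := rfl

theorem inChart_smul {k : ℕ} (x₀ : M) (c : ℝ) (α : DForm E M k V) :
    inChart I x₀ (c • α) = c • inChart I x₀ α := rfl

theorem inChart_zero {k : ℕ} (x₀ : M) :
    inChart I x₀ (0 : DForm E M k V) = 0 := rfl

theorem inChart_sum {ι : Type*} {k : ℕ} (x₀ : M) (s : Finset ι) (α : ι → DForm E M k V) :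
    inChart I x₀ (∑ i ∈ s, α i) = ∑ i ∈ s, inChart I x₀ (α i) := by
  classical
  induction s using Finset.induction_on with
  | empty => rfl
  | insert i s hi ih => rw [Finset.sum_insert hi, Finset.sum_insert hi, inChart_add, ih]

theorem inChart_wedge {p q l : ℕ} (B : V →L[ℝ] W →L[ℝ] X) (h : p + q = l) (x₀ : M)
    (α : DForm E M p V) (β : DForm E M q W) (y : E) :
    inChart I x₀ (fun x => wedge B h (α x) (β x)) y =
      wedge B h (inChart I x₀ α y) (inChart I x₀ β y) := by
  simp only [inChart_apply]
  exact wedge_compContinuousLinearMap ..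

theorem SmoothForm.add {k : ℕ} {α β : DForm E M k V} (hα : SmoothForm I α) (hβ : SmoothForm I β) :
    SmoothForm I (α + β) := fun x₀ => (hα x₀).add (hβ x₀)

theorem SmoothForm.sub {k : ℕ} {α β : DForm E M k V} (hα : SmoothForm I α) (hβ : SmoothForm I β) :
    SmoothForm I (α - β) := fun x₀ => (hα x₀).sub (hβ x₀)

theorem SmoothForm.smul {k : ℕ} {α : DForm E M k V} (c : ℝ) (hα : SmoothForm I α) :
    SmoothForm I (c • α) := fun x₀ => (hα x₀).const_smul c

theorem SmoothForm.sum {ι : Type*} {k : ℕ} (s : Finset ι) {α : ι → DForm E M k V}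
    (hα : ∀ i ∈ s, SmoothForm I (α i)) : SmoothForm I (∑ i ∈ s, α i) := fun x₀ => by
  rw [inChart_sum, funext fun y => Finset.sum_apply y s fun i => inChart I x₀ (α i)]
  exact ContDiffOn.sum fun i hi => hα i hi x₀

theorem SmoothForm.tensorConst {k : ℕ} {α : DForm E M k ℝ} (hα : SmoothForm I α) (c : V) :
    SmoothForm I (tensorConst α c) := fun x₀ =>
  (ContinuousLinearMap.compContinuousAlternatingMapCLM (ι := Fin k) ℝ E ℝ V
    (ContinuousLinearMap.toSpanSingleton ℝ c)).contDiff.comp_contDiffOn (hα x₀)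

section Manifold

variable [IsManifold I ∞ M]

theorem isInvertible_chartInvDeriv {x₀ : M} {y : E} (hy : y ∈ (extChartAt I x₀).target) :
    (chartInvDeriv I x₀ y).IsInvertible :=
  haveI : IsManifold I 1 M := IsManifold.of_le (n := ∞) (by simp)
  isInvertible_mfderivWithin_extChartAt_symm hy

theorem chartInvDeriv_comp_chartDeriv {x₀ x : M} (hx : x ∈ (extChartAt I x₀).source) :
    (chartInvDeriv I x₀ (extChartAt I x₀ x)).comp (chartDeriv I x₀ x) =
      ContinuousLinearMap.id ℝ E :=
  haveI : IsManifold I 1 M := IsManifold.of_le (n := ∞) (by simp)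
  mfderivWithin_extChartAt_symm_comp_mfderiv_extChartAt' hx

theorem chartDeriv_comp_chartInvDeriv {x₀ x : M} (hx : x ∈ (extChartAt I x₀).source) :
    (chartDeriv I x₀ x).comp (chartInvDeriv I x₀ (extChartAt I x₀ x)) =
      ContinuousLinearMap.id ℝ E :=
  haveI : IsManifold I 1 M := IsManifold.of_le (n := ∞) (by simp)
  mfderiv_extChartAt_comp_mfderivWithin_extChartAt_symm' hx

/-- At a point `x` the chart at `x` suffices, because the derivative of its inverse is invertible
there. -/
theorem eq_of_inChart_eq {k : ℕ} {α β : DForm E M k V}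
    (h : ∀ x₀, ∀ y ∈ (extChartAt I x₀).target, inChart I x₀ α y = inChart I x₀ β y) : α = β := by
  funext x
  have h1 := h x _ (mem_extChartAt_target (I := I) x)
  rw [inChart_apply, inChart_apply, extChartAt_to_inv] at h1
  have h2 := congrArg (fun γ => γ.compContinuousLinearMap (chartDeriv I x x)) h1
  have h3 : ∀ γ : E [⋀^Fin k]→L[ℝ] V, (γ.compContinuousLinearMap
      (chartInvDeriv I x (extChartAt I x x))).compContinuousLinearMap (chartDeriv I x x) = γ := by
    intro γ
    ext v
    have h4 := fun v => DFunLike.congr_fun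
      (chartInvDeriv_comp_chartDeriv I (mem_extChartAt_source (I := I) x)) v
    simp only [ContinuousLinearMap.comp_apply, ContinuousLinearMap.id_apply] at h4
    change γ (fun i => chartInvDeriv I x (extChartAt I x x) (chartDeriv I x x (v i))) = γ v
    simp only [h4]
  simpa only [h3] using h2

theorem inChart_eq_zero_iff {k : ℕ} (α : DForm E M k V) {x₀ : M} {y : E}
    (hy : y ∈ (extChartAt I x₀).target) :
    inChart I x₀ α y = 0 ↔ α ((extChartAt I x₀).symm y) = 0 := by
  obtain ⟨e, he⟩ := isInvertible_chartInvDeriv I hy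
  rw [inChart_apply, ← he]
  constructor
  · intro h
    ext v
    have := congrArg (fun γ => γ (fun i => e.symm (v i))) h
    simpa [Function.comp_def] using this
  · intro h
    rw [h]
    rfl

theorem uniqueDiffOn_coordChange (x₀ x : M) : UniqueDiffOn ℝ
    ((extChartAt I x₀).target ∩ (extChartAt I x₀).symm ⁻¹' (extChartAt I x).source) :=
  haveI : IsManifold I 1 M := IsManifold.of_le (n := ∞) (by simp)
  UniqueMDiffOn.uniqueDiffOn_target_inter (I := I) (isOpen_extChartAt_source x).uniqueMDiffOn x₀

theorem contDiffOn_coordChange (x₀ x : M) :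
    ContDiffOn ℝ ∞ (extChartAt I x ∘ (extChartAt I x₀).symm)
      ((extChartAt I x₀).target ∩ (extChartAt I x₀).symm ⁻¹' (extChartAt I x).source) := by
  rw [show (extChartAt I x₀).target ∩ (extChartAt I x₀).symm ⁻¹' (extChartAt I x).source =
      ((extChartAt I x₀).symm ≫ extChartAt I x).source by
    rw [PartialEquiv.trans_source, PartialEquiv.symm_source]]
  exact contDiffOn_ext_coord_change x x₀

theorem fderivWithin_coordChange {x₀ x : M} {z : E} (hz : z ∈ (extChartAt I x₀).target ∩
    (extChartAt I x₀).symm ⁻¹' (extChartAt I x).source) :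
    fderivWithin ℝ (extChartAt I x ∘ (extChartAt I x₀).symm) ((extChartAt I x₀).target ∩
      (extChartAt I x₀).symm ⁻¹' (extChartAt I x).source) z =
      (chartDeriv I x ((extChartAt I x₀).symm z)).comp (chartInvDeriv I x₀ z) := by
  have : IsManifold I 1 M := IsManifold.of_le (n := ∞) (by simp)
  have hU := (uniqueDiffOn_coordChange I x₀ x z hz).uniqueMDiffWithinAt
  have h1 : MDifferentiableWithinAt 𝓘(ℝ, E) I (extChartAt I x₀).symm (range I) z :=
    mdifferentiableWithinAt_extChartAt_symm hz.1
  have h2 : MDifferentiableAt I 𝓘(ℝ, E) (extChartAt I x) ((extChartAt I x₀).symm z) :=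
    mdifferentiableAt_extChartAt (by rw [← extChartAt_source (I := I)]; exact hz.2)
  have hsub : (extChartAt I x₀).target ∩
      (extChartAt I x₀).symm ⁻¹' (extChartAt I x).source ⊆ range I :=
    fun z hz => extChartAt_target_subset_range x₀ hz.1
  rw [← mfderivWithin_eq_fderivWithin, mfderiv_comp_mfderivWithin z h2 (h1.mono hsub) hU,
    mfderivWithin_subset hsub hU h1]
  rfl

theorem coordChange_domain_eventuallyEq {x₀ x : M} {y : E} (hy : y ∈ (extChartAt I x₀).target)
    (hx : (extChartAt I x₀).symm y ∈ (extChartAt I x).source) :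
    ((extChartAt I x₀).target ∩ (extChartAt I x₀).symm ⁻¹' (extChartAt I x).source : Set E)
      =ᶠ[𝓝 y] (extChartAt I x₀).target := by
  filter_upwards [(continuousAt_extChartAt_symm'' hy).preimage_mem_nhds
    ((isOpen_extChartAt_source x).mem_nhds hx)] with z hz
  exact propext ⟨fun h => h.1, fun h => ⟨h, hz⟩⟩

/-- The exterior derivative may be computed in any chart. -/
theorem inChart_extD {k : ℕ} {α : DForm E M k V} (hα : SmoothForm I α) {x₀ : M} {y : E}
    (hy : y ∈ (extChartAt I x₀).target) :
    inChart I x₀ (extD I α) y = extDerivWithin (inChart I x₀ α) (extChartAt I x₀).target y := by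
  set φ₀ := extChartAt I x₀ with hφ₀
  set x := φ₀.symm y with hx
  set φ := extChartAt I x with hφ
  let ψ : E → E := φ ∘ φ₀.symm
  set S : Set E := φ₀.target ∩ φ₀.symm ⁻¹' φ.source with hS
  have hxs : x ∈ φ.source := mem_extChartAt_source x
  have hyS : y ∈ S := ⟨hy, hxs⟩
  have hopen : IsOpen φ.source := isOpen_extChartAt_source x
  have hSu : UniqueDiffOn ℝ S := uniqueDiffOn_coordChange I x₀ x
  have hψ : ContDiffOn ℝ ∞ ψ S := contDiffOn_coordChange I x₀ x
  have hSd : ∀ z ∈ S, fderivWithin ℝ ψ S z =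
      (chartDeriv I x (φ₀.symm z)).comp (chartInvDeriv I x₀ z) :=
    fun z hz => fderivWithin_coordChange I hz
  -- The two chart expressions of `α` differ by pullback along the coordinate change.
  have hpull : ∀ z ∈ S, inChart I x₀ α z =
      (inChart I x α (ψ z)).compContinuousLinearMap (fderivWithin ℝ ψ S z) := by
    intro z hz
    have h1 : φ.symm (ψ z) = φ₀.symm z := φ.left_inv hz.2
    have h2 := chartInvDeriv_comp_chartDeriv I (x₀ := x) hz.2
    rw [hSd z hz, inChart_apply, inChart_apply, h1]
    ext v
    simp only [ContinuousAlternatingMap.compContinuousLinearMap_apply, Function.comp_def]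
    congr 1
    funext i
    exact (DFunLike.congr_fun h2 (chartInvDeriv I x₀ z (v i))).symm
  have hψy : ψ y = φ x := rfl
  have hmaps : MapsTo ψ S φ.target := fun z hz => φ.map_source hz.2
  -- Needed for the symmetry of second derivatives of the coordinate change at boundary points.
  have hclos : y ∈ closure (interior S) := by
    have h := extChartAt_mem_closure_interior (I := I) (x₀ := x₀)
      (subset_closure (by rwa [hopen.interior_eq] : x ∈ interior φ.source)) (φ₀.map_target hy)
    rwa [φ₀.right_inv hy, inter_comm] at h
  have hset : S =ᶠ[𝓝 y] φ₀.target := coordChange_domain_eventuallyEq I hy hxs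
  have hrange : (range I : Set E) =ᶠ[𝓝 (φ x)] φ.target :=
    extChartAt_target_eventuallyEq.symm
  -- The exterior derivative commutes with this pullback. The sets `S`, the chart targets and `range
  -- I` may be interchanged because they agree near the points in question.
  have key : extDerivWithin (inChart I x₀ α) φ₀.target y =
      (extDerivWithin (inChart I x α) φ.target (φ x)).compContinuousLinearMap
        (fderivWithin ℝ ψ S y) := by
    rw [← hψy, ← extDerivWithin_pullback (r := ∞) (((hα x).differentiableOn (by simp)) _ (hmaps hyS))
      (hψ y hyS) (by rw [minSmoothness_of_isRCLikeNormedField];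
                     exact WithTop.coe_le_coe.2 (le_top : (2 : ℕ∞) ≤ ⊤)) hSu hclos hyS hmaps,
      ← extDerivWithin_congr hpull (hpull y hyS), extDerivWithin, extDerivWithin,
      fderivWithin_congr_set hset]
  rw [key, inChart_apply, extD_apply, hSd y hyS, extDerivWithin, fderivWithin_congr_set hrange]
  rfl

end Manifold

end ChartForms

/-! ### Transgression forms and the triangle equation on the manifold. -/

section ChartTransgression

variable {E H M : Type*} [NormedAddCommGroup E] [NormedSpace ℝ E] [TopologicalSpace H]
  [TopologicalSpace M] [ChartedSpace H M] {n : ℕ} (I : ModelWithCorners ℝ E H) [IsManifold I ∞ M]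

theorem inChart_sq (A : DForm E M 1 (AdS n)) (x₀ : M) (y : E) :
    inChart I x₀ (sq A) y =
      (1 / 2 : ℝ) • wedge (bracket n) rfl (inChart I x₀ A y) (inChart I x₀ A y) :=
  congrArg (fun γ => (1 / 2 : ℝ) • γ) (inChart_wedge I (bracket n) rfl x₀ A A y)

theorem inChart_curv {A : DForm E M 1 (AdS n)} (hA : SmoothForm I A) {x₀ : M} {y : E}
    (hy : y ∈ (extChartAt I x₀).target) : inChart I x₀ (curv I A) y =
      curvOn (bracket n) (extChartAt I x₀).target (inChart I x₀ A) y := by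
  rw [curv, inChart_add, Pi.add_apply, inChart_extD I hA hy, inChart_sq]
  rfl

/-- Pullback along an invertible map is a continuous linear equivalence of form spaces, and these
commute with integrals without any integrability hypothesis. -/
theorem integral_compContinuousLinearMap {F : Type*} [NormedAddCommGroup F] [NormedSpace ℝ F]
    {k : ℕ} {L : E →L[ℝ] E} (hL : L.IsInvertible) (g : ℝ → E [⋀^Fin k]→L[ℝ] F) (a b : ℝ) :
    (∫ t in a..b, g t).compContinuousLinearMap L =
      ∫ t in a..b, (g t).compContinuousLinearMap L := by
  obtain ⟨e, rfl⟩ := hL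
  let c : (E [⋀^Fin k]→L[ℝ] F) ≃L[ℝ] E [⋀^Fin k]→L[ℝ] F :=
    ContinuousLinearEquiv.equivOfInverse
      (ContinuousAlternatingMap.compContinuousLinearMapCLM (e : E →L[ℝ] E))
      (ContinuousAlternatingMap.compContinuousLinearMapCLM (e.symm : E →L[ℝ] E))
      (fun γ => by ext v; simp [Function.comp_def]) (fun γ => by ext v; simp [Function.comp_def])
  change c _ = ∫ t in a..b, c (g t)
  rw [intervalIntegral, intervalIntegral, map_sub, ← c.integral_comp_comm, ← c.integral_comp_comm]

variable (f : Poly (AdS n) (n + 1))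

theorem inChart_angle₁_curv {p l : ℕ} (h : p + 2 * n = l) (Z : DForm E M p (AdS n))
    {A : DForm E M 1 (AdS n)} (hA : SmoothForm I A) {x₀ : M} {y : E}
    (hy : y ∈ (extChartAt I x₀).target) :
    inChart I x₀ (fun x => angle₁ f h (Z x) (curv I A x)) y =
      angle₁ f h (inChart I x₀ Z y)
        (curvOn (bracket n) (extChartAt I x₀).target (inChart I x₀ A) y) := by
  rw [← inChart_curv I hA hy]
  exact angle₁_compContinuousLinearMap ..

theorem inChart_angle₂_curv {p q l : ℕ} (h : p + q + 2 * n = l + 2) (Y : DForm E M p (AdS n))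
    (Z : DForm E M q (AdS n)) {A : DForm E M 1 (AdS n)} (hA : SmoothForm I A) {x₀ : M} {y : E}
    (hy : y ∈ (extChartAt I x₀).target) :
    inChart I x₀ (fun x => angle₂ f h (Y x) (Z x) (curv I A x)) y =
      angle₂ f h (inChart I x₀ Y y) (inChart I x₀ Z y)
        (curvOn (bracket n) (extChartAt I x₀).target (inChart I x₀ A) y) := by
  rw [← inChart_curv I hA hy]
  exact angle₂_compContinuousLinearMap ..

variable {A₂ A₁ A₀ : DForm E M 1 (AdS n)}

theorem inChart_transgression (h₁ : SmoothForm I A₁) (h₀ : SmoothForm I A₀) {x₀ : M} {y : E}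
    (hy : y ∈ (extChartAt I x₀).target) :
    inChart I x₀ (transgression I f A₁ A₀) y = transOn (bracket n) f (extChartAt I x₀).target
      (inChart I x₀ A₁) (inChart I x₀ A₀) y := by
  have h := fun t : ℝ => inChart_angle₁_curv I f (add_comm 1 (2 * n)) (A₁ - A₀)
    (h₀.add I ((h₁.sub I h₀).smul I t)) hy
  simp only [inChart_add, inChart_smul, inChart_sub] at h
  rw [transOn]
  simp only [← h]
  simp only [inChart_apply, ← integral_compContinuousLinearMap (isInvertible_chartInvDeriv I hy)]
  rfl

theorem inChart_transgression₂ (h₂ : SmoothForm I A₂) (h₁ : SmoothForm I A₁)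
    (h₀ : SmoothForm I A₀) {x₀ : M} {y : E} (hy : y ∈ (extChartAt I x₀).target) :
    inChart I x₀ (transgression₂ I f A₂ A₁ A₀) y =
      transOn₂ (bracket n) f (extChartAt I x₀).target
        (inChart I x₀ A₂) (inChart I x₀ A₁) (inChart I x₀ A₀) y := by
  have h := fun t s : ℝ => inChart_angle₂_curv I f (add_comm 2 (2 * n)) (A₂ - A₁) (A₁ - A₀)
    ((h₀.add I ((h₁.sub I h₀).smul I t)).add I ((h₂.sub I h₁).smul I s)) hy
  simp only [inChart_add, inChart_smul, inChart_sub] at h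
  rw [transOn₂]
  simp only [← h]
  simp only [inChart_apply, ← integral_compContinuousLinearMap (isInvertible_chartInvDeriv I hy)]
  rfl

theorem smoothForm_transgression₂ [FiniteDimensional ℝ E] (h₂ : SmoothForm I A₂)
    (h₁ : SmoothForm I A₁) (h₀ : SmoothForm I A₀) :
    SmoothForm I (transgression₂ I f A₂ A₁ A₀) := fun x₀ =>
  (contDiffOn_transOn₂ (uniqueDiffOn_extChartAt_target x₀) (h₂ x₀) (h₁ x₀) (h₀ x₀)).congr
    fun _ hy => inChart_transgression₂ I f h₂ h₁ h₀ hy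

/-- The triangle equation. -/
theorem transgression_triangle [FiniteDimensional ℝ E] (hf : IsSymmPoly f)
    (hinv : ∀ x, polyAct (bracket n x) (n + 1) f = 0) (h₂ : SmoothForm I A₂)
    (h₁ : SmoothForm I A₁) (h₀ : SmoothForm I A₀) :
    transgression I f A₂ A₀ = transgression I f A₂ A₁ + transgression I f A₁ A₀ +
      extD I (transgression₂ I f A₂ A₁ A₀) := by
  refine eq_of_inChart_eq I fun x₀ y hy => ?_
  rw [inChart_add, inChart_add, Pi.add_apply, Pi.add_apply, inChart_transgression I f h₂ h₀ hy,
    inChart_transgression I f h₂ h₁ hy, inChart_transgression I f h₁ h₀ hy,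
    inChart_extD I (smoothForm_transgression₂ I f h₂ h₁ h₀) hy,
    transOn_triangle isLieBracket_bracket hf hinv (uniqueDiffOn_extChartAt_target x₀)
      (h₂ x₀) (h₁ x₀) (h₀ x₀) hy (extChartAt_target_subset_closure_interior hy),
    extDerivWithin_congr (fun z hz => inChart_transgression₂ I f h₂ h₁ h₀ hz)
      (inChart_transgression₂ I f h₂ h₁ h₀ hy)]

end ChartTransgression

/-! ### Lorentz-valued and boost-valued forms in the Levi-Civita polynomial. -/

section Grading

variable {E : Type*} [NormedAddCommGroup E] [NormedSpace ℝ E] {n p q l : ℕ} {ℓ : ℝ}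

/-- Forms with values in the Lorentz subalgebra. -/
def IsLorentzValued (ℓ : ℝ) (γ : E [⋀^Fin p]→L[ℝ] AdS n) : Prop := ∀ v a, compP ℓ a (γ v) = 0

/-- Forms with values in the span of the boosts. -/
def IsBoostValued (γ : E [⋀^Fin p]→L[ℝ] AdS n) : Prop := ∀ v a b, compJ a b (γ v) = 0

theorem projJ_eq_of_lorentz (hℓ : ℓ ≠ 0) {X : AdS n} (h : ∀ a, compP ℓ a X = 0) : projJ X = X := by
  have h1 := projP_add_projJ hℓ X
  rwa [projP_apply, Finset.sum_eq_zero fun a _ => by rw [h, zero_smul], zero_add] at h1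

theorem projJ_eq_zero_of_boost {X : AdS n} (h : ∀ a b, compJ a b X = 0) : projJ X = 0 := by
  simp [projJ_apply, h]

theorem projP_eq_of_boost (hℓ : ℓ ≠ 0) {X : AdS n} (h : ∀ a b, compJ a b X = 0) :
    projP ℓ X = X := by
  have h1 := projP_add_projJ hℓ X
  rwa [projJ_eq_zero_of_boost h, add_zero] at h1

theorem projP_eq_zero_of_lorentz {X : AdS n} (h : ∀ a, compP ℓ a X = 0) : projP ℓ X = 0 := by
  simp [projP_apply, h]

theorem polyPrecomp_wedge_const0 {A : AdS n →L[ℝ] AdS n} {τ : ℝ} {f : Poly (AdS n) (n + 1)}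
    {Z : E [⋀^Fin p]→L[ℝ] AdS n}
    (h : ∀ v, polyPrecomp A n (insertFirst (AdS n) n f (Z v)) =
      τ • insertFirst (AdS n) n f (Z v)) (h' : p + 2 * n = l) (F : E [⋀^Fin 2]→L[ℝ] AdS n) :
    angle₁ f h' Z (A.compContinuousAlternatingMap F) = τ • angle₁ f h' Z F := by
  rw [angle₁, angle₁, ← fill_polyPrecomp, ← fill_smul]
  congr 1
  ext1 v
  simp only [ContinuousLinearMap.compContinuousAlternatingMap_coe, Function.comp_apply]
  change _ = τ • wedge (insertFirst (AdS n) n) (zero_add p) (const0 f) Z v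
  rw [wedge_const0_apply _ _ rfl]
  exact h _

/-- The boost `Z` leaves only Lorentz slots, so projecting the two-form to its Lorentz part changes
nothing, and this projection removes `T`. -/
theorem angle₁_leviCivita_of_boost (hℓ : ℓ ≠ 0) (h : p + 2 * n = l)
    {Z : E [⋀^Fin p]→L[ℝ] AdS n} {G T : E [⋀^Fin 2]→L[ℝ] AdS n} (hZ : IsBoostValued Z)
    (hG : IsLorentzValued ℓ G) (hT : IsBoostValued T) :
    angle₁ (leviCivita n ℓ) h Z (G + T) = angle₁ (leviCivita n ℓ) h Z G := by
  have h1 := polyPrecomp_wedge_const0 (A := projJ) (τ := 1) (f := leviCivita n ℓ) (Z := Z)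
    (fun v => by rw [insertFirst_leviCivita_of_P ℓ (hZ v), one_smul]) h (G + T)
  rw [one_smul] at h1
  rw [← h1]
  congr 1
  ext1 v
  change projJ (G v + T v) = G v
  rw [map_add, projJ_eq_of_lorentz hℓ (hG v), projJ_eq_zero_of_boost (hT v), add_zero]

/-- No argument supplies the required boost component; formally this is the scaling rule at `τ = 0`.
-/
theorem angle₁_leviCivita_of_lorentz (hℓ : ℓ ≠ 0) (h : p + 2 * n = l)
    {Z : E [⋀^Fin p]→L[ℝ] AdS n} {G : E [⋀^Fin 2]→L[ℝ] AdS n} (hZ : IsLorentzValued ℓ Z)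
    (hG : IsLorentzValued ℓ G) :
    angle₁ (leviCivita n ℓ) h Z G = 0 := by
  have h1 := polyPrecomp_wedge_const0 (f := leviCivita n ℓ) (Z := Z)
    (fun v => insertFirst_leviCivita_of_J hℓ (hZ v) 0) h G
  rw [zero_smul, zero_smul, add_zero] at h1
  rw [← h1]
  congr 1
  ext1 v
  exact (projJ_eq_of_lorentz hℓ (hG v)).symm

/-- The left side is homogeneous of degree one under scaling of `T`, so it equals its derivative at
`T = 0`, which is the right side. -/
theorem angle₁_leviCivita_add (hℓ : ℓ ≠ 0) (h : p + 2 * n = l) (h' : p + 2 + 2 * n = l + 2)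
    {Z : E [⋀^Fin p]→L[ℝ] AdS n} {G T : E [⋀^Fin 2]→L[ℝ] AdS n} (hZ : IsLorentzValued ℓ Z)
    (hG : IsLorentzValued ℓ G) (hT : IsBoostValued T) :
    angle₁ (leviCivita n ℓ) h Z (G + T) = (n : ℝ) • angle₂ (leviCivita n ℓ) h' Z T G := by
  have h1 : ∀ τ : ℝ, angle₁ (leviCivita n ℓ) h Z (G + τ • T) =
      τ • angle₁ (leviCivita n ℓ) h Z (G + T) := fun τ => by
    rw [← polyPrecomp_wedge_const0 (fun v => insertFirst_leviCivita_of_J hℓ (hZ v) τ) h (G + T)]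
    congr 1
    ext1 v
    change G v + τ • T v = projJ (G v + T v) + τ • projP ℓ (G v + T v)
    rw [map_add, map_add, projJ_eq_of_lorentz hℓ (hG v), projJ_eq_zero_of_boost (hT v),
      projP_eq_of_boost hℓ (hT v), projP_eq_zero_of_lorentz (hG v), add_zero, zero_add]
  have hF : HasDerivAt (fun τ : ℝ => G + τ • T) T 0 := by
    simpa using ((hasDerivAt_id (0 : ℝ)).smul_const T).const_add G
  have h2 := hasDerivAt_angle₁ (isSymmPoly_leviCivita ℓ) h h' Z hF
  simp only [h1] at h2
  have h3 : HasDerivAt (fun τ : ℝ => τ • angle₁ (leviCivita n ℓ) h Z (G + T))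
      (angle₁ (leviCivita n ℓ) h Z (G + T)) 0 := by
    simpa using (hasDerivAt_id (0 : ℝ)).smul_const (angle₁ (leviCivita n ℓ) h Z (G + T))
  rw [h3.unique h2, zero_smul, add_zero]

theorem apply_wedge_eq_zero {V W X Y : Type*} [NormedAddCommGroup V] [NormedSpace ℝ V]
    [NormedAddCommGroup W] [NormedSpace ℝ W] [NormedAddCommGroup X] [NormedSpace ℝ X]
    [NormedAddCommGroup Y] [NormedSpace ℝ Y] (L : X →L[ℝ] Y)
    (B : V →L[ℝ] W →L[ℝ] X) (h : p + q = l) {α : E [⋀^Fin p]→L[ℝ] V} {β : E [⋀^Fin q]→L[ℝ] W}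
    (h0 : ∀ u u', L (B (α u) (β u')) = 0) (v : Fin l → E) : L (wedge B h α β v) = 0 := by
  rw [wedge_apply', map_smul, map_sum, Finset.sum_eq_zero fun σ _ => ?_, smul_zero]
  rw [Units.smul_def, map_zsmul, h0, smul_zero]

theorem IsLorentzValued.add {α β : E [⋀^Fin p]→L[ℝ] AdS n} (hα : IsLorentzValued ℓ α)
    (hβ : IsLorentzValued ℓ β) : IsLorentzValued ℓ (α + β) := fun v a => by
  change compP ℓ a (α v + β v) = 0
  rw [map_add, hα, hβ, add_zero]

theorem IsLorentzValued.smul (c : ℝ) {α : E [⋀^Fin p]→L[ℝ] AdS n} (hα : IsLorentzValued ℓ α) :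
    IsLorentzValued ℓ (c • α) := fun v a => by
  change compP ℓ a (c • α v) = 0
  rw [map_smul, hα, smul_zero]

theorem IsBoostValued.add {α β : E [⋀^Fin p]→L[ℝ] AdS n} (hα : IsBoostValued α)
    (hβ : IsBoostValued β) : IsBoostValued (α + β) := fun v a b => by
  change compJ a b (α v + β v) = 0
  rw [map_add, hα, hβ, add_zero]

theorem IsBoostValued.smul (c : ℝ) {α : E [⋀^Fin p]→L[ℝ] AdS n} (hα : IsBoostValued α) :
    IsBoostValued (c • α) := fun v a b => by
  change compJ a b (c • α v) = 0
  rw [map_smul, hα, smul_zero]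

theorem IsLorentzValued.wedge (hℓ : ℓ ≠ 0) (h : p + q = l) {α : E [⋀^Fin p]→L[ℝ] AdS n}
    {β : E [⋀^Fin q]→L[ℝ] AdS n} (hα : IsLorentzValued ℓ α) (hβ : IsLorentzValued ℓ β) :
    IsLorentzValued ℓ (wedge (bracket n) h α β) := fun v a =>
  apply_wedge_eq_zero _ _ h (fun u u' => compP_bracket_of_J hℓ (hα u) (hβ u') a) v

theorem IsBoostValued.wedge (h : p + q = l) {α : E [⋀^Fin p]→L[ℝ] AdS n}
    {β : E [⋀^Fin q]→L[ℝ] AdS n} (hα : IsBoostValued α) (hβ : IsBoostValued β) :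
    IsLorentzValued ℓ (wedge (bracket n) h α β) := fun v a =>
  apply_wedge_eq_zero _ _ h (fun u u' => compP_bracket_of_P (hα u) (hβ u') a) v

theorem IsLorentzValued.wedge_boost (hℓ : ℓ ≠ 0) (h : p + q = l) {α : E [⋀^Fin p]→L[ℝ] AdS n}
    {β : E [⋀^Fin q]→L[ℝ] AdS n} (hα : IsLorentzValued ℓ α) (hβ : IsBoostValued β) :
    IsBoostValued (TGFT.wedge (bracket n) h α β) := fun v a b =>
  apply_wedge_eq_zero _ _ h (fun u u' => compJ_bracket_of_J_P hℓ (hα u) (hβ u') a b) v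

end Grading

/-! ### Curvature and torsion by degree; the Lanczos–Lovelock form of the lagrangian. -/

section Gravity

variable {E H M : Type*} [NormedAddCommGroup E] [NormedSpace ℝ E] [TopologicalSpace H]
  [TopologicalSpace M] [ChartedSpace H M] {n : ℕ} (I : ModelWithCorners ℝ E H)
  {e : Fin (2 * n + 1) → DForm E M 1 ℝ} {w w₀ : Fin (2 * n + 1) → Fin (2 * n + 1) → DForm E M 1 ℝ}
  {ℓ : ℝ}

theorem isBoostValued_vielbein (x : M) : IsBoostValued (vielbein ℓ e x) := fun v a b => by
  have : vielbein ℓ e x v = ∑ c, (e c x v) • P (n := n) ℓ c := by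
    simp [vielbein, tensorConst]
  rw [this]
  simp [compJ_P]

theorem isLorentzValued_spinConn (x : M) : IsLorentzValued ℓ (spinConn w x) := fun v a => by
  have : spinConn w x v = (1 / 2 : ℝ) • ∑ c, ∑ d, (w c d x v) • J (n := n) c d := by
    simp [spinConn, tensorConst]
  rw [this]
  simp [compP_J]

theorem smoothForm_vielbein (he : ∀ a, SmoothForm I (e a)) : SmoothForm I (vielbein ℓ e) :=
  SmoothForm.sum I _ fun a _ => (he a).tensorConst I _

theorem smoothForm_spinConn (hw : ∀ a b, SmoothForm I (w a b)) : SmoothForm I (spinConn w) :=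
  (SmoothForm.sum I _ fun a _ => SmoothForm.sum I _ fun b _ => (hw a b).tensorConst I _).smul I _

/-- A constant linear map commutes with d, so forms with values in its kernel keep that property; in
particular d preserves the Lorentz and the boost parts. -/
theorem apply_extD_eq_zero {V W : Type*} [NormedAddCommGroup V] [NormedSpace ℝ V]
    [NormedAddCommGroup W] [NormedSpace ℝ W] (L : V →L[ℝ] W) {k : ℕ} {α : DForm E M k V}
    (hα : SmoothForm I α) (h : ∀ x v, L (α x v) = 0) (x : M) (v : Fin (k + 1) → E) :
    L (extD I α x v) = 0 := by
  let K := ContinuousLinearMap.compContinuousAlternatingMapCLM (ι := Fin k) ℝ E V W L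
  let y := extChartAt I x x
  have hd : DifferentiableWithinAt ℝ (inChart I x α) (range I) y := by
    have h1 := ((hα x).differentiableOn (by simp)) y (mem_extChartAt_target x)
    exact (differentiableWithinAt_congr_set extChartAt_target_eventuallyEq).1 h1
  have h1 : K.comp (fderivWithin ℝ (inChart I x α) (range I) y) = 0 := by
    have hu : UniqueDiffWithinAt ℝ (range I) y := I.uniqueDiffOn y (mem_range_self _)
    have h2 := (K.hasFDerivAt.comp_hasFDerivWithinAt y hd.hasFDerivWithinAt)
    refine hu.eq h2 ((hasFDerivWithinAt_const (0 : E [⋀^Fin k]→L[ℝ] W) _ _).congr ?_ ?_)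
    · intro z _
      ext u
      exact h _ _
    · ext u
      exact h _ _
  rw [extD_apply]
  change L (ContinuousAlternatingMap.alternatizeUncurryFin _ _) = 0
  rw [ContinuousAlternatingMap.alternatizeUncurryFin_apply, map_sum]
  refine Finset.sum_eq_zero fun i _ => ?_
  rw [map_zsmul]
  have h3 := DFunLike.congr_fun (DFunLike.congr_fun h1 (chartDeriv I x x (v i)))
  have h4 := h3 (i.removeNth fun j => chartDeriv I x x (v j))
  exact (congrArg _ h4).trans (smul_zero _)

variable [IsManifold I ∞ M]

theorem curv_add_smul [FiniteDimensional ℝ E] {A U : DForm E M 1 (AdS n)} (hA : SmoothForm I A) (hU : SmoothForm I U)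
    (t : ℝ) : curv I (A + t • U) = curv I A + t • (extD I U + brk rfl A U) + t ^ 2 • sq U := by
  refine eq_of_inChart_eq I fun x₀ y hy => ?_
  have hd : ∀ {A : DForm E M 1 (AdS n)}, SmoothForm I A →
      DifferentiableWithinAt ℝ (inChart I x₀ A) (extChartAt I x₀).target y :=
    fun h => ((h x₀).differentiableOn (by simp)) y hy
  rw [inChart_curv I (hA.add I (hU.smul I t)) hy, inChart_add, inChart_smul,
    curvOn_add_smul isLieBracket_bracket (uniqueDiffOn_extChartAt_target x₀ y hy) (hd hA) (hd hU)]
  simp only [inChart_add, inChart_smul, Pi.add_apply, Pi.smul_apply, inChart_curv I hA hy,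
    inChart_extD I hU hy, inChart_sq]
  rw [show inChart I x₀ (brk rfl A U) y = _ from inChart_wedge I (bracket n) rfl x₀ A U y]

theorem isLorentzValued_curv (hℓ : ℓ ≠ 0) {A : DForm E M 1 (AdS n)} (hA : SmoothForm I A)
    (hA' : ∀ x, IsLorentzValued ℓ (A x)) (x : M) : IsLorentzValued ℓ (curv I A x) :=
  IsLorentzValued.add (fun v a => apply_extD_eq_zero I (compP ℓ a) hA (fun x v => hA' x v a) x v)
    (((hA' x).wedge hℓ rfl (hA' x)).smul (1 / 2))

theorem isBoostValued_torsion (hℓ : ℓ ≠ 0) {A B : DForm E M 1 (AdS n)} (hA : SmoothForm I A)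
    (hA' : ∀ x, IsBoostValued (A x)) (hB' : ∀ x, IsLorentzValued ℓ (B x)) (x : M) :
    IsBoostValued (torsion I A B x) :=
  IsBoostValued.add
    (fun v a b => apply_extD_eq_zero I (compJ a b) hA (fun x v => hA' x v a b) x v)
    ((hB' x).wedge_boost hℓ rfl (hA' x))

theorem isLorentzValued_curv_add_sq (hℓ : ℓ ≠ 0) {A B : DForm E M 1 (AdS n)} (hB : SmoothForm I B)
    (hA' : ∀ x, IsBoostValued (A x)) (hB' : ∀ x, IsLorentzValued ℓ (B x)) (c : ℝ) (x : M) :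
    IsLorentzValued ℓ ((curv I B + c • sq A) x) :=
  (isLorentzValued_curv I hℓ hB hB' x).add ((((hA' x).wedge rfl (hA' x)).smul (1 / 2)).smul c)

/-- The difference of two Lorentz connections and the curvatures along the segment joining them are
all Lorentz-valued. -/
theorem transgression_spinConn (hℓ : ℓ ≠ 0) (hw : ∀ a b, SmoothForm I (w a b))
    (hw₀ : ∀ a b, SmoothForm I (w₀ a b)) :
    transgression I (leviCivita n ℓ) (spinConn w) (spinConn w₀) = 0 := by
  funext x
  rw [transgression]
  have hs := smoothForm_spinConn I hw
  have hs₀ := smoothForm_spinConn I hw₀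
  have h1 : IsLorentzValued ℓ ((spinConn w - spinConn w₀ : DForm E M 1 (AdS n)) x) := fun v a => by
    change compP ℓ a (spinConn w x v - spinConn w₀ x v) = 0
    rw [map_sub, isLorentzValued_spinConn, isLorentzValued_spinConn, sub_zero]
  have h0 : ∀ t : ℝ, angle₁ (leviCivita n ℓ) (add_comm 1 (2 * n))
      ((spinConn w - spinConn w₀ : DForm E M 1 (AdS n)) x)
      (curv I (spinConn w₀ + t • (spinConn w - spinConn w₀)) x) = 0 := fun t => by
    refine angle₁_leviCivita_of_lorentz hℓ _ h1 (isLorentzValued_curv I hℓ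
      (hs₀.add I ((hs.sub I hs₀).smul I t)) (fun x => ?_) x)
    intro v a
    change compP ℓ a (spinConn w₀ x v + t • (spinConn w x v - spinConn w₀ x v)) = 0
    simp only [map_add, map_smul, map_sub, isLorentzValued_spinConn x v a]
    simp
  simp only [h0]
  simp

/-- The curvature of ω + te is R + t²e² + tT, and the boost-valued term tT drops out next to the
boost-valued e. -/
theorem transgression_vielbein [FiniteDimensional ℝ E] (hℓ : ℓ ≠ 0) (he : ∀ a, SmoothForm I (e a))
    (hw : ∀ a b, SmoothForm I (w a b)) (k : ℝ) :
    k • transgression I (leviCivita n ℓ) (vielbein ℓ e + spinConn w) (spinConn w) =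
      lovelockLagrangian I ℓ k e w := by
  funext x
  have hs := smoothForm_spinConn I hw
  have hv := smoothForm_vielbein (ℓ := ℓ) I he
  rw [lovelockLagrangian, Pi.smul_apply, transgression, add_sub_cancel_right, smul_smul,
    mul_comm k]
  congr 2
  funext t
  rw [curv_add_smul I hs hv]
  have h1 : (curv I (spinConn w) + t • (extD I (vielbein ℓ e) + brk rfl (spinConn w) (vielbein ℓ e))
      + t ^ 2 • sq (vielbein ℓ e)) x = (curv I (spinConn w) + t ^ 2 • sq (vielbein ℓ e)) x +
        t • torsion I (vielbein ℓ e) (spinConn w) x := by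
    simp only [torsion, Pi.add_apply, Pi.smul_apply]
    abel
  rw [h1]
  exact angle₁_leviCivita_of_boost hℓ _ (isBoostValued_vielbein x)
    (isLorentzValued_curv_add_sq I hℓ hs isBoostValued_vielbein isLorentzValued_spinConn _ x)
    ((isBoostValued_torsion I hℓ hv isBoostValued_vielbein isLorentzValued_spinConn x).smul t)

theorem gravityLagrangian_eq [FiniteDimensional ℝ E] (hℓ : ℓ ≠ 0) (he : ∀ a, SmoothForm I (e a))
    (hw : ∀ a b, SmoothForm I (w a b)) (hw₀ : ∀ a b, SmoothForm I (w₀ a b)) (k : ℝ) :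
    gravityLagrangian I ℓ k e w w₀ = lovelockLagrangian I ℓ k e w +
      k • extD I (transgression₂ I (leviCivita n ℓ) (vielbein ℓ e + spinConn w) (spinConn w)
        (spinConn w₀)) := by
  have hs := smoothForm_spinConn I hw
  rw [gravityLagrangian, transgression_triangle I _ (isSymmPoly_leviCivita ℓ)
    (polyAct_leviCivita hℓ) ((smoothForm_vielbein I he).add I hs) hs (smoothForm_spinConn I hw₀),
    transgression_spinConn I hℓ hw hw₀, add_zero, smul_add, transgression_vielbein I hℓ he hw]

theorem curv_vielbein_add_spinConn [FiniteDimensional ℝ E] (he : ∀ a, SmoothForm I (e a))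
    (hw : ∀ a b, SmoothForm I (w a b)) :
    curv I (vielbein ℓ e + spinConn w) = (curv I (spinConn w) + sq (vielbein ℓ e)) +
      torsion I (vielbein ℓ e) (spinConn w) := by
  have h := curv_add_smul I (smoothForm_spinConn I hw) (smoothForm_vielbein (ℓ := ℓ) I he) 1
  rw [one_smul, one_smul, one_pow, one_smul, add_comm (spinConn w)] at h
  rw [h, torsion]
  abel

/-- The curvature of e + ω has Lorentz part R + e² and boost part T; next to a boost only the former
counts. -/
theorem angle₁_P_curv [FiniteDimensional ℝ E] (hℓ : ℓ ≠ 0) (he : ∀ a, SmoothForm I (e a)) (hw : ∀ a b, SmoothForm I (w a b))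
    {l : ℕ} (h : 0 + 2 * n = l) (a : Fin (2 * n + 1)) (x : M) :
    angle₁ (leviCivita n ℓ) h (const0 (P ℓ a)) (curv I (vielbein ℓ e + spinConn w) x) =
      angle₁ (leviCivita n ℓ) h (const0 (P ℓ a))
        ((curv I (spinConn w) + sq (vielbein ℓ e)) x) := by
  have h1 := isLorentzValued_curv_add_sq I hℓ (smoothForm_spinConn I hw)
    (isBoostValued_vielbein (e := e) (ℓ := ℓ)) isLorentzValued_spinConn 1 x
  rw [one_smul] at h1
  rw [curv_vielbein_add_spinConn I he hw]
  exact angle₁_leviCivita_of_boost hℓ _ (fun v b c => compJ_P ℓ b c a) h1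
    (isBoostValued_torsion I hℓ (smoothForm_vielbein I he) isBoostValued_vielbein
      isLorentzValued_spinConn x)

/-- Next to a Lorentz generator exactly one curvature factor contributes T; the `n` choices give
equal terms. -/
theorem angle₁_J_curv [FiniteDimensional ℝ E] (hℓ : ℓ ≠ 0) (he : ∀ a, SmoothForm I (e a)) (hw : ∀ a b, SmoothForm I (w a b))
    {l : ℕ} (h : 0 + 2 * n = l) (h' : 0 + 2 + 2 * n = l + 2) (a b : Fin (2 * n + 1)) (x : M) :
    angle₁ (leviCivita n ℓ) h (const0 (J a b)) (curv I (vielbein ℓ e + spinConn w) x) =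
      (n : ℝ) • angle₂ (leviCivita n ℓ) h' (const0 (J a b))
        (torsion I (vielbein ℓ e) (spinConn w) x)
        ((curv I (spinConn w) + sq (vielbein ℓ e)) x) := by
  have h1 := isLorentzValued_curv_add_sq I hℓ (smoothForm_spinConn I hw)
    (isBoostValued_vielbein (e := e) (ℓ := ℓ)) isLorentzValued_spinConn 1 x
  rw [one_smul] at h1
  rw [curv_vielbein_add_spinConn I he hw]
  exact angle₁_leviCivita_add hℓ _ _ (fun v c => compP_J ℓ c a b) h1
    (isBoostValued_torsion I hℓ (smoothForm_vielbein I he) isBoostValued_vielbein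
      isLorentzValued_spinConn x)

end Gravity

/-! ### Top-degree forms: nondegeneracy of the wedge pairing and Stokes' theorem. -/

section TopForms

variable {E : Type*} [NormedAddCommGroup E] [NormedSpace ℝ E]

theorem wedge_oneForm_apply {q : ℕ} (lam : E →L[ℝ] ℝ) (μ : E [⋀^Fin q]→L[ℝ] ℝ)
    (v : Fin (q + 1) → E) :
    wedge (smulPairing ℝ) (add_comm 1 q) (oneForm lam) μ v =
      ∑ i : Fin (q + 1), (-1 : ℤ) ^ (i : ℕ) • (lam (v i) * μ (i.removeNth v)) := by
  rw [← alternatizeUncurryFin_eq_wedge (smulPairing ℝ) _ (oneForm lam) μ (lam.smulRight μ)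
    fun v u => by simp [smulPairing], ContinuousAlternatingMap.alternatizeUncurryFin_apply]
  rfl

/-- On the basis, the wedge with the `j`-th coordinate returns, up to sign, the value of `μ` on the
basis with the `j`-th vector left out. Any injective `q`-tuple of basis vectors misses one index,
hence is a permutation of such a list. -/
theorem eq_zero_of_wedge_coord {q : ℕ} (b : Module.Basis (Fin (q + 1)) ℝ E)
    [FiniteDimensional ℝ E] {μ : E [⋀^Fin q]→L[ℝ] ℝ}
    (h : ∀ j, wedge (smulPairing ℝ) (add_comm 1 q)
      (oneForm (LinearMap.toContinuousLinearMap (b.coord j))) μ b = 0) : μ = 0 := by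
  have h1 : ∀ j : Fin (q + 1), μ (fun i => b (j.succAbove i)) = 0 := fun j => by
    have h2 := h j
    rw [wedge_oneForm_apply, Finset.sum_eq_single j] at h2
    · have h3 : μ (j.removeNth b) = 0 := by simpa using h2
      exact h3
    · intro i _ hi
      simp [hi]
    · simp
  apply ContinuousAlternatingMap.toAlternatingMap_injective
  refine Module.Basis.ext_alternating b fun v hv => ?_
  obtain ⟨j, hj⟩ : ∃ j, ∀ i, v i ≠ j := by
    by_contra! hc
    have := Fintype.card_le_of_surjective v hc
    simp at this
  have h2 : ∀ i, ∃ k, j.succAbove k = v i := fun i => Fin.exists_succAbove_eq (hj i)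
  choose σ hσ using h2
  have hσi : Function.Injective σ := fun i k hik => hv (by rw [← hσ, ← hσ, hik])
  let τ : Equiv.Perm (Fin q) := Equiv.ofBijective σ (Finite.injective_iff_bijective.1 hσi)
  have h3 : (fun i => b (v i)) = (fun i => b (j.succAbove i)) ∘ τ := by
    funext i
    exact congrArg b (hσ i).symm
  rw [h3, AlternatingMap.map_perm]
  have h4 : μ.toAlternatingMap (fun i => b (j.succAbove i)) = 0 := h1 j
  rw [h4, smul_zero]
  rfl

variable [FiniteDimensional ℝ E] [MeasurableSpace E] [BorelSpace E] (ν : Measure E)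
  [ν.IsAddHaarMeasure]

/-- Integration by parts against the constant function 1. -/
theorem integral_fderiv_eq_zero {h : E → ℝ} (hh : ContDiff ℝ ∞ h) (hc : HasCompactSupport h)
    (u : E) : ∫ y, fderiv ℝ h y u ∂ν = 0 := by
  have hd : Continuous fun y => fderiv ℝ h y u :=
    (hh.continuous_fderiv (by simp)).clm_apply continuous_const
  have h1 := integral_mul_fderiv_eq_neg_fderiv_mul_of_integrable (μ := ν) (f := fun _ : E => (1 : ℝ))
    (g := h) (v := u) (by simp)
    (by simpa using hd.integrable_of_hasCompactSupport (hc.fderiv_apply (𝕜 := ℝ) u))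
    (by simpa using hh.continuous.integrable_of_hasCompactSupport hc)
    (fun _ _ => differentiableAt_const _) fun y _ => hh.differentiable (by simp) y
  simpa using h1

/-- Stokes' theorem for forms with compact support in the interior of their domain. -/
theorem setIntegral_extDerivWithin_eq_zero {q : ℕ} {T K : Set E} (hK : IsCompact K)
    (hKT : K ⊆ interior T) {η : E → E [⋀^Fin q]→L[ℝ] ℝ} (hη : ContDiffOn ℝ ∞ η T)
    (h0 : ∀ y ∈ T, y ∉ K → η y = 0) (v : Fin (q + 1) → E) :
    ∫ y in K, extDerivWithin η T y v ∂ν = 0 := by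
  classical
  -- Extension by zero. It is smooth on the whole space, since `η` vanishes on `T` outside `K` and
  -- `K` lies in the interior of `T`; the boundary of `T` thus plays no role.
  let ζ : E → E [⋀^Fin q]→L[ℝ] ℝ := K.indicator η
  have hζT : ∀ y ∈ interior T, ζ =ᶠ[𝓝 y] η := fun y hy => by
    filter_upwards [isOpen_interior.mem_nhds hy] with z hz
    by_cases hzK : z ∈ K
    · exact indicator_of_mem hzK _
    · rw [h0 z (interior_subset hz) hzK]
      exact indicator_of_notMem hzK _
  have hζK : ∀ y ∉ K, ζ =ᶠ[𝓝 y] fun _ => 0 := fun y hy => by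
    filter_upwards [hK.isClosed.isOpen_compl.mem_nhds hy] with z hz
    exact indicator_of_notMem hz _
  have hζ : ContDiff ℝ ∞ ζ := contDiff_iff_contDiffAt.2 fun y => by
    by_cases hy : y ∈ interior T
    · exact (hη.contDiffAt (mem_interior_iff_mem_nhds.1 hy)).congr_of_eventuallyEq (hζT y hy)
    · exact contDiffAt_const.congr_of_eventuallyEq (hζK y fun h => hy (hKT h))
  have hsupp : HasCompactSupport ζ := HasCompactSupport.of_support_subset_isCompact hK
    support_indicator_subset
  have h1 : ∀ y ∈ K, extDerivWithin η T y v = extDeriv ζ y v := fun y hy => by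
    rw [Filter.EventuallyEq.extDeriv_eq (hζT y (hKT hy)), extDerivWithin, extDeriv,
      fderivWithin_of_mem_nhds (mem_interior_iff_mem_nhds.1 (hKT hy))]
  have h2 : ∀ y ∉ K, extDeriv ζ y v = 0 := fun y hy => by
    rw [Filter.EventuallyEq.extDeriv_eq (hζK y hy), extDeriv, fderiv_fun_const]
    exact congrArg (fun γ : E [⋀^Fin (q + 1)]→L[ℝ] ℝ => γ v)
      (map_zero (ContinuousAlternatingMap.alternatizeUncurryFinCLM ℝ E ℝ))
  rw [setIntegral_congr_fun hK.measurableSet h1,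
    setIntegral_eq_integral_of_forall_compl_eq_zero fun y hy => h2 y hy]
  have h3 : ∀ i : Fin (q + 1), ContDiff ℝ ∞ (fun y => ζ y (i.removeNth v)) := fun i =>
    (ContinuousAlternatingMap.apply ℝ E ℝ (i.removeNth v)).contDiff.comp hζ
  have h4 : ∀ i : Fin (q + 1), HasCompactSupport (fun y => ζ y (i.removeNth v)) := fun i =>
    hsupp.comp_left (g := fun γ : E [⋀^Fin q]→L[ℝ] ℝ => γ (i.removeNth v)) rfl
  have h5 : ∀ y, extDeriv ζ y v = ∑ i : Fin (q + 1), (-1 : ℝ) ^ (i : ℕ) *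
      fderiv ℝ (fun y => ζ y (i.removeNth v)) y (v i) := fun y => by
    rw [extDeriv_apply (hζ.differentiable (by simp) y)]
    refine Finset.sum_congr rfl fun i _ => ?_
    rw [zsmul_eq_mul]
    push_cast
    rfl
  have h6 : ∀ i : Fin (q + 1), Integrable (fun y =>
      fderiv ℝ (fun y => ζ y (i.removeNth v)) y (v i)) ν := fun i =>
    (((h3 i).continuous_fderiv (by simp)).clm_apply
      continuous_const).integrable_of_hasCompactSupport ((h4 i).fderiv_apply (𝕜 := ℝ) _)
  simp only [h5]
  rw [integral_finsetSum _ fun i _ => (h6 i).const_mul _]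
  refine Finset.sum_eq_zero fun i _ => ?_
  rw [integral_const_mul, integral_fderiv_eq_zero ν (h3 i) (h4 i), mul_zero]

end TopForms

/-! ### Smoothness of polynomial families and derivatives of their integrals. -/

section PolynomialFamilies

variable {E X : Type*} [NormedAddCommGroup E] [NormedSpace ℝ E]
  [NormedAddCommGroup X] [NormedSpace ℝ X] {S : Set E}

theorem IsPolyFamily.contDiffOn {φ : ℝ → ℝ → E → X} (hφ : IsPolyFamily S φ) (t s : ℝ) :
    ContDiffOn ℝ ∞ (φ t s) S := by
  obtain ⟨ι, _, a, b, c, hc, e⟩ := hφ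
  exact (ContDiffOn.sum (s := Finset.univ) fun i _ =>
    (hc i).const_smul (t ^ a i * s ^ b i)).congr fun y hy => e t s y hy

theorem IsPolyFamily.contDiffOn_integral_fst [CompleteSpace X] {φ : ℝ → ℝ → E → X}
    (hφ : IsPolyFamily S φ) (s : ℝ) :
    ContDiffOn ℝ ∞ (fun y => ∫ t in (0 : ℝ)..1, φ t s y) S := by
  obtain ⟨ι, _, a, b, c, hc, e⟩ := hφ
  refine (ContDiffOn.sum (s := Finset.univ) fun i _ =>
    (hc i).const_smul (s ^ b i * ((a i : ℝ) + 1)⁻¹)).congr fun y hy => ?_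
  refine Eq.trans ?_ (integral_sum_monomial (fun i => s ^ b i) a fun i => c i y)
  simp only [fun t s => e t s y hy, mul_comm]

/-- The function is a polynomial in `s` without constant term, and its linear coefficient is the
integral of the family at parameter zero. -/
theorem IsPolyFamily.hasDerivAt_setIntegral [CompleteSpace X] [MeasurableSpace E] [BorelSpace E]
    (ν : Measure E) [IsFiniteMeasureOnCompacts ν] {φ : ℝ → ℝ → E → X} (hφ : IsPolyFamily S φ)
    {K : Set E} (hK : IsCompact K) (hKS : K ⊆ S) (L : X →L[ℝ] ℝ) :
    HasDerivAt (fun s : ℝ => ∫ y in K, L (s • ∫ t in (0 : ℝ)..1, φ (t * s) 0 y) ∂ν)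
      (∫ y in K, L (φ 0 0 y) ∂ν) 0 := by
  obtain ⟨ι, _, a, b, c, hc, e⟩ := hφ
  have hi : ∀ i, IntegrableOn (fun y => L (c i y)) K ν := fun i =>
    (L.continuous.comp_continuousOn ((hc i).continuousOn.mono hKS)).integrableOn_compact hK
  have h1 : ∀ s : ℝ, ∫ y in K, L (s • ∫ t in (0 : ℝ)..1, φ (t * s) 0 y) ∂ν =
      ∑ i, s ^ (a i + 1) * (0 ^ b i * ((a i : ℝ) + 1)⁻¹ * ∫ y in K, L (c i y) ∂ν) := fun s => by
    have h2 : ∀ y ∈ K, L (s • ∫ t in (0 : ℝ)..1, φ (t * s) 0 y) =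
        ∑ i, (s ^ (a i + 1) * (0 ^ b i * ((a i : ℝ) + 1)⁻¹)) * L (c i y) := fun y hy => by
      have h3 := integral_sum_monomial (fun i => s ^ a i * 0 ^ b i) a fun i => c i y
      have h4 : ∀ t, φ (t * s) 0 y = ∑ i, (s ^ a i * 0 ^ b i * t ^ a i) • c i y := fun t => by
        rw [e _ _ y (hKS hy)]
        refine Finset.sum_congr rfl fun i _ => ?_
        rw [mul_pow]
        congr 1
        ring
      simp only [h4, h3, map_smul, map_sum, Finset.smul_sum, smul_eq_mul]
      refine Finset.sum_congr rfl fun i _ => ?_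
      ring
    rw [setIntegral_congr_fun hK.measurableSet h2,
      integral_finsetSum _ fun i _ => (hi i).const_mul _]
    refine Finset.sum_congr rfl fun i _ => ?_
    rw [integral_const_mul]
    ring
  have h5 : ∫ y in K, L (φ 0 0 y) ∂ν = ∑ i, ((((a i + 1 : ℕ) : ℝ) * 0 ^ (a i + 1 - 1)) *
      (0 ^ b i * ((a i : ℝ) + 1)⁻¹ * ∫ y in K, L (c i y) ∂ν)) := by
    have h2 : ∀ y ∈ K, L (φ 0 0 y) = ∑ i, (0 ^ a i * 0 ^ b i) * L (c i y) := fun y hy => by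
      rw [e _ _ y (hKS hy)]
      simp
    rw [setIntegral_congr_fun hK.measurableSet h2,
      integral_finsetSum _ fun i _ => (hi i).const_mul _]
    refine Finset.sum_congr rfl fun i _ => ?_
    rw [integral_const_mul, Nat.add_sub_cancel]
    have : (a i : ℝ) + 1 ≠ 0 := by positivity
    push_cast
    field_simp
  simp only [h1, h5]
  exact HasDerivAt.fun_sum fun i _ => (hasDerivAt_pow (a i + 1) (0 : ℝ)).mul_const _

end PolynomialFamilies

/-! ### Pulling a real form out of the bracket. -/

section Angle

variable {E V : Type*} [NormedAddCommGroup E] [NormedSpace ℝ E] [NormedAddCommGroup V]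
  [NormedSpace ℝ V] {n : ℕ}

theorem wedge_smulPairing_const0 {X : Type*} [NormedAddCommGroup X] [NormedSpace ℝ X] {q : ℕ}
    (lam : E [⋀^Fin q]→L[ℝ] ℝ) (c : X) :
    wedge (smulPairing X) (add_zero q) lam (const0 c) =
      (ContinuousLinearMap.toSpanSingleton ℝ c).compContinuousAlternatingMap lam := by
  ext1 v
  rw [wedge_comm _ _ (zero_add q), mul_zero, pow_zero, one_smul,
    wedge_const0_apply _ _ rfl]
  rfl

/-- Separates a variation into a real test form and a generator; the latter's coefficient form is
the field equation. -/
theorem angle₁_toSpanSingleton {q l : ℕ} (f : Poly V (n + 1)) (h : q + 2 * n = l)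
    (lam : E [⋀^Fin q]→L[ℝ] ℝ) (c : V) (F : E [⋀^Fin 2]→L[ℝ] V) :
    angle₁ f h ((ContinuousLinearMap.toSpanSingleton ℝ c).compContinuousAlternatingMap lam) F =
      wedge (smulPairing ℝ) h lam (angle₁ f (zero_add (2 * n)) (const0 c) F) := by
  rw [angle₁, angle₁, fill_wedge_smulPairing h _ (add_zero q) h, ← wedge_smulPairing_const0,
    wedge_wedge_smulPairing _ _ _ (zero_add 0) (add_zero q), zero_mul, pow_zero, one_smul]

end Angle

/-! ### First variation of a transgression action. -/

section Variation

variable {E H M : Type*} [NormedAddCommGroup E] [NormedSpace ℝ E] [FiniteDimensional ℝ E]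
  [TopologicalSpace H] [TopologicalSpace M] [ChartedSpace H M] {n : ℕ}
  (I : ModelWithCorners ℝ E H) [IsManifold I ∞ M] (f : Poly (AdS n) (n + 1))
  {A₁ A₀ a₁ a₀ : DForm E M 1 (AdS n)}

/-- Two triangle equations: first with `A₁` inserted between the varied connections, then with `A₀`
inserted between `A₁` and the varied `A₀`. All dependence on `s` outside exact terms sits in the
first summand. -/
theorem transgression_variation (hf : IsSymmPoly f)
    (hinv : ∀ x, polyAct (bracket n x) (n + 1) f = 0) (h₁ : SmoothForm I A₁)
    (h₀ : SmoothForm I A₀) (h₁' : SmoothForm I a₁) (h₀' : SmoothForm I a₀) (s : ℝ)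
    (hs : transgression I f A₀ (A₀ + s • a₀) = 0) :
    transgression I f (A₁ + s • a₁) (A₀ + s • a₀) =
      transgression I f (A₁ + s • a₁) A₁ + transgression I f A₁ A₀ +
        (extD I (transgression₂ I f (A₁ + s • a₁) A₁ (A₀ + s • a₀)) +
          extD I (transgression₂ I f A₁ A₀ (A₀ + s • a₀))) := by
  have h1 := h₁.add I (h₁'.smul I s)
  have h0 := h₀.add I (h₀'.smul I s)
  rw [transgression_triangle I f hf hinv h1 h₁ h0, transgression_triangle I f hf hinv h₁ h₀ h0, hs]
  abel

theorem contDiffOn_inChart_transgression (h₁ : SmoothForm I A₁) (h₀ : SmoothForm I A₀) (x₀ : M) :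
    ContDiffOn ℝ ∞ (inChart I x₀ (transgression I f A₁ A₀)) (extChartAt I x₀).target := by
  have hT := uniqueDiffOn_extChartAt_target (I := I) x₀
  have h := (h₁.sub I h₀) x₀
  -- Only one parameter is needed; the second is a dummy, set to zero.
  refine (((((isPolyFamily_const h).angle₁ f (add_comm 1 (2 * n)) (isPolyFamily_curvOn
    (br := bracket n) hT (h₀ x₀) h h)).contDiffOn_integral_fst 0).const_smul (n + 1 : ℝ))).congr
    fun y hy => ?_
  rw [inChart_transgression I f h₁ h₀ hy, transOn]
  simp only [zero_smul, add_zero]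
  rfl

theorem SmoothForm.extD {k : ℕ} {α : DForm E M k ℝ} (hα : SmoothForm I α) :
    SmoothForm I (extD I α) := fun x₀ =>
  (contDiffOn_extDerivWithin (uniqueDiffOn_extChartAt_target x₀) (hα x₀)).congr
    fun _ hy => inChart_extD I hα hy

/-- Each difference is a factor of the integrand, so the correction terms in the variation inherit
the support of the variations. -/
theorem transgression₂_apply_eq_zero {A₂ : DForm E M 1 (AdS n)} {x : M}
    (h : (A₂ - A₁) x = 0 ∨ (A₁ - A₀) x = 0) : transgression₂ I f A₂ A₁ A₀ x = 0 := by
  rw [transgression₂]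
  rcases h with h | h <;> simp [h, angle₂_zero_left, angle₂_zero_right]

variable [MeasurableSpace E] [BorelSpace E] (ν : Measure E) [ν.IsAddHaarMeasure]
  {x₀ : M} {K : Set E}

theorem setIntegral_inChart_extD_eq_zero {q : ℕ} (hK : IsCompact K)
    (hKT : K ⊆ interior (extChartAt I x₀).target) {β : DForm E M q ℝ} (hβ : SmoothForm I β)
    (h0 : ∀ x, x ∉ (extChartAt I x₀).symm '' K → β x = 0) (v : Fin (q + 1) → E) :
    ∫ y in K, inChart I x₀ (extD I β) y v ∂ν = 0 := by
  rw [setIntegral_congr_fun hK.measurableSet fun y hy => congrArg (fun γ => γ v)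
    (inChart_extD I hβ (interior_subset (hKT hy)))]
  refine setIntegral_extDerivWithin_eq_zero ν hK hKT (hβ x₀) (fun y hy hyK => ?_) v
  rw [inChart_eq_zero_iff I β hy]
  refine h0 _ fun ⟨z, hz, hzy⟩ => hyK ?_
  rwa [← (extChartAt I x₀).symm.injOn (interior_subset (hKT hz)) hy hzy]

theorem hasDerivAt_integral_inChart_transgression (hf : IsSymmPoly f)
    (hinv : ∀ x, polyAct (bracket n x) (n + 1) f = 0) (h₁ : SmoothForm I A₁)
    (h₀ : SmoothForm I A₀) (h₁' : SmoothForm I a₁) (h₀' : SmoothForm I a₀)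
    (hs : ∀ s : ℝ, transgression I f A₀ (A₀ + s • a₀) = 0) (hK : IsCompact K)
    (hKT : K ⊆ interior (extChartAt I x₀).target)
    (h0 : ∀ x, x ∉ (extChartAt I x₀).symm '' K → a₁ x = 0 ∧ a₀ x = 0)
    (v : Fin (2 * n + 1) → E) :
    HasDerivAt (fun s : ℝ => ∫ y in K,
        inChart I x₀ (transgression I f (A₁ + s • a₁) (A₀ + s • a₀)) y v ∂ν)
      (∫ y in K, (n + 1 : ℝ) * inChart I x₀
        (fun x => angle₁ f (add_comm 1 (2 * n)) (a₁ x) (curv I A₁ x)) y v ∂ν) 0 := by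
  have hKT' : K ⊆ (extChartAt I x₀).target := hKT.trans interior_subset
  have hT := uniqueDiffOn_extChartAt_target (I := I) x₀
  have hi : ∀ {q : ℕ} {γ : E → E [⋀^Fin q]→L[ℝ] ℝ} (v : Fin q → E),
      ContDiffOn ℝ ∞ γ (extChartAt I x₀).target → IntegrableOn (fun y => γ y v) K ν :=
    fun v hγ => ((ContinuousAlternatingMap.apply ℝ E ℝ v).continuous.comp_continuousOn
      (hγ.continuousOn.mono hKT')).integrableOn_compact hK
  -- Substituting A₁ + sa₁ in the transgression formula gives `s` times the integral of `g` at
  -- parameter `t * s`; the second parameter is again a dummy.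
  let g : ℝ → ℝ → E → E [⋀^Fin (2 * n + 1)]→L[ℝ] ℝ := fun t s y =>
    angle₁ f (add_comm 1 (2 * n)) (inChart I x₀ a₁ y) (curvOn (bracket n) (extChartAt I x₀).target
      (inChart I x₀ A₁ + t • inChart I x₀ a₁ + s • inChart I x₀ a₁) y)
  have hg : IsPolyFamily (extChartAt I x₀).target g :=
    (isPolyFamily_const (h₁' x₀)).angle₁ f _ (isPolyFamily_curvOn hT (h₁ x₀) (h₁' x₀) (h₁' x₀))
  let L : E [⋀^Fin (2 * n + 1)]→L[ℝ] ℝ →L[ℝ] ℝ :=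
    (n + 1 : ℝ) • ContinuousAlternatingMap.apply ℝ E ℝ v
  have h1 : ∀ s : ℝ, ∀ y ∈ K, inChart I x₀ (transgression I f (A₁ + s • a₁) A₁) y v =
      L (s • ∫ t in (0 : ℝ)..1, g (t * s) 0 y) := fun s y hy => by
    rw [inChart_transgression I f (h₁.add I (h₁'.smul I s)) h₁ (hKT' hy), transOn,
      inChart_add, inChart_smul, add_sub_cancel_left]
    simp only [g, zero_smul, add_zero, smul_smul, Pi.smul_apply, angle₁_smul]
    rw [intervalIntegral.integral_smul]
    rfl
  -- By Stokes' theorem both exact terms integrate to zero: one contains the factor sa₁, the other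
  -- -sa₀, and both vanish outside the image of `K`.
  have h2 : ∀ s : ℝ, ∫ y in K,
      inChart I x₀ (transgression I f (A₁ + s • a₁) (A₀ + s • a₀)) y v ∂ν =
      (∫ y in K, L (s • ∫ t in (0 : ℝ)..1, g (t * s) 0 y) ∂ν) +
        ∫ y in K, inChart I x₀ (transgression I f A₁ A₀) y v ∂ν := fun s => by
    have hA₁ := h₁.add I (h₁'.smul I s)
    have hA₀ := h₀.add I (h₀'.smul I s)
    have hb := smoothForm_transgression₂ I f hA₁ h₁ hA₀
    have hb' := smoothForm_transgression₂ I f h₁ h₀ hA₀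
    rw [transgression_variation I f hf hinv h₁ h₀ h₁' h₀' s (hs s),
      ← setIntegral_congr_fun hK.measurableSet (h1 s)]
    simp only [inChart_add, Pi.add_apply, ContinuousAlternatingMap.add_apply]
    have hi₁ := hi v (contDiffOn_inChart_transgression I f hA₁ h₁ x₀)
    have hi₂ := hi v (contDiffOn_inChart_transgression I f h₁ h₀ x₀)
    have hi₃ := hi v ((hb.extD I) x₀)
    have hi₄ := hi v ((hb'.extD I) x₀)
    refine (integral_add (hi₁.add hi₂) (hi₃.add hi₄)).trans ?_
    simp only [Pi.add_apply]
    rw [integral_add hi₁ hi₂, integral_add hi₃ hi₄,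
      setIntegral_inChart_extD_eq_zero I ν hK hKT hb, setIntegral_inChart_extD_eq_zero I ν hK hKT hb',
      add_zero, add_zero]
    · intro x hx
      refine transgression₂_apply_eq_zero I f (Or.inr ?_)
      simp [(h0 x hx).2]
    · intro x hx
      refine transgression₂_apply_eq_zero I f (Or.inl ?_)
      simp [(h0 x hx).1]
  simp only [h2]
  refine ((hg.hasDerivAt_setIntegral ν hK hKT' L).add_const _).congr_deriv ?_
  refine setIntegral_congr_fun hK.measurableSet fun y hy => ?_
  simp only [inChart_angle₁_curv I f (add_comm 1 (2 * n)) a₁ h₁ (hKT' hy), g, zero_smul, add_zero]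
  rfl

end Variation

/-! ### Compactly supported test forms and the fundamental lemma of the calculus of variations. -/

section TestForms

variable {E H M : Type*} [NormedAddCommGroup E] [NormedSpace ℝ E] [FiniteDimensional ℝ E]
  [TopologicalSpace H] [TopologicalSpace M] [ChartedSpace H M]
  (I : ModelWithCorners ℝ E H) [IsManifold I ∞ M]

open Classical in
/-- The one-form that is `g • lam` in the chart at `x₀` and zero outside of it. -/
def chartForm (x₀ : M) (g : E → ℝ) (lam : E →L[ℝ] ℝ) : DForm E M 1 ℝ := fun x =>
  if x ∈ (extChartAt I x₀).source then
    g (extChartAt I x₀ x) • oneForm (lam.comp (chartDeriv I x₀ x)) else 0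

variable {x₀ : M} {g : E → ℝ} (lam : E →L[ℝ] ℝ)

theorem chartForm_eq_zero {x : M} (hx : x ∉ (extChartAt I x₀).symm '' tsupport g) :
    chartForm I x₀ g lam x = 0 := by
  rw [chartForm]
  split_ifs with h
  · rw [image_eq_zero_of_notMem_tsupport fun hg => hx ⟨_, hg, (extChartAt I x₀).left_inv h⟩,
      zero_smul]
  · rfl

theorem inChart_chartForm_of_mem {x₁ : M} {z : E}
    (hz : (extChartAt I x₁).symm z ∈ (extChartAt I x₀).source) :
    inChart I x₁ (chartForm I x₀ g lam) z = g (extChartAt I x₀ ((extChartAt I x₁).symm z)) •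
      oneForm (lam.comp ((chartDeriv I x₀ ((extChartAt I x₁).symm z)).comp
        (chartInvDeriv I x₁ z))) := by
  rw [inChart_apply, chartForm, if_pos hz]
  rfl

theorem inChart_chartForm {y : E} (hy : y ∈ (extChartAt I x₀).target) :
    inChart I x₀ (chartForm I x₀ g lam) y = g y • oneForm lam := by
  have hx := (extChartAt I x₀).map_target hy
  have h := chartDeriv_comp_chartInvDeriv I hx
  rw [(extChartAt I x₀).right_inv hy] at h
  rw [inChart_chartForm_of_mem I lam hx, h, (extChartAt I x₀).right_inv hy,
    ContinuousLinearMap.comp_id]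

theorem contDiff_oneForm : ContDiff ℝ ∞ (oneForm : (E →L[ℝ] ℝ) → E [⋀^Fin 1]→L[ℝ] ℝ) := by
  let L : (E →L[ℝ] ℝ) →ₗ[ℝ] E [⋀^Fin 1]→L[ℝ] ℝ :=
    { toFun := oneForm
      map_add' := fun _ _ => rfl
      map_smul' := fun _ _ => rfl }
  exact (LinearMap.toContinuousLinearMap L).contDiff

theorem smoothForm_chartForm [T2Space M] (hg : ContDiff ℝ ∞ g) (hgc : HasCompactSupport g)
    (hgT : tsupport g ⊆ (extChartAt I x₀).target) : SmoothForm I (chartForm I x₀ g lam) := by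
  intro x₁ y hy
  by_cases hx : (extChartAt I x₁).symm y ∈ (extChartAt I x₀).source
  · refine ContDiffWithinAt.congr_set ?_ (coordChange_domain_eventuallyEq I hy hx)
    set S : Set E :=
      (extChartAt I x₁).target ∩ (extChartAt I x₁).symm ⁻¹' (extChartAt I x₀).source with hS
    have hψ : ContDiffOn ℝ ∞ (extChartAt I x₀ ∘ (extChartAt I x₁).symm) S :=
      contDiffOn_coordChange I x₁ x₀
    have hd : ContDiffOn ℝ ∞ (fderivWithin ℝ (extChartAt I x₀ ∘ (extChartAt I x₁).symm) S) S :=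
      hψ.fderivWithin (uniqueDiffOn_coordChange I x₁ x₀) (by simp)
    refine (((hg.comp_contDiffOn hψ).smul (contDiff_oneForm.comp_contDiffOn
      ((contDiffOn_const (c := lam)).clm_comp hd))).congr fun z hz => ?_) y ⟨hy, hx⟩
    rw [inChart_chartForm_of_mem I lam hz.2, ← fderivWithin_coordChange I hz]
    rfl
  · have hC : IsClosed ((extChartAt I x₀).symm '' tsupport g) :=
      (hgc.image_of_continuousOn ((continuousOn_extChartAt_symm x₀).mono hgT)).isClosed
    have hy' : (extChartAt I x₁).symm y ∉ (extChartAt I x₀).symm '' tsupport g := by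
      rintro ⟨z, hz, e⟩
      exact hx (e ▸ (extChartAt I x₀).map_target (hgT hz))
    have h0 : inChart I x₁ (chartForm I x₀ g lam) =ᶠ[𝓝 y] fun _ => 0 := by
      filter_upwards [(continuousAt_extChartAt_symm'' hy).preimage_mem_nhds
        (hC.isOpen_compl.mem_nhds hy')] with z hz
      rw [inChart_apply, chartForm_eq_zero I lam hz]
      rfl
    exact (contDiffAt_const.congr_of_eventuallyEq h0).contDiffWithinAt

variable [MeasurableSpace E] [BorelSpace E] (ν : Measure E) [ν.IsAddHaarMeasure]

/-- The fundamental lemma of the calculus of variations for forms. -/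
theorem eq_zero_of_forall_integral_wedge_eq_zero [T2Space M] {q : ℕ}
    (b : Module.Basis (Fin (q + 1)) ℝ E)
    {μ : DForm E M q ℝ} (hμ : SmoothForm I μ)
    (h : ∀ (x₀ : M) (K : Set E), IsCompact K → K ⊆ interior (extChartAt I x₀).target →
      ∀ θ : DForm E M 1 ℝ, SmoothForm I θ → (∀ x, x ∉ (extChartAt I x₀).symm '' K → θ x = 0) →
      ∫ y in K, inChart I x₀
        (fun x => wedge (smulPairing ℝ) (add_comm 1 q) (θ x) (μ x)) y b ∂ν = 0) : μ = 0 := by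
  refine eq_of_inChart_eq I fun x₀ => ?_
  set T := (extChartAt I x₀).target with hT
  have hc := (hμ x₀).continuousOn
  have h1 : ∀ y ∈ interior T, inChart I x₀ μ y = 0 := by
    have h2 : ∀ j : Fin (q + 1), ∀ y ∈ interior T, wedge (smulPairing ℝ) (add_comm 1 q)
        (oneForm (LinearMap.toContinuousLinearMap (b.coord j))) (inChart I x₀ μ y) b = 0 := by
      intro j
      set lam := LinearMap.toContinuousLinearMap (b.coord j)
      let u : E → ℝ := fun y =>
        wedge (smulPairing ℝ) (add_comm 1 q) (oneForm lam) (inChart I x₀ μ y) b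
      have hu : ContinuousOn u (interior T) := by
        have h3 : ContDiffOn ℝ ∞ (fun y => wedge (smulPairing ℝ) (add_comm 1 q) (oneForm lam)
            (inChart I x₀ μ y)) T :=
          ((isPolyFamily_const contDiffOn_const).wedge _ _
            (isPolyFamily_const (hμ x₀))).contDiffOn 0 0
        exact (ContinuousAlternatingMap.apply ℝ E ℝ b).continuous.comp_continuousOn
          (h3.continuousOn.mono interior_subset)
      -- A bump function times a coordinate one-form is an admissible test form; this gives
      -- vanishing almost everywhere, and continuity upgrades it to all interior points.
      have h4 : ∀ᵐ y ∂ν, y ∈ interior T → u y = 0 := by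
        refine isOpen_interior.ae_eq_zero_of_integral_contDiff_smul_eq_zero
          (hu.locallyIntegrableOn isOpen_interior.measurableSet) fun g hg hgc hgT => ?_
        have h5 := h x₀ (tsupport g) hgc hgT _
          (smoothForm_chartForm I lam hg hgc (hgT.trans interior_subset))
          fun x hx => chartForm_eq_zero I lam hx
        rw [← setIntegral_eq_integral_of_forall_compl_eq_zero (s := tsupport g) fun y hy => by
          rw [image_eq_zero_of_notMem_tsupport hy, zero_smul], ← h5]
        refine setIntegral_congr_fun (isClosed_tsupport g).measurableSet fun y hy => ?_
        rw [inChart_wedge, inChart_chartForm I lam (interior_subset (hgT hy)), wedge_smul_left]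
        rfl
      have h6 : u =ᵐ[ν.restrict (interior T)] fun _ => 0 :=
        (ae_restrict_iff' isOpen_interior.measurableSet).2 h4
      exact Measure.eqOn_open_of_ae_eq h6 isOpen_interior hu continuousOn_const
    exact fun y hy => eq_zero_of_wedge_coord b fun j => h2 j y hy
  intro y hy
  -- Boundary points are reached by continuity, as the chart target lies in the closure of its
  -- interior.
  have h7 : EqOn (inChart I x₀ μ) (fun _ => 0) T := by
    refine EqOn.of_subset_closure (s := interior T) h1 hc continuousOn_const interior_subset
      (extChartAt_target_subset_closure_interior (I := I))
  exact h7 hy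

end TestForms

/-! ### Linearity in the component fields. -/

section Linearity

variable {E M : Type*} [NormedAddCommGroup E] [NormedSpace ℝ E] {n : ℕ} {ℓ : ℝ}

theorem vielbein_add_smul (e δe : Fin (2 * n + 1) → DForm E M 1 ℝ) (s : ℝ) :
    vielbein ℓ (e + s • δe) = vielbein ℓ e + s • vielbein ℓ δe := by
  funext x
  ext1 v
  simp [vielbein, tensorConst, add_smul, Finset.sum_add_distrib, Finset.smul_sum, smul_smul]

theorem spinConn_add_smul (w δw : Fin (2 * n + 1) → Fin (2 * n + 1) → DForm E M 1 ℝ) (s : ℝ) :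
    spinConn (w + s • δw) = spinConn w + s • spinConn δw := by
  funext x
  ext1 v
  simp [spinConn, tensorConst, Finset.sum_add_distrib, Finset.smul_sum, smul_smul,
    mul_assoc, mul_left_comm s]

theorem vielbein_eq_zero {e : Fin (2 * n + 1) → DForm E M 1 ℝ} {x : M} (h : ∀ a, e a x = 0) :
    vielbein ℓ e x = 0 := by
  ext1 v
  simp [vielbein, tensorConst, h]

theorem spinConn_eq_zero {w : Fin (2 * n + 1) → Fin (2 * n + 1) → DForm E M 1 ℝ} {x : M}
    (h : ∀ a b, w a b x = 0) : spinConn w x = 0 := by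
  ext1 v
  simp [spinConn, tensorConst, h]

theorem angle₁_vielbein (f : Poly (AdS n) (n + 1)) (e : Fin (2 * n + 1) → DForm E M 1 ℝ) (x : M)
    (F : E [⋀^Fin 2]→L[ℝ] AdS n) :
    angle₁ f (add_comm 1 (2 * n)) (vielbein ℓ e x) F = ∑ a, wedge (smulPairing ℝ)
      (add_comm 1 (2 * n)) (e a x) (angle₁ f (zero_add (2 * n)) (const0 (P ℓ a)) F) := by
  rw [vielbein, Finset.sum_apply, angle₁_sum]
  exact Finset.sum_congr rfl fun a _ => angle₁_toSpanSingleton ..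

theorem angle₁_spinConn (f : Poly (AdS n) (n + 1))
    (w : Fin (2 * n + 1) → Fin (2 * n + 1) → DForm E M 1 ℝ) (x : M)
    (F : E [⋀^Fin 2]→L[ℝ] AdS n) :
    angle₁ f (add_comm 1 (2 * n)) (spinConn w x) F = (1 / 2 : ℝ) • ∑ a, ∑ b,
      wedge (smulPairing ℝ) (add_comm 1 (2 * n)) (w a b x)
        (angle₁ f (zero_add (2 * n)) (const0 (J a b)) F) := by
  rw [spinConn, Pi.smul_apply, angle₁_smul, Finset.sum_apply, angle₁_sum]
  congr 1
  refine Finset.sum_congr rfl fun a _ => ?_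
  rw [Finset.sum_apply, angle₁_sum]
  exact Finset.sum_congr rfl fun b _ => angle₁_toSpanSingleton ..

end Linearity

/-! ### The field equations. -/

section Stationary

variable {n : ℕ} {H M : Type*} [TopologicalSpace H] [TopologicalSpace M] [ChartedSpace H M]
  (I : ModelWithCorners ℝ (EuclideanSpace ℝ (Fin (2 * n + 1))) H) [IsManifold I ∞ M] {ℓ : ℝ}
  {e δe : Fin (2 * n + 1) → DForm (EuclideanSpace ℝ (Fin (2 * n + 1))) M 1 ℝ}
  {w w₀ δw δw₀ : Fin (2 * n + 1) → Fin (2 * n + 1) →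
    DForm (EuclideanSpace ℝ (Fin (2 * n + 1))) M 1 ℝ}

theorem smoothForm_angle₁_const0_curv (f : Poly (AdS n) (n + 1)) (c : AdS n)
    {A : DForm (EuclideanSpace ℝ (Fin (2 * n + 1))) M 1 (AdS n)} (hA : SmoothForm I A) :
    SmoothForm I (fun x => angle₁ f (zero_add (2 * n)) (const0 c) (curv I A x)) := fun x₀ => by
  have hT := uniqueDiffOn_extChartAt_target (I := I) x₀
  have h := ((isPolyFamily_const (contDiffOn_const (c := const0 c))).angle₁ f (zero_add (2 * n))
    (isPolyFamily_curvOn (br := bracket n) hT (hA x₀) (hA x₀) (hA x₀))).contDiffOn 0 0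
  refine h.congr fun y hy => ?_
  rw [inChart_angle₁_curv I f (zero_add (2 * n)) (fun _ => const0 c) hA hy]
  simp only [zero_smul, add_zero]
  rfl

/-- The general variation formula at A₁ = e + ω and A₀ = ω̄. Its vanishing hypothesis on the
transgression between ω̄ and its variation is supplied by `transgression_spinConn`, so δω̄ leaves no
trace in the derivative. -/
theorem hasDerivAt_integralChart_gravityLagrangian (hℓ : ℓ ≠ 0) (k : ℝ)
    (he : ∀ a, SmoothForm I (e a)) (hw : ∀ a b, SmoothForm I (w a b))
    (hw₀ : ∀ a b, SmoothForm I (w₀ a b)) {x₀ : M} {K : Set (EuclideanSpace ℝ (Fin (2 * n + 1)))}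
    (hK : IsCompact K) (hKT : K ⊆ interior (extChartAt I x₀).target)
    (hδe : ∀ a, SmoothForm I (δe a)) (hδw : ∀ a b, SmoothForm I (δw a b))
    (hδw₀ : ∀ a b, SmoothForm I (δw₀ a b))
    (h0 : ∀ x, x ∉ (extChartAt I x₀).symm '' K →
      (∀ a, δe a x = 0) ∧ (∀ a b, δw a b x = 0) ∧ ∀ a b, δw₀ a b x = 0) :
    HasDerivAt (fun s : ℝ => integralChart I x₀ K
        (gravityLagrangian I ℓ k (e + s • δe) (w + s • δw) (w₀ + s • δw₀)))
      (k * ((n + 1) * integralChart I x₀ K fun x =>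
        angle₁ (leviCivita n ℓ) (add_comm 1 (2 * n)) ((vielbein ℓ δe + spinConn δw) x)
          (curv I (vielbein ℓ e + spinConn w) x))) 0 := by
  have h := hasDerivAt_integral_inChart_transgression I (leviCivita n ℓ) volume
    (isSymmPoly_leviCivita ℓ) (polyAct_leviCivita hℓ)
    ((smoothForm_vielbein (ℓ := ℓ) I he).add I (smoothForm_spinConn I hw))
    (smoothForm_spinConn I hw₀)
    ((smoothForm_vielbein (ℓ := ℓ) I hδe).add I (smoothForm_spinConn I hδw))
    (smoothForm_spinConn I hδw₀)
    (fun s => by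
      rw [← spinConn_add_smul]
      exact transgression_spinConn I hℓ hw₀ fun a b => (hw₀ a b).add I ((hδw₀ a b).smul I s))
    hK hKT
    (fun x hx => by
      obtain ⟨h1, h2, h3⟩ := h0 x hx
      rw [Pi.add_apply, vielbein_eq_zero h1, spinConn_eq_zero h2, spinConn_eq_zero h3, add_zero]
      exact ⟨rfl, rfl⟩)
    (fun i => EuclideanSpace.single i 1)
  rw [integral_const_mul] at h
  refine (h.const_mul k).congr_of_eventuallyEq (Filter.Eventually.of_forall fun s => ?_)
  simp only [integralChart, gravityLagrangian, inChart_smul, Pi.smul_apply,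
    ContinuousAlternatingMap.smul_apply, smul_eq_mul, integral_const_mul]
  rw [vielbein_add_smul, spinConn_add_smul, spinConn_add_smul, smul_add, add_add_add_comm]

theorem smoothForm_zero {E V : Type*} [NormedAddCommGroup E] [NormedSpace ℝ E]
    [NormedAddCommGroup V] [NormedSpace ℝ V] {H M : Type*} [TopologicalSpace H]
    [TopologicalSpace M] [ChartedSpace H M] (I : ModelWithCorners ℝ E H) {k : ℕ} :
    SmoothForm I (0 : DForm E M k V) := fun x₀ => by
  rw [inChart_zero]
  exact contDiffOn_const

/-- The field equations, in terms of the curvature of the connection `e + ω`. -/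
theorem isStationary_iff [T2Space M] (hℓ : ℓ ≠ 0) {k : ℝ} (hk : k ≠ 0)
    (he : ∀ a, SmoothForm I (e a)) (hw : ∀ a b, SmoothForm I (w a b))
    (hw₀ : ∀ a b, SmoothForm I (w₀ a b)) :
    IsStationary I ℓ k e w w₀ ↔
      (∀ (a b : Fin (2 * n + 1)) (x : M), angle₁ (leviCivita n ℓ) (zero_add (2 * n))
        (const0 (J a b)) (curv I (vielbein ℓ e + spinConn w) x) = 0) ∧
      ∀ (a : Fin (2 * n + 1)) (x : M), angle₁ (leviCivita n ℓ) (zero_add (2 * n))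
        (const0 (P ℓ a)) (curv I (vielbein ℓ e + spinConn w) x) = 0 := by
  classical
  set F := curv I (vielbein ℓ e + spinConn w) with hF
  have hA := (smoothForm_vielbein (ℓ := ℓ) I he).add I (smoothForm_spinConn I hw)
  have hz : SmoothForm I (0 : DForm (EuclideanSpace ℝ (Fin (2 * n + 1))) M 1 ℝ) :=
    smoothForm_zero I
  have hcoe : ⇑(EuclideanSpace.basisFun (Fin (2 * n + 1)) ℝ).toBasis =
      fun i => EuclideanSpace.single i (1 : ℝ) := by
    funext i
    simp
  constructor
  · intro hs
    -- Variations with δω̄ = 0 already yield all the equations.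
    have key : ∀ (x₀ : M) (K : Set (EuclideanSpace ℝ (Fin (2 * n + 1)))), IsCompact K →
        K ⊆ interior (extChartAt I x₀).target →
        ∀ (δe : Fin (2 * n + 1) → DForm (EuclideanSpace ℝ (Fin (2 * n + 1))) M 1 ℝ)
          (δw : Fin (2 * n + 1) → Fin (2 * n + 1) →
            DForm (EuclideanSpace ℝ (Fin (2 * n + 1))) M 1 ℝ),
        (∀ a, SmoothForm I (δe a)) → (∀ a b, SmoothForm I (δw a b)) →
        (∀ x, x ∉ (extChartAt I x₀).symm '' K → (∀ a, δe a x = 0) ∧ ∀ a b, δw a b x = 0) →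
        integralChart I x₀ K (fun x => angle₁ (leviCivita n ℓ) (add_comm 1 (2 * n))
          ((vielbein ℓ δe + spinConn δw) x) (F x)) = 0 := by
      intro x₀ K hK hKT δe δw hδe hδw h0
      have h0' : ∀ x, x ∉ (extChartAt I x₀).symm '' K →
          (∀ a, δe a x = 0) ∧ (∀ a b, δw a b x = 0) ∧ ∀ a b,
            (0 : Fin (2 * n + 1) → Fin (2 * n + 1) →
              DForm (EuclideanSpace ℝ (Fin (2 * n + 1))) M 1 ℝ) a b x = 0 :=
        fun x hx => ⟨(h0 x hx).1, (h0 x hx).2, fun _ _ => rfl⟩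
      have h1 := (hasDerivAt_integralChart_gravityLagrangian I hℓ k he hw hw₀ hK hKT hδe hδw
        (fun _ _ => hz) h0').unique (hs x₀ K hK hKT δe δw 0 hδe hδw (fun _ _ => hz) h0')
      have hn : (n + 1 : ℝ) ≠ 0 := by positivity
      exact (mul_eq_zero.1 ((mul_eq_zero.1 h1).resolve_left hk)).resolve_left hn
    have hwedge : ∀ c : AdS n, (∀ (x₀ : M) (K : Set (EuclideanSpace ℝ (Fin (2 * n + 1)))),
        IsCompact K → K ⊆ interior (extChartAt I x₀).target →
        ∀ θ : DForm (EuclideanSpace ℝ (Fin (2 * n + 1))) M 1 ℝ, SmoothForm I θ →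
          (∀ x, x ∉ (extChartAt I x₀).symm '' K → θ x = 0) →
          integralChart I x₀ K (fun x => wedge (smulPairing ℝ) (add_comm 1 (2 * n)) (θ x)
            (angle₁ (leviCivita n ℓ) (zero_add (2 * n)) (const0 c) (F x))) = 0) →
        ∀ x, angle₁ (leviCivita n ℓ) (zero_add (2 * n)) (const0 c) (F x) = 0 := by
      intro c h
      refine congrFun (eq_zero_of_forall_integral_wedge_eq_zero I volume
        (EuclideanSpace.basisFun (Fin (2 * n + 1)) ℝ).toBasis
        (smoothForm_angle₁_const0_curv I (leviCivita n ℓ) c hA) ?_)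
      rw [hcoe]
      exact h
    refine ⟨fun a b => hwedge _ fun x₀ K hK hKT θ hθ h0 => ?_,
      fun a => hwedge _ fun x₀ K hK hKT θ hθ h0 => ?_⟩
    · have h1 := key x₀ K hK hKT 0 (Pi.single a (Pi.single b θ)) (fun _ => hz)
        (fun c d => by
          by_cases hc : c = a
          · subst hc
            by_cases hd : d = b
            · subst hd
              simpa using hθ
            · simpa [Pi.single_eq_of_ne hd] using hz
          · simpa [Pi.single_eq_of_ne hc] using hz)
        (fun x hx => ⟨fun _ => rfl, fun c d => by
          by_cases hc : c = a
          · subst hc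
            by_cases hd : d = b
            · subst hd
              simpa using h0 x hx
            · simp [Pi.single_eq_of_ne hd]
          · simp [Pi.single_eq_of_ne hc]⟩)
      have h2 : ∀ x, angle₁ (leviCivita n ℓ) (add_comm 1 (2 * n))
          ((vielbein ℓ 0 + spinConn (Pi.single a (Pi.single b θ)) :
            DForm (EuclideanSpace ℝ (Fin (2 * n + 1))) M 1 (AdS n)) x) (F x) =
          (1 / 2 : ℝ) • wedge (smulPairing ℝ) (add_comm 1 (2 * n)) (θ x)
            (angle₁ (leviCivita n ℓ) (zero_add (2 * n)) (const0 (J a b)) (F x)) := fun x => by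
        rw [Pi.add_apply, vielbein_eq_zero (e := 0) fun _ => rfl, zero_add, angle₁_spinConn,
          Finset.sum_eq_single a, Finset.sum_eq_single b, Pi.single_eq_same, Pi.single_eq_same]
        · intro d _ hd
          rw [Pi.single_eq_same, Pi.single_eq_of_ne hd]
          exact wedge_zero_left ..
        · simp
        · intro c _ hc
          rw [Pi.single_eq_of_ne hc]
          exact Finset.sum_eq_zero fun d _ => wedge_zero_left ..
        · simp
      rw [funext h2] at h1
      have h3 := (integral_const_mul (1 / 2 : ℝ) _).symm.trans h1
      exact (mul_eq_zero.1 h3).resolve_left (by norm_num)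
    · have h1 := key x₀ K hK hKT (Pi.single a θ) 0
        (fun c => by
          by_cases hc : c = a
          · subst hc
            simpa using hθ
          · simpa [Pi.single_eq_of_ne hc] using hz)
        (fun _ _ => hz)
        (fun x hx => ⟨fun c => by
          by_cases hc : c = a
          · subst hc
            simpa using h0 x hx
          · simp [Pi.single_eq_of_ne hc], fun _ _ => rfl⟩)
      have h2 : ∀ x, angle₁ (leviCivita n ℓ) (add_comm 1 (2 * n))
          ((vielbein ℓ (Pi.single a θ) + spinConn 0 :
            DForm (EuclideanSpace ℝ (Fin (2 * n + 1))) M 1 (AdS n)) x) (F x) =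
          wedge (smulPairing ℝ) (add_comm 1 (2 * n)) (θ x)
            (angle₁ (leviCivita n ℓ) (zero_add (2 * n)) (const0 (P ℓ a)) (F x)) := fun x => by
        rw [Pi.add_apply, spinConn_eq_zero (w := 0) fun _ _ => rfl, add_zero, angle₁_vielbein,
          Finset.sum_eq_single a, Pi.single_eq_same]
        · intro c _ hc
          rw [Pi.single_eq_of_ne hc]
          exact wedge_zero_left ..
        · simp
      rwa [funext h2] at h1
  · rintro ⟨hJ, hP⟩ x₀ K hK hKT δe δw δw₀ hδe hδw hδw₀ h0
    refine (hasDerivAt_integralChart_gravityLagrangian I hℓ k he hw hw₀ hK hKT hδe hδw hδw₀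
      h0).congr_deriv ?_
    have h1 : (fun x => angle₁ (leviCivita n ℓ) (add_comm 1 (2 * n))
        ((vielbein ℓ δe + spinConn δw) x) (F x)) = 0 := by
      funext x
      rw [Pi.add_apply, angle₁_add, angle₁_vielbein, angle₁_spinConn]
      simp only [hJ, hP, wedge_zero_right, Finset.sum_const_zero, smul_zero, add_zero]
      rfl
    rw [h1, integralChart, inChart_zero]
    simp

end Stationary

end TGFT

end

/-! ### Assembly of the three statements. -/

theorem mainTheorem5 (n : ℕ) (hn : 1 ≤ n) (ℓ k : ℝ) (hℓ : 0 < ℓ)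
    {H M : Type*} [TopologicalSpace H] [TopologicalSpace M] [ChartedSpace H M] [T2Space M]
    (I : ModelWithCorners ℝ (EuclideanSpace ℝ (Fin (2 * n + 1))) H) [IsManifold I ∞ M]
    (e : Fin (2 * n + 1) → DForm (EuclideanSpace ℝ (Fin (2 * n + 1))) M 1 ℝ)
    (w w₀ : Fin (2 * n + 1) → Fin (2 * n + 1) →
      DForm (EuclideanSpace ℝ (Fin (2 * n + 1))) M 1 ℝ)
    (he : ∀ a, SmoothForm I (e a)) (hw : ∀ a b, SmoothForm I (w a b))
    (hw₀ : ∀ a b, SmoothForm I (w₀ a b)) :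
    SmoothForm I (transgression₂ I (leviCivita n ℓ) (vielbein ℓ e + spinConn w) (spinConn w)
      (spinConn w₀)) ∧
    gravityLagrangian I ℓ k e w w₀ =
      lovelockLagrangian I ℓ k e w +
        k • extD I (transgression₂ I (leviCivita n ℓ) (vielbein ℓ e + spinConn w) (spinConn w)
          (spinConn w₀)) ∧
    transgression I (leviCivita n ℓ) (spinConn w) (spinConn w₀) = 0 ∧
    (k ≠ 0 → (IsStationary I ℓ k e w w₀ ↔
      (∀ (a b : Fin (2 * n + 1)) (x : M),
        angle₂ (l := 2 * n) (leviCivita n ℓ) (by omega) (const0 (J a b))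
          (torsion I (vielbein ℓ e) (spinConn w) x)
          ((curv I (spinConn w) + sq (vielbein ℓ e)) x) = 0) ∧
      (∀ (a : Fin (2 * n + 1)) (x : M),
        angle₁ (l := 2 * n) (leviCivita n ℓ) (by omega) (const0 (P ℓ a))
          ((curv I (spinConn w) + sq (vielbein ℓ e)) x) = 0))) := by
  have hℓ' : ℓ ≠ 0 := hℓ.ne'
  have hs := smoothForm_spinConn I hw
  have hA := (smoothForm_vielbein (ℓ := ℓ) I he).add I hs
  refine ⟨smoothForm_transgression₂ I _ hA hs (smoothForm_spinConn I hw₀),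
    gravityLagrangian_eq I hℓ' he hw hw₀ k, transgression_spinConn I hℓ' hw hw₀, fun hk => ?_⟩
  -- The Lorentz equations come with a factor `n` from the choice of the torsion slot, and it must
  -- be divided out.
  have hn' : (n : ℝ) ≠ 0 := Nat.cast_ne_zero.2 (by omega)
  rw [isStationary_iff I hℓ' hk he hw hw₀]
  refine and_congr (forall_congr' fun a => forall_congr' fun b => forall_congr' fun x => ?_)
    (forall_congr' fun a => forall_congr' fun x => ?_)
  · rw [angle₁_J_curv I hℓ' he hw _ (by omega), smul_eq_zero_iff_right hn']
  · rw [angle₁_P_curv I hℓ' he hw]
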